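/- Let $d\ge 2$, let $\Omega\subset\mathbb R^d$ be a bounded polyhedral Lipschitz domain and let $\gamma>0$. Then there is a constant $C>0$, depending only on $\Omega$ and $\gamma$, such that the following holds. Let $\mathcal T_H$ be a regular (conforming) finite mesh of $\Omega$ into nondegenerate closed simplices with $\max_{T\in\mathcal T_H}\operatorname{diam}T/\operatorname{diam}B_T\le\gamma$, where $B_T$ is the largest ball contained in $T$. Let $\mathsf H\in L^\infty(\Omega)$ be the mesh-size function, $\mathsf H|_T=\operatorname{diam}T$, and let $H:=\|\mathsf H\|_{L^\infty(\Omega)}$ be the maximal mesh size. Let $V_H$ be the space of functions in $H^1_0(\Omega)$ that are affine on each $T\in\mathcal T_H$, let $\mathcal N_H$ be the set of vertices of $\mathcal T_H$ in $\Omega$ and $\phi_z$ ($z\in\mathcal N_H$) the nodal basis (hat) functions, and let $$\mathcal I_Hv:=\sum_{z\in\mathcal N_H}\frac{(v,\phi_z)_{L^2(\Omega)}}{(1,\phi_z)_{L^2(\Omega)}}\,\phi_z .$$ Let $A$ be a measurable symmetric matrix field on $\Omega$ with spectrum in $[\alpha,\beta]$ almost everywhere, $0<\alpha\le\beta<\infty$;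 put $a(u,v):=\int_\Omega (A\nabla u)\cdot\nabla v\,dx$ and $|||v|||:=\sqrt{a(v,v)}$. Let $V_h$ be any linear space, of finite or infinite dimension, with $V_H\subseteq V_h\subseteq H^1_0(\Omega)$. Let $V_f:=\{v\in V_h:\mathcal I_Hv=0\}$, let $P_f v\in V_f$ denote the $a$-orthogonal projection of $v$ to $V_f$, i.e. $a(P_fv,w)=a(v,w)$ for all $w\in V_f$, and let $V_c:=(1-P_f)V_H$ (if $V_h$ is not closed, $V_c$ consists of the $v-P_fv$ for those $v\in V_H$ for which $P_fv$ exists). Then for all $v_c\in V_c$ and all $v_f\in V_f$, with $\|\cdot\|$ the norm of $L^2(\Omega)$, $$(v_c,v_f)_{L^2(\Omega)}\le C\,H^2\|\nabla v_c\|\,\|\nabla v_f\|,\qquad H^2\|\nabla v_c\|\,\|\nabla v_f\|\le\alpha^{-1}H^2\,|||v_c|||\,|||v_f|||,$$ and $$\|v_c\|^2+\|\mathsf H^{-1}v_f\|^2\le C\,\alpha^{-1}\,|||v_c+v_f|||^2 .$$ -/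

import Mathlib

open MeasureTheory

noncomputable section

namespace TwoScale

/-- Euclidean space of dimension `d`. -/
abbrev E (d : ℕ) : Type := EuclideanSpace ℝ (Fin d)

variable {d : ℕ}

/-! ### The domain -/

/-- A bounded Lipschitz domain: nonempty, open, connected, bounded, and near every boundary point,
in suitable orthonormal coordinates, the set of points lying strictly above the graph of a Lipschitz
function. Here `e` is the unit vector of the vertical axis and `y - ⟪y, e⟫ e` is the horizontal part
of `y`. -/
structure IsLipschitzDomain (Ω : Set (E d)) : Prop where
  isOpen : IsOpen Ω
  isConnected : IsConnected Ω
  isBounded : Bornology.IsBounded Ω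
  lipschitz_boundary : ∀ x ∈ frontier Ω, ∃ (r : ℝ) (e : E d) (K : NNReal) (ψ : E d → ℝ),
    0 < r ∧ ‖e‖ = 1 ∧ LipschitzWith K ψ ∧
      ∀ y ∈ Metric.ball x r, (y ∈ Ω ↔ ψ (y - inner ℝ y e • e) < inner ℝ y e)

/-! ### The Sobolev space `H¹₀(Ω)` -/

/-- Pairs `(u, g)` of a function in `L²(Ω)` and a vector field in `L²(Ω; ℝᵈ)`. A function of `H¹(Ω)`
is represented by the pair of itself and its weak gradient. -/
abbrev Pairs (Ω : Set (E d)) : Type :=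
  Lp ℝ 2 (volume.restrict Ω) × Lp (E d) 2 (volume.restrict Ω)

/-- The pairs `(φ, ∇φ)` with `φ` smooth and compactly supported in `Ω`. -/
def testPairs (Ω : Set (E d)) : Set (Pairs Ω) :=
  {p | ∃ φ : E d → ℝ, ContDiff ℝ (⊤ : ℕ∞) φ ∧ HasCompactSupport φ ∧ tsupport φ ⊆ Ω ∧
    p.1 =ᵐ[volume.restrict Ω] φ ∧ p.2 =ᵐ[volume.restrict Ω] gradient φ}

/-- `H¹₀(Ω)`: the closure of the smooth compactly supported functions in the `H¹` topology. An element
`v` is the pair of the function `v.1` and its weak gradient `v.2` (which `v.1` determines). -/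
def H10 (Ω : Set (E d)) : Submodule ℝ (Pairs Ω) :=
  (Submodule.span ℝ (testPairs Ω)).topologicalClosure

/-! ### Simplicial meshes; a simplex is given by its finite set of vertices -/

/-- The closed simplex with vertex set `T`. -/
def cell (T : Finset (E d)) : Set (E d) := convexHull ℝ (T : Set (E d))

/-- Regular (conforming) finite element meshes of `Ω`: finitely many nondegenerate closed
`d`-simplices that cover the closure of `Ω`, any two of which meet in a common face or not at all. -/
structure IsRegularMesh (Ω : Set (E d)) (𝒯 : Finset (Finset (E d))) : Prop where
  card_eq : ∀ T ∈ 𝒯, T.card = d + 1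
  affineIndependent : ∀ T ∈ 𝒯, AffineIndependent ℝ (fun y : T => (y : E d))
  cover : ⋃ T ∈ 𝒯, cell T = closure Ω
  conforming : ∀ T ∈ 𝒯, ∀ K ∈ 𝒯,
    cell T ∩ cell K = convexHull ℝ ((T : Set (E d)) ∩ (K : Set (E d)))

/-- `H_T`, the diameter of a simplex. -/
def cellDiam (T : Finset (E d)) : ℝ := Metric.diam (cell T)

/-- The radius of the largest ball contained in a simplex. -/
def inradius (T : Finset (E d)) : ℝ :=
  sSup {r : ℝ | 0 ≤ r ∧ ∃ x, Metric.closedBall x r ⊆ cell T}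

/-- The shape regularity parameter of a mesh: the maximum over its simplices `T` of
`diam T / diam B_T`, where `B_T` is the largest ball contained in `T`. -/
def shapeRegularity (𝒯 : Finset (Finset (E d))) : ℝ :=
  ⨆ T : 𝒯, cellDiam T.1 / (2 * inradius T.1)

/-- The maximal mesh size. -/
def maxMeshSize (𝒯 : Finset (Finset (E d))) : ℝ := ⨆ T : 𝒯, cellDiam T.1

/-- The mesh size function, equal to `H_T` in the interior of each simplex `T` (the interiors are
disjoint, and the union of the boundaries is a null set, so that this is defined almost everywhere;
the value there is `0`). -/
def meshSize (𝒯 : Finset (Finset (E d))) (x : E d) : ℝ :=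
  ∑ T ∈ 𝒯, (interior (cell T)).indicator (fun _ => cellDiam T) x

/-! ### Finite element space, nodal basis and quasi-interpolation -/

/-- `V_H`: the functions in `H¹₀(Ω)` that are affine on every simplex of the mesh. -/
def VH (Ω : Set (E d)) (𝒯 : Finset (Finset (E d))) : Submodule ℝ (Pairs Ω) where
  carrier := {v | v ∈ H10 Ω ∧ ∀ T ∈ 𝒯, ∃ ℓ : E d →ᵃ[ℝ] ℝ,
    ∀ᵐ x ∂(volume.restrict Ω), x ∈ cell T → v.1 x = ℓ x}
  zero_mem' := by
    refine ⟨zero_mem _, fun T _ => ⟨0, ?_⟩⟩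
    filter_upwards [Lp.coeFn_zero ℝ 2 (volume.restrict Ω)] with x hx _
    simpa using hx
  add_mem' := by
    rintro u v ⟨hu, hu'⟩ ⟨hv, hv'⟩
    refine ⟨add_mem hu hv, fun T hT => ?_⟩
    obtain ⟨k, hk⟩ := hu' T hT
    obtain ⟨l, hl⟩ := hv' T hT
    refine ⟨k + l, ?_⟩
    filter_upwards [hk, hl, Lp.coeFn_add u.1 v.1] with x h1 h2 h3 hx
    have h4 : (u + v).1 x = u.1 x + v.1 x := h3
    rw [h4, h1 hx, h2 hx]
    rfl
  smul_mem' := by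
    rintro c u ⟨hu, hu'⟩
    refine ⟨Submodule.smul_mem _ c hu, fun T hT => ?_⟩
    obtain ⟨k, hk⟩ := hu' T hT
    refine ⟨c • k, ?_⟩
    filter_upwards [hk, Lp.coeFn_smul c u.1] with x h1 h3 hx
    have h4 : (c • u).1 x = c * u.1 x := h3
    rw [h4, h1 hx]
    rfl

open Classical in
/-- `𝒩_H`: the interior vertices of the mesh, that is, those in the open set `Ω`. -/
def interiorVertices (Ω : Set (E d)) (𝒯 : Finset (Finset (E d))) : Finset (E d) :=
  (𝒯.biUnion id).filter (· ∈ Ω)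

open Classical in
/-- The barycentric coordinate of `x` with respect to the vertex `z` of the simplex `T`. -/
def bary (T : Finset (E d)) (z x : E d) : ℝ :=
  if h : ∃ w : E d → ℝ, ∑ y ∈ T, w y = 1 ∧ ∑ y ∈ T, w y • y = x then h.choose z else 0

open Classical in
/-- The nodal basis (hat) function of the vertex `z`: on each simplex with vertex `z` it is the
barycentric coordinate with respect to `z` (for a regular mesh the choice of the simplex containing
`x` does not matter), and it vanishes on the remaining simplices. It is the continuous function,
affine on each simplex, with the value `1` at `z` and `0` at all other vertices. -/
def hat (𝒯 : Finset (Finset (E d))) (z x : E d) : ℝ :=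
  if h : ∃ T ∈ 𝒯, z ∈ T ∧ x ∈ cell T then bary h.choose z x else 0

/-- The nodal value `(v, φ_z) / (1, φ_z)` of the weighted Clément interpolant of `v`. -/
def clementValue (Ω : Set (E d)) (𝒯 : Finset (Finset (E d))) (v : Pairs Ω) (z : E d) : ℝ :=
  (∫ x in Ω, v.1 x * hat 𝒯 z x) / (∫ x in Ω, hat 𝒯 z x)

/-- The weighted Clément quasi-interpolant `I_H v = ∑_z (I_H v)(z) φ_z`, the sum being over the
interior vertices. -/
def clement (Ω : Set (E d)) (𝒯 : Finset (Finset (E d))) (v : Pairs Ω) (x : E d) : ℝ :=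
  ∑ z ∈ interiorVertices Ω 𝒯, clementValue Ω 𝒯 v z * hat 𝒯 z x

/-! ### The energy and the two-scale decomposition -/

/-- Measurable symmetric coefficients with spectrum in `[α, β]`, where `0 < α ≤ β`. -/
structure IsCoefficient (Ω : Set (E d)) (A : E d → Matrix (Fin d) (Fin d) ℝ) (α β : ℝ) : Prop where
  pos : 0 < α
  le : α ≤ β
  aemeasurable : ∀ i j, AEMeasurable (fun x => A x i j) (volume.restrict Ω)
  isSymm : ∀ᵐ x ∂(volume.restrict Ω), (A x).IsSymm
  spectrum_subset : ∀ᵐ x ∂(volume.restrict Ω), spectrum ℝ (A x) ⊆ Set.Icc α β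

/-- The bilinear form `a(u, v) = ∫_Ω (A ∇u) · ∇v`. -/
def energy (Ω : Set (E d)) (A : E d → Matrix (Fin d) (Fin d) ℝ) (u v : Pairs Ω) : ℝ :=
  ∫ x in Ω, inner ℝ (Matrix.toEuclideanLin (A x) (u.2 x)) (v.2 x)

/-- The energy norm. -/
def energyNorm (Ω : Set (E d)) (A : E d → Matrix (Fin d) (Fin d) ℝ) (v : Pairs Ω) : ℝ :=
  Real.sqrt (energy Ω A v v)

/-- The fine scale space `V_f`: the kernel of the quasi-interpolation restricted to `V_h`. -/
def Vf (Ω : Set (E d)) (𝒯 : Finset (Finset (E d))) (Vh : Submodule ℝ (Pairs Ω)) :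
    Set (Pairs Ω) :=
  {v | v ∈ Vh ∧ ∀ x ∈ Ω, clement Ω 𝒯 v x = 0}

/-- `p = P_f v`: the function `p` is the `a`-orthogonal projection of `v` to `V_f`. -/
def IsFineProjection (Ω : Set (E d)) (𝒯 : Finset (Finset (E d)))
    (A : E d → Matrix (Fin d) (Fin d) ℝ) (Vh : Submodule ℝ (Pairs Ω)) (v p : Pairs Ω) : Prop :=
  p ∈ Vf Ω 𝒯 Vh ∧ ∀ w ∈ Vf Ω 𝒯 Vh, energy Ω A p w = energy Ω A v w

/-- The coarse space `V_c = (1 - P_f) V_H`. (The projection exists whenever `V_h` is closed, in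
particular for finite-dimensional `V_h` and for `V_h = H¹₀(Ω)`.) -/
def Vc (Ω : Set (E d)) (𝒯 : Finset (Finset (E d))) (A : E d → Matrix (Fin d) (Fin d) ℝ)
    (Vh : Submodule ℝ (Pairs Ω)) : Set (Pairs Ω) :=
  {u | ∃ v ∈ VH Ω 𝒯, ∃ p, IsFineProjection Ω 𝒯 A Vh v p ∧ u = v - p}

end TwoScale

end

open TwoScale

/-! Everything rests on one estimate for the weighted Clément operator, `‖H⁻¹ (v - I_H v)‖² ≤ C
‖∇v‖²` on `H¹₀(Ω)` with `C` depending only on `Ω` and `γ` (`exists_clementError_le`). If `I_H v_f =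
0`, all nodal values of `v_f` vanish. So `v_f` is its own interpolation error and is `L²`-orthogonal
to all hat functions, whence `(v_c, v_f) = (v_c - I_H v_c, v_f)` and each factor contributes one
power of `H`. For the last inequality, `v_c` and `v_f` are `a`-orthogonal, so their energies add;
Friedrichs' inequality controls `v_c` and the Clément estimate controls `v_f`.

The Clément estimate is local to the patch of cells around a vertex `z`. Patches need not be convex,
so the Poincaré inequality is used on a ball about `z` whose radius is a small multiple of the local
mesh size (`exists_poincare_ball`). The part of this ball in `Ω` lies in the patch. At a boundary
vertex a fixed fraction of the ball lies outside `Ω`, where a test function vanishes, so the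
approximating constant can be `0`. Contracting each cell towards `z` carries the bound from the ball
to the patch (`sum_integral_le_of_ball`), and the weighted mean is as good as any constant up to a
factor (`sum_integral_le_of_mean`). Summation over vertices and density finish the argument.

All this needs the cells at one vertex to have comparable diameters, with a constant that sees only
`γ` and `Ω` (`cellDiam_le`). On a cell `T` at `z`, `1 - φ_z` is comparable with `|x - z| / diam T`.
Along a path that stays away from `z`, `log (1 - φ_z)` varies by at most `γ` times the length over
the distance. Points of a small sphere about `z` are joined by paths of bounded relative length:
through a third direction if `z` is interior (here `d ≥ 2` enters), along the cone of the Lipschitz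
boundary otherwise. -/

noncomputable section

namespace TwoScale

variable {d : ℕ}

/-! ### Bounds on the coefficient and the energy form -/

theorem inner_toEuclideanLin (M : Matrix (Fin d) (Fin d) ℝ) (ξ η : E d) :
    inner ℝ (Matrix.toEuclideanLin M ξ) η = ∑ i, (∑ j, M i j * ξ j) * η i := by
  simp [PiLp.inner_apply, Matrix.toLpLin_apply, Matrix.mulVec, dotProduct, mul_comm]

theorem inner_toEuclideanLin_comm {M : Matrix (Fin d) (Fin d) ℝ} (hM : M.IsSymm) (ξ η : E d) :
    inner ℝ (Matrix.toEuclideanLin M ξ) η = inner ℝ (Matrix.toEuclideanLin M η) ξ := by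
  simp only [inner_toEuclideanLin, Finset.sum_mul]
  rw [Finset.sum_comm]
  refine Finset.sum_congr rfl fun i _ => Finset.sum_congr rfl fun j _ => ?_
  rw [hM.apply i j]
  ring

theorem inner_nonneg_of_spectrum_nonneg {M : Matrix (Fin d) (Fin d) ℝ} (hM : M.IsSymm)
    (h : spectrum ℝ M ⊆ Set.Ici 0) (ξ : E d) : 0 ≤ inner ℝ (Matrix.toEuclideanLin M ξ) ξ := by
  have hP : M.PosSemidef := Matrix.posSemidef_iff_isHermitian_and_spectrum_nonneg.2
    ⟨by rw [Matrix.IsHermitian, Matrix.conjTranspose_eq_transpose_of_trivial]; exact hM,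
      fun x hx => h hx⟩
  have := hP.dotProduct_mulVec_nonneg ξ.ofLp
  rw [inner_toEuclideanLin]
  simpa [dotProduct, Matrix.mulVec, mul_comm] using this

/-- Subtracting a scalar matrix translates the spectrum, so `M - α` and `β - M` are both positive
semidefinite. -/
theorem inner_bounds_of_spectrum_subset {M : Matrix (Fin d) (Fin d) ℝ} (hM : M.IsSymm) {α β : ℝ}
    (h : spectrum ℝ M ⊆ Set.Icc α β) (ξ : E d) :
    α * ‖ξ‖ ^ 2 ≤ inner ℝ (Matrix.toEuclideanLin M ξ) ξ ∧
      inner ℝ (Matrix.toEuclideanLin M ξ) ξ ≤ β * ‖ξ‖ ^ 2 := by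
  have hs : ∀ c : ℝ, (algebraMap ℝ (Matrix (Fin d) (Fin d) ℝ) c).IsSymm := fun c => by
    rw [Matrix.algebraMap_eq_diagonal]; exact Matrix.isSymm_diagonal _
  have hl : ∀ c : ℝ, inner ℝ (Matrix.toEuclideanLin (algebraMap ℝ (Matrix (Fin d) (Fin d) ℝ) c) ξ) ξ
      = c * ‖ξ‖ ^ 2 := fun c => by
    rw [Algebra.algebraMap_eq_smul_one, map_smul, LinearMap.smul_apply, real_inner_smul_left,
      Matrix.toLpLin_one]
    simp
  constructor
  · have h1 : spectrum ℝ (M - algebraMap ℝ _ α) ⊆ Set.Ici 0 := by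
      intro x hx
      rw [sub_eq_add_neg, ← map_neg, add_comm] at hx
      rw [← spectrum.singleton_add_eq] at hx
      obtain ⟨a, ha, b, hb, rfl⟩ := hx
      simp only [Set.mem_singleton_iff] at ha
      have := (h hb).1
      simp only [Set.mem_Ici]; linarith
    have := inner_nonneg_of_spectrum_nonneg (hM.sub (hs α)) h1 ξ
    rw [map_sub, LinearMap.sub_apply, inner_sub_left, hl] at this
    linarith
  · have h1 : spectrum ℝ (algebraMap ℝ _ β - M) ⊆ Set.Ici 0 := by
      intro x hx
      rw [← spectrum.singleton_sub_eq] at hx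
      obtain ⟨a, ha, b, hb, rfl⟩ := hx
      simp only [Set.mem_singleton_iff] at ha
      have := (h hb).2
      simp only [Set.mem_Ici]; linarith
    have := inner_nonneg_of_spectrum_nonneg ((hs β).sub hM) h1 ξ
    rw [map_sub, LinearMap.sub_apply, inner_sub_left, hl] at this
    linarith

theorem IsCoefficient.ae_bounds {Ω : Set (E d)} {A : E d → Matrix (Fin d) (Fin d) ℝ} {α β : ℝ}
    (hA : IsCoefficient Ω A α β) : ∀ᵐ x ∂(volume.restrict Ω), ∀ ξ : E d,
      α * ‖ξ‖ ^ 2 ≤ inner ℝ (Matrix.toEuclideanLin (A x) ξ) ξ ∧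
      inner ℝ (Matrix.toEuclideanLin (A x) ξ) ξ ≤ β * ‖ξ‖ ^ 2 := by
  filter_upwards [hA.isSymm, hA.spectrum_subset] with x h1 h2 ξ
  exact inner_bounds_of_spectrum_subset h1 h2 ξ

theorem integrable_norm_sq {Ω : Set (E d)} (u : Lp (E d) 2 (volume.restrict Ω)) :
    Integrable (fun x => ‖u x‖ ^ 2) (volume.restrict Ω) :=
  (memLp_two_iff_integrable_sq_norm (Lp.aestronglyMeasurable u)).1 (Lp.memLp u)

theorem integral_norm_sq {F : Type*} [NormedAddCommGroup F] [InnerProductSpace ℝ F] {Ω : Set (E d)}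
    (u : Lp F 2 (volume.restrict Ω)) : ∫ x in Ω, ‖u x‖ ^ 2 = ‖u‖ ^ 2 := by
  rw [← real_inner_self_eq_norm_sq, L2.inner_def]
  simp

/-- Only the quadratic form is bounded directly. Its non-negativity at `u ± v` (polarization) bounds
the mixed term by `β (|∇u|² + |∇v|²)`, which is integrable. -/
theorem IsCoefficient.integrable {Ω : Set (E d)} {A : E d → Matrix (Fin d) (Fin d) ℝ} {α β : ℝ}
    (hA : IsCoefficient Ω A α β) (u v : Pairs Ω) :
    Integrable (fun x => inner ℝ (Matrix.toEuclideanLin (A x) (u.2 x)) (v.2 x))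
      (volume.restrict Ω) := by
  have hm : AEStronglyMeasurable
      (fun x => inner ℝ (Matrix.toEuclideanLin (A x) (u.2 x)) (v.2 x)) (volume.restrict Ω) := by
    simp only [inner_toEuclideanLin]
    have hc : ∀ (w : Lp (E d) 2 (volume.restrict Ω)) (i : Fin d),
        AEMeasurable (fun x => w x i) (volume.restrict Ω) := fun w i =>
      (EuclideanSpace.proj (𝕜 := ℝ) i).continuous.measurable.comp_aemeasurable
        (Lp.aestronglyMeasurable w).aemeasurable
    refine AEMeasurable.aestronglyMeasurable ?_
    refine Finset.aemeasurable_fun_sum _ fun i _ => AEMeasurable.mul ?_ (hc _ i)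
    exact Finset.aemeasurable_fun_sum _ fun j _ => (hA.aemeasurable i j).mul (hc _ j)
  refine Integrable.mono' (((integrable_norm_sq u.2).add (integrable_norm_sq v.2)).const_mul β) hm ?_
  filter_upwards [hA.ae_bounds, hA.isSymm] with x hx hs
  have hβ := hA.pos.le.trans hA.le
  have h1 := (hx (u.2 x + v.2 x)).1
  have h2 := (hx (u.2 x - v.2 x)).1
  have h3 := (hx (u.2 x)).2
  have h4 := (hx (v.2 x)).2
  simp only [map_add, map_sub, inner_add_left, inner_add_right, inner_sub_left,
    inner_sub_right] at h1 h2
  rw [inner_toEuclideanLin_comm hs (v.2 x) (u.2 x)] at h1 h2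
  have h5 : 0 ≤ α * ‖u.2 x + v.2 x‖ ^ 2 := mul_nonneg hA.pos.le (sq_nonneg _)
  have h6 : 0 ≤ α * ‖u.2 x - v.2 x‖ ^ 2 := mul_nonneg hA.pos.le (sq_nonneg _)
  have h7 : 0 ≤ β * ‖u.2 x‖ ^ 2 := mul_nonneg hβ (sq_nonneg _)
  have h8 : 0 ≤ β * ‖v.2 x‖ ^ 2 := mul_nonneg hβ (sq_nonneg _)
  rw [Real.norm_eq_abs, abs_le]
  simp only [Pi.add_apply]
  constructor <;> linarith

theorem IsCoefficient.energy_comm {Ω : Set (E d)} {A : E d → Matrix (Fin d) (Fin d) ℝ} {α β : ℝ}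
    (hA : IsCoefficient Ω A α β) (u v : Pairs Ω) : energy Ω A u v = energy Ω A v u := by
  refine integral_congr_ae ?_
  filter_upwards [hA.isSymm] with x hs
  exact inner_toEuclideanLin_comm hs _ _

theorem IsCoefficient.energy_add_left {Ω : Set (E d)} {A : E d → Matrix (Fin d) (Fin d) ℝ}
    {α β : ℝ} (hA : IsCoefficient Ω A α β) (u v w : Pairs Ω) :
    energy Ω A (u + v) w = energy Ω A u w + energy Ω A v w := by
  rw [energy, energy, energy, ← integral_add (hA.integrable u w) (hA.integrable v w)]
  refine integral_congr_ae ?_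
  filter_upwards [Lp.coeFn_add u.2 v.2] with x hx
  have hx' : (u + v).2 x = u.2 x + v.2 x := hx
  simp only [hx', map_add, inner_add_left]

theorem IsCoefficient.norm_sq_le_energy {Ω : Set (E d)} {A : E d → Matrix (Fin d) (Fin d) ℝ}
    {α β : ℝ} (hA : IsCoefficient Ω A α β) (v : Pairs Ω) :
    α * ‖v.2‖ ^ 2 ≤ energy Ω A v v := by
  rw [← integral_norm_sq, ← integral_const_mul]
  refine integral_mono_ae ((integrable_norm_sq v.2).const_mul α) (hA.integrable v v) ?_
  filter_upwards [hA.ae_bounds] with x hx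
  exact (hx _).1

theorem IsCoefficient.energyNorm_sq {Ω : Set (E d)} {A : E d → Matrix (Fin d) (Fin d) ℝ}
    {α β : ℝ} (hA : IsCoefficient Ω A α β) (v : Pairs Ω) :
    energyNorm Ω A v ^ 2 = energy Ω A v v :=
  Real.sq_sqrt ((mul_nonneg hA.pos.le (sq_nonneg _)).trans (hA.norm_sq_le_energy v))

theorem IsCoefficient.norm_sq_le {Ω : Set (E d)} {A : E d → Matrix (Fin d) (Fin d) ℝ}
    {α β : ℝ} (hA : IsCoefficient Ω A α β) (v : Pairs Ω) :
    ‖v.2‖ ^ 2 ≤ α⁻¹ * energyNorm Ω A v ^ 2 := by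
  rw [hA.energyNorm_sq, le_inv_mul_iff₀ hA.pos]
  exact hA.norm_sq_le_energy v

theorem IsCoefficient.norm_mul_norm_le {Ω : Set (E d)} {A : E d → Matrix (Fin d) (Fin d) ℝ}
    {α β : ℝ} (hA : IsCoefficient Ω A α β) (u v : Pairs Ω) :
    ‖u.2‖ * ‖v.2‖ ≤ α⁻¹ * (energyNorm Ω A u * energyNorm Ω A v) := by
  have hα := inv_pos.2 hA.pos
  have hn : ∀ w, 0 ≤ energyNorm Ω A w := fun w => Real.sqrt_nonneg _
  refine abs_le_of_sq_le_sq' ?_ (mul_nonneg hα.le (mul_nonneg (hn u) (hn v))) |>.2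
  calc (‖u.2‖ * ‖v.2‖) ^ 2 = ‖u.2‖ ^ 2 * ‖v.2‖ ^ 2 := by ring
    _ ≤ (α⁻¹ * energyNorm Ω A u ^ 2) * (α⁻¹ * energyNorm Ω A v ^ 2) :=
      mul_le_mul (hA.norm_sq_le u) (hA.norm_sq_le v) (sq_nonneg _) (by positivity)
    _ = _ := by ring

theorem IsCoefficient.energyNorm_add_sq {Ω : Set (E d)} {A : E d → Matrix (Fin d) (Fin d) ℝ}
    {α β : ℝ} (hA : IsCoefficient Ω A α β) {u v : Pairs Ω} (h : energy Ω A u v = 0) :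
    energyNorm Ω A (u + v) ^ 2 = energyNorm Ω A u ^ 2 + energyNorm Ω A v ^ 2 := by
  simp only [hA.energyNorm_sq]
  rw [hA.energy_add_left, hA.energy_comm u, hA.energy_comm v, hA.energy_add_left,
    hA.energy_add_left, h, hA.energy_comm v u, h]
  ring

theorem IsCoefficient.energy_coarse_fine {Ω : Set (E d)} {𝒯 : Finset (Finset (E d))}
    {A : E d → Matrix (Fin d) (Fin d) ℝ} {α β : ℝ} (hA : IsCoefficient Ω A α β)
    {Vh : Submodule ℝ (Pairs Ω)} {vc vf : Pairs Ω} (hc : vc ∈ Vc Ω 𝒯 A Vh)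
    (hf : vf ∈ Vf Ω 𝒯 Vh) : energy Ω A vc vf = 0 := by
  obtain ⟨v, -, p, ⟨-, hp⟩, rfl⟩ := hc
  have h := hA.energy_add_left (v - p) p vf
  rw [sub_add_cancel, hp vf hf] at h
  linarith

/-! ### Poincaré type inequalities for smooth functions -/

/-- Change of variables: the homothety has Jacobian `t ^ d`, and enlarging its image to `S'` only
increases the integral of `F ≥ 0`. -/
theorem integral_comp_homothety_le {S S' : Set (E d)} (hS : IsCompact S) (hS' : IsCompact S')
    (z : E d) {t : ℝ} (ht : 0 < t) (hst : ∀ x ∈ S, z + t • (x - z) ∈ S') {F : E d → ℝ}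
    (hF : Continuous F) (h0 : ∀ x, 0 ≤ F x) :
    ∫ x in S, F (z + t • (x - z)) ≤ (t ^ d)⁻¹ * ∫ x in S', F x := by
  have hder : ∀ x ∈ S, HasFDerivWithinAt (fun x : E d => z + t • (x - z))
      (t • ContinuousLinearMap.id ℝ (E d)) S x := fun x _ => by
    have := (((hasFDerivAt_id (𝕜 := ℝ) x).sub_const z).const_smul t).const_add z
    exact this.hasFDerivWithinAt
  have hinj : Set.InjOn (fun x : E d => z + t • (x - z)) S := by
    intro x _ y _ hxy
    have : t • (x - z) = t • (y - z) := add_left_cancel hxy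
    exact sub_left_injective (smul_right_injective _ ht.ne' this)
  have hdet : (t • ContinuousLinearMap.id ℝ (E d)).det = t ^ d := by
    rw [ContinuousLinearMap.det]
    simp
  have key := integral_image_eq_integral_abs_det_fderiv_smul volume hS.measurableSet hder hinj F
  simp only [hdet, smul_eq_mul, abs_of_pos (pow_pos ht d)] at key
  rw [integral_const_mul] at key
  rw [le_inv_mul_iff₀ (pow_pos ht d), ← key]
  refine setIntegral_mono_set (hF.continuousOn.integrableOn_compact hS')
    (Filter.Eventually.of_forall h0) (Filter.Eventually.of_forall ?_)
  rintro _ ⟨x, hx, rfl⟩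
  exact hst x hx

/-- Expanding `∫ (g - c)² ≥ 0` with `c` the integral itself, on an interval of length `1 - ε`,
leaves `(1 + ε) c² ≤ ∫ g²`. -/
theorem sq_intervalIntegral_le {ε : ℝ} (h0 : 0 ≤ ε) (h1 : ε ≤ 1) {g : ℝ → ℝ} (hg : Continuous g) :
    (∫ t in ε..1, g t) ^ 2 ≤ ∫ t in ε..1, g t ^ 2 := by
  set c := ∫ t in ε..1, g t with hc
  have h : 0 ≤ ∫ t in ε..1, (g t - c) ^ 2 :=
    intervalIntegral.integral_nonneg h1 fun t _ => sq_nonneg _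
  have h2 : ∫ t in ε..1, (g t - c) ^ 2 = (∫ t in ε..1, g t ^ 2) - 2 * c * c + (1 - ε) * c ^ 2 := by
    have : ∀ t, (g t - c) ^ 2 = g t ^ 2 - (2 * c) * g t + c ^ 2 := fun t => by ring
    simp only [this]
    rw [intervalIntegral.integral_add, intervalIntegral.integral_sub,
      intervalIntegral.integral_const_mul, intervalIntegral.integral_const, ← hc]
    · simp
    all_goals exact Continuous.intervalIntegrable (by fun_prop) _ _
  nlinarith [mul_nonneg h0 (sq_nonneg c)]

theorem sq_sub_le_integral_fderiv {v : E d → ℝ} (hv : ContDiff ℝ 1 v) {ε : ℝ} (h0 : 0 ≤ ε)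
    (h1 : ε ≤ 1) (z x : E d) :
    (v x - v (z + ε • (x - z))) ^ 2 ≤
      ∫ t in ε..1, ‖x - z‖ ^ 2 * ‖fderiv ℝ v (z + t • (x - z))‖ ^ 2 := by
  have hc : Continuous (fderiv ℝ v) := hv.continuous_fderiv one_ne_zero
  have hd : ∀ t : ℝ, HasDerivAt (fun t : ℝ => v (z + t • (x - z)))
      (fderiv ℝ v (z + t • (x - z)) (x - z)) t := fun t => by
    have h2 : HasDerivAt (fun t : ℝ => z + t • (x - z)) (x - z) t := by
      simpa using ((hasDerivAt_id t).smul_const (x - z)).const_add z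
    exact ((hv.differentiable one_ne_zero _).hasFDerivAt).comp_hasDerivAt t h2
  have hcont : Continuous fun t : ℝ => fderiv ℝ v (z + t • (x - z)) (x - z) := by fun_prop
  have h3 := intervalIntegral.integral_eq_sub_of_hasDerivAt (a := ε) (b := 1)
    (fun t _ => hd t) (hcont.intervalIntegrable _ _)
  have h4 : v x - v (z + ε • (x - z)) = ∫ t in ε..1, fderiv ℝ v (z + t • (x - z)) (x - z) := by
    rw [h3]; simp
  rw [h4]
  refine (sq_intervalIntegral_le h0 h1 hcont).trans ?_
  refine intervalIntegral.integral_mono_on h1 (Continuous.intervalIntegrable (by fun_prop) _ _)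
    (Continuous.intervalIntegrable (by fun_prop) _ _) fun t _ => ?_
  rw [← mul_pow]
  refine sq_le_sq' ?_ ?_
  · have := (abs_le.1 ((Real.norm_eq_abs _).symm.le.trans
      ((fderiv ℝ v (z + t • (x - z))).le_opNorm (x - z)))).1
    linarith
  · have := (abs_le.1 ((Real.norm_eq_abs _).symm.le.trans
      ((fderiv ℝ v (z + t • (x - z))).le_opNorm (x - z)))).2
    linarith

/-- The fundamental theorem of calculus along each segment, then Fubini, then for each `t` the
homothety of ratio `t`. Its Jacobian costs `t⁻ᵈ ≤ ε⁻ᵈ`: stopping at ratio `ε` instead of at the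
centre keeps the constant finite. -/
theorem integral_sq_sub_comp_homothety_le {v : E d → ℝ} (hv : ContDiff ℝ 1 v) {S : Set (E d)}
    (hS : IsCompact S) {z : E d} {ε R : ℝ} (h0 : 0 < ε) (h1 : ε ≤ 1)
    (hst : ∀ x ∈ S, ∀ t ∈ Set.Icc ε 1, z + t • (x - z) ∈ S) (hR : ∀ x ∈ S, ‖x - z‖ ≤ R) :
    ∫ x in S, (v x - v (z + ε • (x - z))) ^ 2 ≤
      R ^ 2 * (ε ^ d)⁻¹ * ∫ x in S, ‖fderiv ℝ v x‖ ^ 2 := by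
  have hc : Continuous (fderiv ℝ v) := hv.continuous_fderiv one_ne_zero
  have hvc := hv.continuous
  set G : E d → ℝ → ℝ := fun x t => R ^ 2 * ‖fderiv ℝ v (z + t • (x - z))‖ ^ 2 with hG
  have hGc : Continuous (Function.uncurry G) := by
    simp only [hG, Function.uncurry_def]; fun_prop
  have hGi : Integrable (Function.uncurry G)
      ((volume.restrict S).prod (volume.restrict (Set.Ioc ε 1))) := by
    rw [Measure.prod_restrict]
    exact (hGc.continuousOn.integrableOn_compact (hS.prod isCompact_Icc)).mono_set
      (Set.prod_mono_right Set.Ioc_subset_Icc_self)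
  have step1 : ∫ x in S, (v x - v (z + ε • (x - z))) ^ 2 ≤ ∫ x in S, ∫ t in Set.Ioc ε 1, G x t := by
    refine setIntegral_mono_on
      (Continuous.continuousOn (by fun_prop) |>.integrableOn_compact hS) hGi.integral_prod_left
      hS.measurableSet fun x hx => ?_
    rw [← intervalIntegral.integral_of_le h1]
    refine (sq_sub_le_integral_fderiv hv h0.le h1 z x).trans ?_
    refine intervalIntegral.integral_mono_on h1 (Continuous.intervalIntegrable (by fun_prop) _ _)
      (Continuous.intervalIntegrable (by fun_prop) _ _) fun t _ => ?_
    simp only [hG]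
    gcongr
    exact hR x hx
  refine step1.trans ?_
  rw [integral_integral_swap hGi]
  have hbd : ∀ t ∈ Set.Ioc ε 1, ∫ x in S, G x t ≤
      R ^ 2 * (ε ^ d)⁻¹ * ∫ x in S, ‖fderiv ℝ v x‖ ^ 2 := fun t ht => by
    simp only [hG]
    rw [integral_const_mul, mul_assoc]
    have ht0 := h0.trans ht.1
    refine mul_le_mul_of_nonneg_left ?_ (sq_nonneg _)
    refine (integral_comp_homothety_le hS hS z ht0 (fun x hx => hst x hx t ⟨ht.1.le, ht.2⟩)
      (F := fun x => ‖fderiv ℝ v x‖ ^ 2) (by fun_prop) (fun x => sq_nonneg _)).trans ?_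
    refine mul_le_mul_of_nonneg_right ?_ (integral_nonneg fun _ => sq_nonneg _)
    gcongr
    exact ht.1.le
  have hK : 0 ≤ R ^ 2 * (ε ^ d)⁻¹ * ∫ x in S, ‖fderiv ℝ v x‖ ^ 2 :=
    mul_nonneg (by positivity) (integral_nonneg fun _ => sq_nonneg _)
  calc ∫ t in Set.Ioc ε 1, ∫ x in S, G x t
      ≤ ∫ t in Set.Ioc ε 1, R ^ 2 * (ε ^ d)⁻¹ * ∫ x in S, ‖fderiv ℝ v x‖ ^ 2 :=
        setIntegral_mono_on hGi.integral_prod_right (integrableOn_const (by simp) enorm_ne_top)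
          measurableSet_Ioc hbd
    _ ≤ _ := by
      rw [setIntegral_const, smul_eq_mul, Measure.real, Real.volume_Ioc,
        ENNReal.toReal_ofReal (by linarith)]
      exact mul_le_of_le_one_left hK (by linarith)

/-- Joining `x` directly to `y` would involve homotheties of arbitrarily small ratio. Both values
are compared with the value at the midpoint instead, so only ratios in `[1/2, 1]` occur; the two
halves agree by symmetry. -/
theorem integral_integral_sq_sub_le {v : E d → ℝ} (hv : ContDiff ℝ 1 v) {S : Set (E d)}
    (hS : IsCompact S) (hconv : Convex ℝ S) {R : ℝ} (hR : ∀ x ∈ S, ∀ y ∈ S, ‖x - y‖ ≤ R) :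
    ∫ y in S, ∫ x in S, (v x - v y) ^ 2 ≤
      4 * (volume.real S * (R ^ 2 * 2 ^ d * ∫ x in S, ‖fderiv ℝ v x‖ ^ 2)) := by
  have hvc := hv.continuous
  set M := R ^ 2 * 2 ^ d * ∫ x in S, ‖fderiv ℝ v x‖ ^ 2 with hM
  have hint : ∀ G : E d → E d → ℝ, Continuous (Function.uncurry G) →
      Integrable (Function.uncurry G) ((volume.restrict S).prod (volume.restrict S)) := by
    intro G hG
    rw [Measure.prod_restrict]
    exact hG.continuousOn.integrableOn_compact (hS.prod hS)
  have hmid : ∀ y ∈ S, ∫ x in S, (v x - v (y + (2⁻¹ : ℝ) • (x - y))) ^ 2 ≤ M := fun y hy => by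
    refine (integral_sq_sub_comp_homothety_le hv hS (z := y) (ε := 2⁻¹) (R := R) (by norm_num)
      (by norm_num) (fun x hx t ht => ?_) (fun x hx => hR x hx y hy)).trans ?_
    · have : y + t • (x - y) = (1 - t) • y + t • x := by
        rw [smul_sub, sub_smul, one_smul]; abel
      rw [this]
      exact hconv hy hx (by linarith [ht.2]) (by linarith [ht.1]) (by ring)
    · rw [hM, inv_pow, inv_inv]
  set G : E d → E d → ℝ := fun y x => (v x - v (y + (2⁻¹ : ℝ) • (x - y))) ^ 2 with hG
  have hGi := hint G (by simp only [hG, Function.uncurry_def]; fun_prop)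
  have hb : ∫ y in S, ∫ x in S, G y x ≤ volume.real S * M := by
    calc ∫ y in S, ∫ x in S, G y x ≤ ∫ y in S, M :=
          setIntegral_mono_on hGi.integral_prod_left
            (integrableOn_const hS.measure_lt_top.ne (by simp)) hS.measurableSet hmid
      _ = _ := by rw [setIntegral_const, smul_eq_mul]
  have hGi' := hint (fun y x => G x y) (by simp only [hG, Function.uncurry_def]; fun_prop)
  have hb' : ∫ y in S, ∫ x in S, G x y ≤ volume.real S * M := by
    rw [integral_integral_swap hGi']; exact hb
  calc ∫ y in S, ∫ x in S, (v x - v y) ^ 2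
      ≤ ∫ y in S, ((∫ x in S, 2 * G y x) + ∫ x in S, 2 * G x y) := by
        refine setIntegral_mono_on (hint (fun y x => (v x - v y) ^ 2)
          (by simp only [Function.uncurry_def]; fun_prop)).integral_prod_left
          (Integrable.add (hint (fun y x => 2 * G y x)
            (by simp only [hG, Function.uncurry_def]; fun_prop)).integral_prod_left
            (hint (fun y x => 2 * G x y)
            (by simp only [hG, Function.uncurry_def]; fun_prop)).integral_prod_left)
          hS.measurableSet fun y hy => ?_
        rw [← integral_add]
        · refine setIntegral_mono_on (Continuous.continuousOn (by fun_prop)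
            |>.integrableOn_compact hS) (Continuous.continuousOn (by simp only [hG]; fun_prop)
            |>.integrableOn_compact hS) hS.measurableSet fun x hx => ?_
          have he : x + (2⁻¹ : ℝ) • (y - x) = y + (2⁻¹ : ℝ) • (x - y) := by
            module
          simp only [hG, he]
          nlinarith [sq_nonneg ((v x - v (y + (2⁻¹ : ℝ) • (x - y))) +
            (v y - v (y + (2⁻¹ : ℝ) • (x - y))))]
        all_goals exact (Continuous.continuousOn (by simp only [hG]; fun_prop)
            |>.integrableOn_compact hS)
    _ = 2 * (∫ y in S, ∫ x in S, G y x) + 2 * ∫ y in S, ∫ x in S, G x y := by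
        simp only [integral_const_mul]
        have i1 : IntegrableOn (fun y => ∫ x in S, G y x) S := hGi.integral_prod_left
        have i2 : IntegrableOn (fun y => ∫ x in S, G x y) S := hGi'.integral_prod_left
        rw [integral_add (i1.const_mul 2) (i2.const_mul 2), integral_const_mul, integral_const_mul]
    _ ≤ _ := by linarith

/-- A Poincaré inequality in which the mean is replaced by a value of the function at a point of a
given set `P` of positive measure. -/
theorem exists_integral_sq_sub_le {v : E d → ℝ} (hv : ContDiff ℝ 1 v) {S P : Set (E d)}
    (hS : IsCompact S) (hconv : Convex ℝ S) {R κ : ℝ} (hR : ∀ x ∈ S, ∀ y ∈ S, ‖x - y‖ ≤ R)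
    (hP : MeasurableSet P) (hPS : P ⊆ S) (hκ : 0 < κ) (hS0 : 0 < volume.real S)
    (hPκ : κ * volume.real S ≤ volume.real P) :
    ∃ y ∈ P, ∫ x in S, (v x - v y) ^ 2 ≤
      4 * κ⁻¹ * R ^ 2 * 2 ^ d * ∫ x in S, ‖fderiv ℝ v x‖ ^ 2 := by
  have hvc := hv.continuous
  set M := 4 * κ⁻¹ * R ^ 2 * 2 ^ d * ∫ x in S, ‖fderiv ℝ v x‖ ^ 2 with hM
  -- Otherwise the integral over `y ∈ P` alone would exceed the bound for the double integral over
  -- `S × S`.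
  by_contra! hcon
  have hi : IntegrableOn (fun y => ∫ x in S, (v x - v y) ^ 2) S := by
    have : Integrable (Function.uncurry fun y x => (v x - v y) ^ 2)
        ((volume.restrict S).prod (volume.restrict S)) := by
      rw [Measure.prod_restrict]
      exact Continuous.continuousOn (by simp only [Function.uncurry_def]; fun_prop)
        |>.integrableOn_compact (hS.prod hS)
    exact this.integral_prod_left
  have hPpos : 0 < volume.real P := (mul_pos hκ hS0).trans_le hPκ
  have hPfin : volume P ≠ ⊤ := ((measure_mono hPS).trans_lt hS.measure_lt_top).ne
  have h1 : volume.real P * M < ∫ y in P, ∫ x in S, (v x - v y) ^ 2 := by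
    have h2 : 0 < ∫ y in P, ((∫ x in S, (v x - v y) ^ 2) - M) := by
      rw [setIntegral_pos_iff_support_of_nonneg_ae]
      · refine lt_of_lt_of_le (ENNReal.toReal_pos_iff.1 hPpos).1 (measure_mono fun y hy => ?_)
        exact ⟨(sub_pos.2 (hcon y hy)).ne', hy⟩
      · filter_upwards [ae_restrict_mem hP] with y hy
        exact (sub_pos.2 (hcon y hy)).le
      · exact (hi.mono_set hPS).sub (integrableOn_const hPfin (by simp))
    rw [integral_sub (hi.mono_set hPS) (integrableOn_const hPfin (by simp)), setIntegral_const,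
      smul_eq_mul] at h2
    linarith
  have h3 : ∫ y in P, ∫ x in S, (v x - v y) ^ 2 ≤ ∫ y in S, ∫ x in S, (v x - v y) ^ 2 :=
    setIntegral_mono_set hi (Filter.Eventually.of_forall fun y => integral_nonneg fun _ =>
      sq_nonneg _) (Filter.Eventually.of_forall hPS)
  have h4 := integral_integral_sq_sub_le hv hS hconv hR
  have h5 : κ * volume.real S * M ≤ volume.real P * M :=
    mul_le_mul_of_nonneg_right hPκ (by
      rw [hM]; exact mul_nonneg (by positivity) (integral_nonneg fun _ => sq_nonneg _))
  have h6 : κ * volume.real S * M =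
      4 * (volume.real S * (R ^ 2 * 2 ^ d * ∫ x in S, ‖fderiv ℝ v x‖ ^ 2)) := by
    rw [hM]; field_simp
  linarith

/-! ### Barycentric coordinates of a nondegenerate simplex -/

/-- `T` is the vertex set of a nondegenerate `d`-simplex. -/
structure IsNondegenerate (T : Finset (E d)) : Prop where
  card_eq : T.card = d + 1
  affineIndependent : AffineIndependent ℝ (fun y : T => (y : E d))

namespace IsNondegenerate

variable {T : Finset (E d)} (hT : IsNondegenerate T)

include hT

/-- The vertices of a nondegenerate simplex as an affine basis. -/
def basis : AffineBasis T ℝ (E d) where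
  toFun := fun y => (y : E d)
  ind' := hT.affineIndependent
  tot' := by
    rw [hT.affineIndependent.affineSpan_eq_top_iff_card_eq_finrank_add_one]
    simp [hT.card_eq]

theorem basis_apply (y : T) : hT.basis y = y := rfl

theorem range_basis : Set.range hT.basis = (T : Set (E d)) := by
  ext y; exact ⟨by rintro ⟨y, rfl⟩; exact y.2, fun h => ⟨⟨y, h⟩, rfl⟩⟩

theorem coord_eq_of_weights {w : E d → ℝ} {x : E d} (h1 : ∑ y ∈ T, w y = 1)
    (h2 : ∑ y ∈ T, w y • y = x) {z : E d} (hz : z ∈ T) : hT.basis.coord ⟨z, hz⟩ x = w z := by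
  have h1' : ∑ y : T, w y = 1 := by rw [Finset.sum_coe_sort T w]; exact h1
  have := hT.basis.coord_apply_combination_of_mem (Finset.mem_univ (⟨z, hz⟩ : T))
    (w := fun y : T => w y) h1'
  rw [Finset.affineCombination_eq_linear_combination _ _ _ h1'] at this
  rw [← h2, ← this]
  congr 1
  exact (Finset.sum_coe_sort T (fun y => w y • y)).symm

/-- `bary` chooses some family of weights; affine independence makes the weights on `T` unique.
Hence `bary` is an affine function on the whole space. -/
theorem bary_eq_coord {z : E d} (hz : z ∈ T) (x : E d) :
    bary T z x = hT.basis.coord ⟨z, hz⟩ x := by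
  classical
  have h : ∃ w : E d → ℝ, ∑ y ∈ T, w y = 1 ∧ ∑ y ∈ T, w y • y = x := by
    refine ⟨fun y => if hy : y ∈ T then hT.basis.coord ⟨y, hy⟩ x else 0, ?_, ?_⟩
    · rw [← hT.basis.sum_coord_apply_eq_one x, ← Finset.sum_coe_sort T]
      exact Finset.sum_congr rfl fun y _ => by simp
    · rw [← Finset.sum_coe_sort T]
      conv_rhs => rw [← hT.basis.linear_combination_coord_eq_self x]
      exact Finset.sum_congr rfl fun y _ => by simp [basis_apply]
  rw [bary, dif_pos h]
  exact (hT.coord_eq_of_weights h.choose_spec.1 h.choose_spec.2 hz).symm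

theorem bary_eq_of_weights {w : E d → ℝ} {x : E d} (h1 : ∑ y ∈ T, w y = 1)
    (h2 : ∑ y ∈ T, w y • y = x) {z : E d} (hz : z ∈ T) : bary T z x = w z := by
  rw [hT.bary_eq_coord hz, hT.coord_eq_of_weights h1 h2 hz]

theorem sum_bary (x : E d) : ∑ z ∈ T, bary T z x = 1 := by
  rw [← hT.basis.sum_coord_apply_eq_one x, ← Finset.sum_coe_sort T]
  exact Finset.sum_congr rfl fun y _ => hT.bary_eq_coord y.2 x

theorem sum_bary_smul (x : E d) : ∑ z ∈ T, bary T z x • z = x := by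
  conv_rhs => rw [← hT.basis.linear_combination_coord_eq_self x]
  rw [← Finset.sum_coe_sort T]
  exact Finset.sum_congr rfl fun y _ => by rw [hT.bary_eq_coord y.2 x]; rfl

theorem mem_cell_iff {x : E d} : x ∈ cell T ↔ ∀ z ∈ T, 0 ≤ bary T z x := by
  rw [cell, ← hT.range_basis, hT.basis.convexHull_eq_nonneg_coord]
  exact ⟨fun h z hz => by rw [hT.bary_eq_coord hz]; exact h _,
    fun h y => by rw [← hT.bary_eq_coord y.2]; exact h _ y.2⟩

theorem mem_interior_cell_iff {x : E d} : x ∈ interior (cell T) ↔ ∀ z ∈ T, 0 < bary T z x := by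
  rw [cell, ← hT.range_basis, hT.basis.interior_convexHull]
  exact ⟨fun h z hz => by rw [hT.bary_eq_coord hz]; exact h _,
    fun h y => by rw [← hT.bary_eq_coord y.2]; exact h _ y.2⟩

theorem continuous_bary {z : E d} (hz : z ∈ T) : Continuous (bary T z) := by
  have : bary T z = hT.basis.coord ⟨z, hz⟩ := funext fun x => hT.bary_eq_coord hz x
  rw [this]
  exact (hT.basis.coord _).continuous_of_finiteDimensional

theorem bary_lineMap {z : E d} (hz : z ∈ T) (x y : E d) (t : ℝ) :
    bary T z (x + t • (y - x)) = bary T z x + t * (bary T z y - bary T z x) := by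
  simp only [hT.bary_eq_coord hz]
  have := (hT.basis.coord ⟨z, hz⟩).apply_lineMap x y t
  rw [AffineMap.lineMap_apply, AffineMap.lineMap_apply] at this
  simp only [vsub_eq_sub, vadd_eq_add, smul_eq_mul] at this
  rw [add_comm x, this]
  ring

theorem bary_self {z : E d} (hz : z ∈ T) : bary T z z = 1 := by
  rw [hT.bary_eq_coord hz]; exact hT.basis.coord_apply_eq ⟨z, hz⟩

theorem bary_of_ne {z y : E d} (hz : z ∈ T) (hy : y ∈ T) (h : z ≠ y) : bary T z y = 0 := by
  rw [hT.bary_eq_coord hz]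
  exact hT.basis.coord_apply_ne (i := ⟨z, hz⟩) (j := ⟨y, hy⟩) (fun h' => h (congrArg Subtype.val h'))

theorem bary_le_one {z x : E d} (hz : z ∈ T) (hx : x ∈ cell T) : bary T z x ≤ 1 := by
  rw [← hT.sum_bary x]
  exact Finset.single_le_sum (fun y hy => hT.mem_cell_iff.1 hx y hy) hz

omit hT in
theorem isCompact_cell (T : Finset (E d)) : IsCompact (cell T) :=
  T.finite_toSet.isCompact_convexHull ℝ

omit hT in
theorem convex_cell (T : Finset (E d)) : Convex ℝ (cell T) := convex_convexHull ℝ _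

omit hT in
theorem mem_cell {T : Finset (E d)} {z : E d} (hz : z ∈ T) : z ∈ cell T :=
  subset_convexHull ℝ _ hz

omit hT in
theorem dist_le_cellDiam {T : Finset (E d)} {x y : E d} (hx : x ∈ cell T) (hy : y ∈ cell T) :
    ‖x - y‖ ≤ cellDiam T := by
  rw [← dist_eq_norm]
  exact Metric.dist_le_diam_of_mem (isCompact_cell T).isBounded hx hy

theorem cellDiam_pos (hd : 0 < d) : 0 < cellDiam T := by
  obtain ⟨x, hx, y, hy, hxy⟩ := Finset.one_lt_card.1 (by rw [hT.card_eq]; omega : 1 < T.card)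
  exact (norm_pos_iff.2 (sub_ne_zero.2 hxy)).trans_le (dist_le_cellDiam (mem_cell hx) (mem_cell hy))

/-- The affine function `1 - λ_z` is at least `|x - z| / diam T` on `T`. -/
theorem norm_sub_vertex_le {z x : E d} (hz : z ∈ T) (hx : x ∈ cell T) :
    ‖x - z‖ ≤ (1 - bary T z x) * cellDiam T := by
  classical
  have h1 : x - z = ∑ y ∈ T.erase z, bary T y x • (y - z) := by
    have h2 : ∑ y ∈ T, bary T y x • (y - z) = x - z := by
      simp only [smul_sub, Finset.sum_sub_distrib]
      rw [hT.sum_bary_smul, ← Finset.sum_smul, hT.sum_bary, one_smul]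
    rw [← h2, ← Finset.add_sum_erase T _ hz]
    simp
  have h3 : 1 - bary T z x = ∑ y ∈ T.erase z, bary T y x := by
    rw [← hT.sum_bary x, ← Finset.add_sum_erase T _ hz]; ring
  rw [h1, h3, Finset.sum_mul]
  refine (norm_sum_le _ _).trans (Finset.sum_le_sum fun y hy => ?_)
  have hyT := Finset.mem_of_mem_erase hy
  rw [norm_smul, Real.norm_of_nonneg (hT.mem_cell_iff.1 hx y hyT)]
  exact mul_le_mul_of_nonneg_left (dist_le_cellDiam (mem_cell hyT) (mem_cell hz))
    (hT.mem_cell_iff.1 hx y hyT)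

/-- The coordinate is affine with values in `[0, 1]` on the ball, so it changes by at most `1` along
the diameter parallel to `p - q`, which has length `2 r`. -/
theorem abs_bary_sub_mul_le_of_closedBall {z c : E d} {r : ℝ} (hz : z ∈ T) (hr : 0 ≤ r)
    (hc : Metric.closedBall c r ⊆ cell T) (p q : E d) :
    |bary T z p - bary T z q| * (2 * r) ≤ ‖p - q‖ := by
  rcases eq_or_ne p q with rfl | hpq
  · simp
  have hn : 0 < ‖p - q‖ := norm_pos_iff.2 (sub_ne_zero.2 hpq)
  set s := r / ‖p - q‖ with hs
  have hs0 : 0 ≤ s := by positivity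
  have hsr : s * ‖p - q‖ = r := by rw [hs]; field_simp
  have hmem : ∀ t : ℝ, |t| = s → c + t • (p - q) ∈ cell T := fun t ht => hc (by
    rw [Metric.mem_closedBall, dist_eq_norm, add_sub_cancel_left, norm_smul, Real.norm_eq_abs, ht,
      hsr])
  have hlin : ∀ t : ℝ, bary T z (c + t • (p - q)) =
      bary T z c + t * (bary T z p - bary T z q) := fun t => by
    have h1 := hT.bary_lineMap hz c (c + (p - q)) t
    rw [add_sub_cancel_left] at h1
    have h2 : bary T z (c + (p - q)) - bary T z c = bary T z p - bary T z q := by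
      simp only [hT.bary_eq_coord hz]
      rw [← vsub_eq_sub (hT.basis.coord _ (c + (p - q))), ← AffineMap.linearMap_vsub,
        ← vsub_eq_sub (hT.basis.coord _ p), ← AffineMap.linearMap_vsub]
      simp
    rw [h1, h2]
  have ha := hmem s (abs_of_nonneg hs0)
  have hb := hmem (-s) (by rw [abs_neg, abs_of_nonneg hs0])
  have h1 := hT.mem_cell_iff.1 ha z hz
  have h2 := hT.mem_cell_iff.1 hb z hz
  have h3 := hT.bary_le_one hz ha
  have h4 := hT.bary_le_one hz hb
  rw [hlin] at h1 h2 h3 h4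
  have h5 : |bary T z p - bary T z q| * (2 * s) ≤ 1 := by
    rw [← abs_of_nonneg (by positivity : 0 ≤ 2 * s), ← abs_mul, abs_le]
    constructor <;> linarith
  calc |bary T z p - bary T z q| * (2 * r) =
        |bary T z p - bary T z q| * (2 * s) * ‖p - q‖ := by rw [← hsr]; ring
    _ ≤ 1 * ‖p - q‖ := by gcongr
    _ = _ := one_mul _

omit hT in
-- Guards against the default value of `sSup` for unbounded sets; in dimension `0` every radius
-- would be admissible.
theorem bddAbove_inradius_set (hd : 0 < d) :
    BddAbove {r : ℝ | 0 ≤ r ∧ ∃ x, Metric.closedBall x r ⊆ cell T} := by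
  have : Nonempty (Fin d) := ⟨⟨0, hd⟩⟩
  have : Nontrivial (E d) := inferInstance
  refine ⟨cellDiam T, ?_⟩
  rintro r ⟨hr, x, hx⟩
  obtain ⟨u, hu⟩ := exists_norm_eq (E d) hr
  have := dist_le_cellDiam (hx (show x + u ∈ _ by simp [hu])) (hx (Metric.mem_closedBall_self hr))
  rwa [add_sub_cancel_left, hu] at this

theorem inradius_pos (hd : 0 < d) : 0 < inradius T := by
  have hne : (interior (cell T)).Nonempty := by
    rw [cell, interior_convexHull_nonempty_iff_affineSpan_eq_top, ← hT.range_basis]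
    exact hT.basis.tot
  obtain ⟨x, hx⟩ := hne
  obtain ⟨r, hr, hrx⟩ := Metric.nhds_basis_closedBall.mem_iff.1 (mem_interior_iff_mem_nhds.1 hx)
  exact hr.trans_le (le_csSup (bddAbove_inradius_set hd) ⟨hr.le, x, hrx⟩)

theorem abs_bary_sub_mul_inradius_le {z : E d} (hz : z ∈ T) (p q : E d) :
    |bary T z p - bary T z q| * (2 * inradius T) ≤ ‖p - q‖ := by
  rcases (abs_nonneg (bary T z p - bary T z q)).eq_or_lt with h | h
  · rw [← h]; simp
  · rw [mul_comm, ← le_div_iff₀ h, ← le_div_iff₀' two_pos]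
    refine csSup_le ⟨0, le_rfl, z, by simpa using mem_cell hz⟩ ?_
    rintro r ⟨hr, c, hc⟩
    rw [le_div_iff₀' two_pos, le_div_iff₀ h, mul_comm]
    exact hT.abs_bary_sub_mul_le_of_closedBall hz hr hc p q

/-- Along the ray from `z` the other coordinates are multiplied by `t`, while that of `z` becomes `1
- t (1 - λ_z)`. The latter alone limits how far the ray stays in the cell, and `t > 1` is allowed.
-/
theorem lineMap_mem_cell {z x : E d} (hz : z ∈ T) (hx : x ∈ cell T) {t : ℝ} (h0 : 0 ≤ t)
    (h1 : t * (1 - bary T z x) ≤ 1) : z + t • (x - z) ∈ cell T := by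
  rw [hT.mem_cell_iff]
  intro y hy
  rw [hT.bary_lineMap hy]
  rcases eq_or_ne y z with rfl | hyz
  · rw [hT.bary_self hz]; linarith
  · rw [hT.bary_of_ne hy hz hyz]
    have := mul_nonneg h0 (hT.mem_cell_iff.1 hx y hy)
    linarith

end IsNondegenerate

open IsNondegenerate

/-! ### Regular meshes and hat functions -/

namespace IsRegularMesh

variable {Ω : Set (E d)} {𝒯 : Finset (Finset (E d))} (hM : IsRegularMesh Ω 𝒯)

include hM

theorem nondeg {T : Finset (E d)} (hT : T ∈ 𝒯) : IsNondegenerate T :=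
  ⟨hM.card_eq T hT, hM.affineIndependent T hT⟩

theorem cell_subset {T : Finset (E d)} (hT : T ∈ 𝒯) : cell T ⊆ closure Ω := by
  rw [← hM.cover]; exact Set.subset_biUnion_of_mem (u := fun T => cell T) hT

theorem exists_mem_cell {x : E d} (hx : x ∈ closure Ω) : ∃ T ∈ 𝒯, x ∈ cell T := by
  rw [← hM.cover] at hx; simpa using hx

/-- A point in two cells has its barycentric coordinates supported in the common vertices. -/
theorem exists_weights {T K : Finset (E d)} (hT : T ∈ 𝒯) (hK : K ∈ 𝒯) {x : E d}
    (hxT : x ∈ cell T) (hxK : x ∈ cell K) : ∃ w : E d → ℝ,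
      (∀ z ∈ T, bary T z x = w z) ∧ (∀ z ∈ K, bary K z x = w z) ∧
      ∀ z, z ∉ T ∨ z ∉ K → w z = 0 := by
  classical
  have hx : x ∈ convexHull ℝ ((T ∩ K : Finset (E d)) : Set (E d)) := by
    rw [Finset.coe_inter, ← hM.conforming T hT K hK]; exact ⟨hxT, hxK⟩
  rw [Finset.mem_convexHull'] at hx
  obtain ⟨w, -, hw1, hw2⟩ := hx
  set w' : E d → ℝ := fun y => if y ∈ T ∩ K then w y else 0 with hw'
  have h0 : ∀ y, y ∉ T ∩ K → w' y = 0 := fun y hy => by simp only [hw', if_neg hy]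
  have hsum : ∀ S : Finset (E d), T ∩ K ⊆ S → ∑ y ∈ S, w' y = 1 ∧ ∑ y ∈ S, w' y • y = x := by
    intro S hS
    rw [← Finset.sum_subset hS (fun y _ hy => h0 y hy),
      ← Finset.sum_subset hS (fun y _ hy => by rw [h0 y hy, zero_smul]), ← hw1, ← hw2]
    exact ⟨Finset.sum_congr rfl fun y hy => by simp only [hw', if_pos hy],
      Finset.sum_congr rfl fun y hy => by simp only [hw', if_pos hy]⟩
  refine ⟨w', fun z hz => ?_, fun z hz => ?_, fun z hz => h0 z ?_⟩
  · obtain ⟨h1, h2⟩ := hsum T Finset.inter_subset_left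
    exact (hM.nondeg hT).bary_eq_of_weights h1 h2 hz
  · obtain ⟨h1, h2⟩ := hsum K Finset.inter_subset_right
    exact (hM.nondeg hK).bary_eq_of_weights h1 h2 hz
  · rw [Finset.mem_inter]; tauto

/-- Conformity makes the choice of a cell in `hat` irrelevant: the coordinates of `x` in two cells
are carried by their common vertices and coincide. -/
theorem hat_eq_bary {T : Finset (E d)} (hT : T ∈ 𝒯) {z x : E d} (hz : z ∈ T) (hx : x ∈ cell T) :
    hat 𝒯 z x = bary T z x := by
  have h : ∃ T ∈ 𝒯, z ∈ T ∧ x ∈ cell T := ⟨T, hT, hz, hx⟩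
  rw [hat, dif_pos h]
  obtain ⟨h1, h2, h3⟩ := h.choose_spec
  obtain ⟨w, hw1, hw2, -⟩ := hM.exists_weights hT h1 hx h3
  rw [hw1 z hz, hw2 z h2]

omit hM in
theorem hat_eq_zero_of_forall {z x : E d} (h : ∀ T ∈ 𝒯, z ∈ T → x ∉ cell T) : hat 𝒯 z x = 0 := by
  rw [hat, dif_neg]
  rintro ⟨T, hT, hz, hx⟩
  exact h T hT hz hx

theorem hat_eq_zero {T : Finset (E d)} (hT : T ∈ 𝒯) {z x : E d} (hz : z ∉ T) (hx : x ∈ cell T) :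
    hat 𝒯 z x = 0 := by
  by_cases h : ∃ K ∈ 𝒯, z ∈ K ∧ x ∈ cell K
  · obtain ⟨K, hK, hzK, hxK⟩ := h
    obtain ⟨w, -, hw2, hw3⟩ := hM.exists_weights hT hK hx hxK
    rw [hM.hat_eq_bary hK hzK hxK, hw2 z hzK, hw3 z (Or.inl hz)]
  · exact hat_eq_zero_of_forall fun K hK hzK hxK => h ⟨K, hK, hzK, hxK⟩

theorem hat_nonneg (z x : E d) : 0 ≤ hat 𝒯 z x := by
  by_cases h : ∃ K ∈ 𝒯, z ∈ K ∧ x ∈ cell K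
  · obtain ⟨K, hK, hzK, hxK⟩ := h
    rw [hM.hat_eq_bary hK hzK hxK]
    exact (hM.nondeg hK).mem_cell_iff.1 hxK z hzK
  · exact (hat_eq_zero_of_forall fun K hK hzK hxK => h ⟨K, hK, hzK, hxK⟩).ge

theorem hat_le_one (z x : E d) : hat 𝒯 z x ≤ 1 := by
  by_cases h : ∃ K ∈ 𝒯, z ∈ K ∧ x ∈ cell K
  · obtain ⟨K, hK, hzK, hxK⟩ := h
    rw [hM.hat_eq_bary hK hzK hxK]
    exact (hM.nondeg hK).bary_le_one hzK hxK
  · exact (hat_eq_zero_of_forall fun K hK hzK hxK => h ⟨K, hK, hzK, hxK⟩).le.trans zero_le_one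

theorem continuousOn_hat (z : E d) : ContinuousOn (hat 𝒯 z) (closure Ω) := by
  have hU : closure Ω = ⋃ T : 𝒯, cell T.1 := by
    rw [← hM.cover]; ext x; simp
  rw [hU]
  refine (locallyFinite_of_finite _).continuousOn_iUnion
    (fun T => (isCompact_cell T.1).isClosed) fun T => ?_
  by_cases hz : z ∈ T.1
  · exact ((hM.nondeg T.2).continuous_bary hz).continuousOn.congr
      fun x hx => hM.hat_eq_bary T.2 hz hx
  · exact continuousOn_const.congr fun x hx => hM.hat_eq_zero T.2 hz hx

theorem aestronglyMeasurable_hat (z : E d) :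
    AEStronglyMeasurable (hat 𝒯 z) (volume.restrict Ω) :=
  ((hM.continuousOn_hat z).aestronglyMeasurable isClosed_closure.measurableSet).mono_measure
    (Measure.restrict_mono subset_closure le_rfl)

theorem hat_self {T : Finset (E d)} (hT : T ∈ 𝒯) {z : E d} (hz : z ∈ T) : hat 𝒯 z z = 1 := by
  rw [hM.hat_eq_bary hT hz (mem_cell hz), (hM.nondeg hT).bary_self hz]

theorem hat_of_ne {T : Finset (E d)} (hT : T ∈ 𝒯) {z y : E d} (hy : y ∈ T) (h : z ≠ y) :
    hat 𝒯 z y = 0 := by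
  by_cases hz : z ∈ T
  · rw [hM.hat_eq_bary hT hz (mem_cell hy), (hM.nondeg hT).bary_of_ne hz hy h]
  · exact hM.hat_eq_zero hT hz (mem_cell hy)

theorem disjoint_interior {T K : Finset (E d)} (hT : T ∈ 𝒯) (hK : K ∈ 𝒯) (h : T ≠ K) :
    Disjoint (interior (cell T)) (interior (cell K)) := by
  rw [Set.disjoint_left]
  intro x hxT hxK
  obtain ⟨y, hyT, hyK⟩ : ∃ y ∈ T, y ∉ K := by
    by_contra! hcon
    exact h (Finset.eq_of_subset_of_card_le hcon (by rw [hM.card_eq T hT, hM.card_eq K hK]))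
  obtain ⟨w, hw1, -, hw3⟩ := hM.exists_weights hT hK (interior_subset hxT) (interior_subset hxK)
  have := (hM.nondeg hT).mem_interior_cell_iff.1 hxT y hyT
  rw [hw1 y hyT, hw3 y (Or.inr hyK)] at this
  exact this.false

omit hM in
theorem interior_cell_ae_eq (T : Finset (E d)) {μ : Measure (E d)} (hμ : μ ≪ volume) :
    interior (cell T) =ᵐ[μ] cell T := by
  refine hμ.ae_le ?_
  exact interior_ae_eq_of_null_frontier ((convex_cell T).addHaar_frontier volume)

/-- The cells overlap in null sets only. -/
theorem sum_setIntegral_cell_le {𝒮 : Finset (Finset (E d))} (h𝒮 : 𝒮 ⊆ 𝒯) {μ : Measure (E d)}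
    (hμ : μ ≪ volume) {F : E d → ℝ} (hF : Integrable F μ) (h0 : ∀ᵐ x ∂μ, 0 ≤ F x) :
    ∑ T ∈ 𝒮, ∫ x in cell T, F x ∂μ ≤ ∫ x, F x ∂μ := by
  have h1 : ∑ T ∈ 𝒮, ∫ x in cell T, F x ∂μ = ∑ T ∈ 𝒮, ∫ x in interior (cell T), F x ∂μ :=
    Finset.sum_congr rfl fun T _ => (setIntegral_congr_set (interior_cell_ae_eq T hμ)).symm
  rw [h1, ← integral_biUnion_finset 𝒮 (fun T _ => isOpen_interior.measurableSet)
    (fun T hT K hK h => hM.disjoint_interior (h𝒮 hT) (h𝒮 hK) h) (fun T _ => hF.integrableOn)]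
  exact setIntegral_le_integral hF h0

theorem ae_exists_mem_interior : ∀ᵐ x ∂(volume.restrict Ω), ∃ T ∈ 𝒯, x ∈ interior (cell T) := by
  have h1 : ∀ᵐ x ∂(volume : Measure (E d)), ∀ T ∈ 𝒯, x ∉ frontier (cell T) := by
    rw [Finset.eventually_all]
    exact fun T _ => measure_eq_zero_iff_ae_notMem.1 ((convex_cell T).addHaar_frontier volume)
  have h2 : ∀ᵐ x ∂(volume.restrict Ω), x ∈ closure Ω :=
    ae_restrict_of_ae_restrict_of_subset subset_closure
      (ae_restrict_mem isClosed_closure.measurableSet)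
  filter_upwards [ae_restrict_of_ae h1, h2] with x hx hxΩ
  obtain ⟨T, hT, hxT⟩ := hM.exists_mem_cell hxΩ
  refine ⟨T, hT, ?_⟩
  by_contra h
  exact hx T hT ⟨subset_closure hxT, h⟩

theorem setIntegral_eq_sum {F : E d → ℝ} (hF : Integrable F (volume.restrict Ω)) :
    ∫ x in Ω, F x = ∑ T ∈ 𝒯, ∫ x in cell T, F x ∂(volume.restrict Ω) := by
  have h1 : ∑ T ∈ 𝒯, ∫ x in cell T, F x ∂(volume.restrict Ω) =
      ∑ T ∈ 𝒯, ∫ x in interior (cell T), F x ∂(volume.restrict Ω) :=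
    Finset.sum_congr rfl fun T _ => (setIntegral_congr_set
      (interior_cell_ae_eq T Measure.absolutelyContinuous_restrict)).symm
  rw [h1, ← integral_biUnion_finset 𝒯 (fun T _ => isOpen_interior.measurableSet)
    (fun T hT K hK h => hM.disjoint_interior hT hK h) (fun T _ => hF.integrableOn)]
  have h2 : (volume.restrict Ω).restrict (⋃ T ∈ 𝒯, interior (cell T)) = volume.restrict Ω := by
    refine Measure.restrict_eq_self_of_ae_mem ?_
    filter_upwards [hM.ae_exists_mem_interior] with x hx
    simpa using hx
  rw [h2]

theorem meshSize_eq {T : Finset (E d)} (hT : T ∈ 𝒯) {x : E d} (hx : x ∈ interior (cell T)) :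
    meshSize 𝒯 x = cellDiam T := by
  rw [meshSize, Finset.sum_eq_single_of_mem T hT, Set.indicator_of_mem hx]
  intro K hK hKT
  exact Set.indicator_of_notMem
    (fun hxK => Set.disjoint_left.1 (hM.disjoint_interior hK hT hKT) hxK hx) _

/-- Hat functions have slope at most `γ / diam T` on each cell. Shape regularity enters the whole
proof only through this bound. -/
theorem abs_bary_sub_le {γ : ℝ} (hd : 0 < d) (hγ : shapeRegularity 𝒯 ≤ γ) {T : Finset (E d)}
    (hT : T ∈ 𝒯) {z : E d} (hz : z ∈ T) (p q : E d) :
    |bary T z p - bary T z q| * cellDiam T ≤ γ * ‖p - q‖ := by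
  have hr := (hM.nondeg hT).inradius_pos hd
  have h1 : cellDiam T / (2 * inradius T) ≤ γ :=
    (le_ciSup (f := fun T : 𝒯 => cellDiam T.1 / (2 * inradius T.1))
      (Set.finite_range _).bddAbove ⟨T, hT⟩).trans hγ
  have hγ0 : 0 ≤ γ := (div_nonneg ((hM.nondeg hT).cellDiam_pos hd).le (by positivity)).trans h1
  rw [div_le_iff₀ (by positivity)] at h1
  calc |bary T z p - bary T z q| * cellDiam T
      ≤ |bary T z p - bary T z q| * (γ * (2 * inradius T)) := by gcongr
    _ = γ * (|bary T z p - bary T z q| * (2 * inradius T)) := by ring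
    _ ≤ γ * ‖p - q‖ := by
      gcongr
      exact (hM.nondeg hT).abs_bary_sub_mul_inradius_le hz p q

omit hM in
theorem cellDiam_le_maxMeshSize {T : Finset (E d)} (hT : T ∈ 𝒯) : cellDiam T ≤ maxMeshSize 𝒯 :=
  le_ciSup (f := fun T : 𝒯 => cellDiam T.1) (Set.finite_range _).bddAbove ⟨T, hT⟩

end IsRegularMesh

/-! ### The uniform cone condition -/

/-- Near every boundary point `z`, within the radius `r`, translates of points of the closure of `Ω`
by vectors of a cone of aperture `θ` around some axis `e` belong to `Ω`. -/
structure HasCone (Ω : Set (E d)) (r θ : ℝ) : Prop where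
  r_pos : 0 < r
  θ_pos : 0 < θ
  θ_le : θ ≤ 1
  cone : ∀ z ∈ frontier Ω, ∃ e : E d, ‖e‖ = 1 ∧ ∀ x ∈ closure Ω, x ∈ Metric.ball z r →
    ∀ s : ℝ, 0 < s → ∀ u : E d, ‖u - s • e‖ < θ * s → x + u ∈ Metric.ball z r → x + u ∈ Ω

/-- Write `u = s e + w`. The height above the horizontal plane grows by at least `s - ‖w‖`, the
graph below by at most `2 K ‖w‖`; so `(2 K + 1) ‖w‖ < s` keeps the point strictly above the graph.
-/
theorem IsLipschitzDomain.exists_local_cone {Ω : Set (E d)} (hΩ : IsLipschitzDomain Ω) {x₀ : E d}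
    (hx₀ : x₀ ∈ frontier Ω) : ∃ r > 0, ∃ θ, 0 < θ ∧ θ ≤ 1 ∧ ∃ e : E d, ‖e‖ = 1 ∧
      ∀ x ∈ closure Ω, x ∈ Metric.ball x₀ r → ∀ s : ℝ, 0 < s → ∀ u : E d, ‖u - s • e‖ < θ * s →
        x + u ∈ Metric.ball x₀ r → x + u ∈ Ω := by
  obtain ⟨r, e, K, ψ, hr, he, hψ, h⟩ := hΩ.lipschitz_boundary x₀ hx₀
  have hK : (0 : ℝ) ≤ K := K.2
  refine ⟨r, hr, (2 * K + 1)⁻¹, by positivity, inv_le_one_of_one_le₀ (by linarith), e, he, ?_⟩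
  intro x hx hxr s hs u hu hxu
  rw [h _ hxu]
  -- For points of the closure only the weak inequality survives; the strict one is regained from
  -- the cone.
  have hx' : ψ (x - inner ℝ x e • e) ≤ inner ℝ x e := by
    have h1 : x ∈ closure (Metric.ball x₀ r ∩ Ω) := Metric.isOpen_ball.inter_closure ⟨hxr, hx⟩
    have hψc := hψ.continuous
    have h2 : IsClosed {y : E d | ψ (y - inner ℝ y e • e) ≤ inner ℝ y e} :=
      isClosed_le (by fun_prop) (by fun_prop)
    exact closure_minimal (fun y hy => ((h y hy.1).1 hy.2).le) h2 h1
  set w := u - s • e with hw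
  have hu' : u = s • e + w := by rw [hw]; abel
  have hwe : |inner ℝ w e| ≤ ‖w‖ := by simpa [he] using abs_real_inner_le_norm w e
  have hee : inner ℝ e e = (1 : ℝ) := by rw [real_inner_self_eq_norm_sq, he]; norm_num
  have h1 : inner ℝ (x + u) e = inner ℝ x e + s + inner ℝ w e := by
    rw [hu', inner_add_left, inner_add_left, real_inner_smul_left, hee]; ring
  have h2 : x + u - inner ℝ (x + u) e • e - (x - inner ℝ x e • e) = w - inner ℝ w e • e := by
    rw [h1, hu']; module
  have h3 : ‖w - inner ℝ w e • e‖ ≤ 2 * ‖w‖ := by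
    refine (norm_sub_le _ _).trans ?_
    rw [norm_smul, he, Real.norm_eq_abs]; linarith
  have h4 := hψ.dist_le_mul (x + u - inner ℝ (x + u) e • e) (x - inner ℝ x e • e)
  rw [dist_eq_norm, dist_eq_norm, h2] at h4
  have h5 := (abs_le.1 ((Real.norm_eq_abs _).symm.le.trans h4)).2
  have h6 : (K : ℝ) * ‖w - inner ℝ w e • e‖ ≤ K * (2 * ‖w‖) := by gcongr
  have h7 : (2 * K + 1) * ‖w‖ < s := by
    rwa [inv_mul_eq_div, lt_div_iff₀' (by positivity)] at hu
  have h8 := (abs_le.1 hwe).1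
  linarith

/-- Compactness of the boundary makes radius and aperture uniform. Halving the radius of a chart
lets it serve all boundary points in the concentric smaller ball. -/
theorem IsLipschitzDomain.exists_hasCone {Ω : Set (E d)} (hΩ : IsLipschitzDomain Ω) :
    ∃ r θ : ℝ, HasCone Ω r θ := by
  have hcomp : IsCompact (frontier Ω) :=
    Metric.isCompact_of_isClosed_isBounded isClosed_frontier
      (hΩ.isBounded.closure.subset frontier_subset_closure)
  have key := hcomp.induction_on (p := fun S => ∃ r θ : ℝ, 0 < r ∧ 0 < θ ∧ θ ≤ 1 ∧
    ∀ z ∈ S, ∃ e : E d, ‖e‖ = 1 ∧ ∀ x ∈ closure Ω, x ∈ Metric.ball z r →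
    ∀ s : ℝ, 0 < s → ∀ u : E d, ‖u - s • e‖ < θ * s → x + u ∈ Metric.ball z r → x + u ∈ Ω)
    ⟨1, 1, one_pos, one_pos, le_rfl, by simp⟩
    (fun S S' hSS' ⟨r, θ, h1, h2, h3, h4⟩ => ⟨r, θ, h1, h2, h3, fun z hz => h4 z (hSS' hz)⟩)
    (fun S S' ⟨r, θ, h1, h2, h3, h4⟩ ⟨r', θ', h1', h2', h3', h4'⟩ =>
      ⟨min r r', min θ θ', lt_min h1 h1', lt_min h2 h2', (min_le_left _ _).trans h3,
        fun z hz => ?_⟩)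
    (fun x₀ hx₀ => ?_)
  · obtain ⟨r, θ, h1, h2, h3, h4⟩ := key
    exact ⟨r, θ, h1, h2, h3, h4⟩
  · rcases hz with hz | hz
    · obtain ⟨e, he, h⟩ := h4 z hz
      refine ⟨e, he, fun x hx hxr s hs u hu hxu => h x hx
        (Metric.ball_subset_ball (min_le_left _ _) hxr) s hs u (hu.trans_le ?_)
        (Metric.ball_subset_ball (min_le_left _ _) hxu)⟩
      exact mul_le_mul_of_nonneg_right (min_le_left _ _) hs.le
    · obtain ⟨e, he, h⟩ := h4' z hz
      refine ⟨e, he, fun x hx hxr s hs u hu hxu => h x hx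
        (Metric.ball_subset_ball (min_le_right _ _) hxr) s hs u (hu.trans_le ?_)
        (Metric.ball_subset_ball (min_le_right _ _) hxu)⟩
      exact mul_le_mul_of_nonneg_right (min_le_right _ _) hs.le
  · obtain ⟨r, hr, θ, hθ, hθ1, e, he, h⟩ := hΩ.exists_local_cone hx₀
    refine ⟨Metric.ball x₀ (r / 2), mem_nhdsWithin_of_mem_nhds (Metric.ball_mem_nhds _ (by linarith)),
      r / 2, θ, by linarith, hθ, hθ1, fun z hz => ⟨e, he, fun x hx hxr s hs u hu hxu => ?_⟩⟩
    have hsub : Metric.ball z (r / 2) ⊆ Metric.ball x₀ r :=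
      Metric.ball_subset_ball' (by have := Metric.mem_ball.1 hz; linarith)
    exact h x hx (hsub hxr) s hs u hu (hsub hxu)

theorem notMem_of_mem_frontier {Ω : Set (E d)} (hΩ : IsOpen Ω) {z : E d} (hz : z ∈ frontier Ω) :
    z ∉ Ω := by
  rw [hΩ.frontier_eq] at hz; exact hz.2

/-- The interior cone also yields exterior balls: a point `y` of `Ω` in such a ball would have `z -
y` in the cone, which would put the boundary point `z` into the open set `Ω`. -/
theorem HasCone.exists_exterior {Ω : Set (E d)} {r θ : ℝ} (h : HasCone Ω r θ) (hΩ : IsOpen Ω)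
    {z : E d} (hz : z ∈ frontier Ω) : ∃ e : E d, ‖e‖ = 1 ∧ ∀ s, 0 < s → 2 * s < r →
      Disjoint (Metric.ball (z - s • e) (θ * s)) Ω := by
  obtain ⟨e, he, hc⟩ := h.cone z hz
  refine ⟨e, he, fun s hs hsr => Set.disjoint_left.2 fun y hy hyΩ => ?_⟩
  rw [Metric.mem_ball, dist_eq_norm] at hy
  have h1 : y + (z - y) ∈ Ω := by
    refine hc y (subset_closure hyΩ) ?_ s hs (z - y) ?_ ?_
    · rw [Metric.mem_ball, dist_eq_norm]
      have : y - z = (y - (z - s • e)) - s • e := by abel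
      rw [this]
      refine (norm_sub_le _ _).trans_lt ?_
      rw [norm_smul, he, Real.norm_of_nonneg hs.le]
      have := mul_le_of_le_one_left hs.le h.θ_le
      linarith
    · rwa [← norm_neg, show -(z - y - s • e) = y - (z - s • e) by abel]
    · simpa using h.r_pos
  rw [add_sub_cancel] at h1
  exact notMem_of_mem_frontier hΩ hz h1

/-- Exterior balls centred arbitrarily close to a boundary point exclude slits. This is used to
deduce that a ball covered by cells lies in `Ω` and not merely in its closure. -/
theorem HasCone.interior_closure {Ω : Set (E d)} {r θ : ℝ} (h : HasCone Ω r θ) (hΩ : IsOpen Ω) :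
    interior (closure Ω) = Ω := by
  refine Set.Subset.antisymm (fun z hz => ?_) hΩ.subset_interior_closure
  by_contra hzΩ
  have hzf : z ∈ frontier Ω := by
    rw [hΩ.frontier_eq]; exact ⟨interior_subset hz, hzΩ⟩
  obtain ⟨e, he, hext⟩ := h.exists_exterior hΩ hzf
  obtain ⟨δ, hδ, hball⟩ := Metric.isOpen_iff.1 isOpen_interior z hz
  have hr := h.r_pos
  set s := min (δ / 2) (r / 4) with hs
  have hs0 : 0 < s := lt_min (by linarith) (by linarith)
  have hs1 : s ≤ δ / 2 := min_le_left _ _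
  have hs2 : s ≤ r / 4 := min_le_right _ _
  have h1 : z - s • e ∈ closure Ω := interior_subset (hball (by
    rw [Metric.mem_ball, dist_eq_norm, sub_sub_cancel_left, norm_neg, norm_smul, he,
      Real.norm_of_nonneg hs0.le]
    linarith))
  have hdis := hext s hs0 (by linarith)
  exact (Set.disjoint_left.1 (hdis.closure_right Metric.isOpen_ball))
    (Metric.mem_ball_self (mul_pos h.θ_pos hs0)) h1

/-- The exterior ball with `s = ρ / 2` has radius `θ ρ / 2` and fits into the ball of radius `ρ`
about `z`. -/
theorem HasCone.volume_diff_ge {Ω : Set (E d)} {r θ : ℝ} (h : HasCone Ω r θ) (hΩ : IsOpen Ω)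
    {z : E d} (hz : z ∈ frontier Ω) {ρ : ℝ} (hρ : 0 < ρ) (hρr : ρ < r) :
    (θ / 2) ^ d * volume.real (Metric.closedBall z ρ) ≤
      volume.real (Metric.closedBall z ρ \ Ω) := by
  obtain ⟨e, he, hext⟩ := h.exists_exterior hΩ hz
  have hdis := hext (ρ / 2) (by linarith) (by linarith)
  have hθ := h.θ_pos
  have hsub : Metric.ball (z - (ρ / 2) • e) (θ * (ρ / 2)) ⊆ Metric.closedBall z ρ \ Ω := by
    refine fun y hy => ⟨?_, Set.disjoint_left.1 hdis hy⟩
    rw [Metric.mem_ball, dist_eq_norm] at hy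
    rw [Metric.mem_closedBall, dist_eq_norm]
    have : y - z = (y - (z - (ρ / 2) • e)) - (ρ / 2) • e := by abel
    rw [this]
    refine (norm_sub_le _ _).trans ?_
    rw [norm_smul, he, Real.norm_of_nonneg (by linarith)]
    have := mul_le_of_le_one_left (by linarith : 0 ≤ ρ / 2) h.θ_le
    linarith
  refine le_trans (le_of_eq ?_) (measureReal_mono hsub
    ((measure_mono Set.sdiff_subset).trans_lt measure_closedBall_lt_top).ne)
  rw [Measure.real, Measure.real, Measure.addHaar_closedBall _ _ hρ.le,
    Measure.addHaar_ball_of_pos volume (z - (ρ / 2) • e) (by positivity : 0 < θ * (ρ / 2)),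
    ENNReal.toReal_mul, ENNReal.toReal_mul,
    ENNReal.toReal_ofReal (by positivity), ENNReal.toReal_ofReal (by positivity)]
  simp only [finrank_euclideanSpace, Fintype.card_fin]
  rw [← mul_assoc, ← mul_pow]
  ring

/-! ### Local quasi-uniformity of shape regular meshes -/

/-- A function that is Lipschitz on each of finitely many closed sets covering `[0, 1]` is Lipschitz
on `[0, 1]`. -/
theorem abs_sub_le_of_piecewise {ι : Type*} (s : Finset ι) {S : ι → Set ℝ} {G : ℝ → ℝ} {L : ℝ}
    (hS : ∀ i ∈ s, IsClosed (S i)) (hcov : ∀ t ∈ Set.Icc (0 : ℝ) 1, ∃ i ∈ s, t ∈ S i)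
    (hG : ContinuousOn G (Set.Icc 0 1))
    (hL : ∀ i ∈ s, ∀ a ∈ S i, ∀ b ∈ S i, a ∈ Set.Icc (0 : ℝ) 1 → b ∈ Set.Icc (0 : ℝ) 1 →
      |G a - G b| ≤ L * |a - b|) : |G 1 - G 0| ≤ L := by
  set P : Set ℝ := {t | |G t - G 0| ≤ L * t} with hP
  have hclosed : IsClosed (P ∩ Set.Icc 0 1) := by
    have h1 : ContinuousOn (fun t => L * t - |G t - G 0|) (Set.Icc 0 1) :=
      (by fun_prop : ContinuousOn (fun t => L * t) (Set.Icc (0 : ℝ) 1)).sub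
        (hG.sub continuousOn_const).abs
    have h2 := h1.preimage_isClosed_of_isClosed isClosed_Icc (isClosed_Ici (a := (0 : ℝ)))
    convert! h2 using 1
    ext t
    simp [hP, and_comm]
  have hsub : Set.Icc (0 : ℝ) 1 ⊆ P := by
    refine hclosed.Icc_subset_of_forall_exists_gt (by simp [hP]) ?_
    rintro x ⟨hxP, hx⟩ y hy
    -- Continuation to the right of `x`: the finitely many closed sets that miss `x` also miss a
    -- neighbourhood, so any set met just after `x` contains `x`, and its Lipschitz bound applies
    -- between the two points.
    have hev : ∀ᶠ t in nhdsWithin x (Set.Ioi x), ∀ i ∈ s, t ∈ S i → x ∈ S i := by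
      refine Filter.Eventually.filter_mono nhdsWithin_le_nhds ?_
      rw [Finset.eventually_all]
      intro i hi
      by_cases hxi : x ∈ S i
      · exact Filter.Eventually.of_forall fun _ _ => hxi
      · filter_upwards [(hS i hi).isOpen_compl.mem_nhds hxi] with t ht ht'
        exact absurd ht' ht
    obtain ⟨t, ht, htx, hty⟩ := (hev.and (Ioc_mem_nhdsGT (lt_min hy hx.2))).exists
    have ht1 : t ∈ Set.Icc (0 : ℝ) 1 := ⟨hx.1.trans htx.le, hty.trans (min_le_right _ _)⟩
    obtain ⟨i, hi, hti⟩ := hcov t ht1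
    refine ⟨t, ?_, htx, hty.trans (min_le_left _ _)⟩
    have h1 := hL i hi t hti x (ht i hi hti) ht1 ⟨hx.1, hx.2.le⟩
    rw [abs_of_pos (sub_pos.2 htx)] at h1
    have h2 : |G x - G 0| ≤ L * x := hxP
    have h3 := abs_sub_le (G t) (G x) (G 0)
    change |G t - G 0| ≤ L * t
    linarith
  have := hsub (Set.right_mem_Icc.2 zero_le_one)
  simpa [hP] using this

/-- The logarithm has slope at most `1 / m` on `[m, ∞)`; obtained from `log t ≤ t - 1` at a
quotient. -/
theorem abs_log_sub_log_le {a b c m : ℝ} (hm : 0 < m) (ha : m ≤ a) (hb : m ≤ b)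
    (h : |a - b| ≤ c * m) : |Real.log a - Real.log b| ≤ c := by
  have key : ∀ a b : ℝ, m ≤ a → m ≤ b → |a - b| ≤ c * m → Real.log a - Real.log b ≤ c := by
    intro a b ha hb h
    have ha0 := hm.trans_le ha
    have hb0 := hm.trans_le hb
    have hc : 0 ≤ c := nonneg_of_mul_nonneg_left ((abs_nonneg _).trans h) hm
    rw [← Real.log_div ha0.ne' hb0.ne']
    refine (Real.log_le_sub_one_of_pos (by positivity)).trans ?_
    rw [div_sub_one hb0.ne', div_le_iff₀ hb0]
    exact (le_abs_self _).trans (h.trans (by gcongr))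
  rw [abs_le]
  constructor
  · have := key b a hb ha (by rwa [abs_sub_comm])
    linarith
  · exact key a b ha hb h

namespace IsRegularMesh

variable {Ω : Set (E d)} {𝒯 : Finset (Finset (E d))} (hM : IsRegularMesh Ω 𝒯)

include hM

theorem one_le_shape (hd : 0 < d) {γ : ℝ} (hγ : shapeRegularity 𝒯 ≤ γ) {T : Finset (E d)}
    (hT : T ∈ 𝒯) : 1 ≤ γ := by
  obtain ⟨z, hz, y, hy, hzy⟩ := Finset.one_lt_card.1
    (by rw [hM.card_eq T hT]; omega : 1 < T.card)
  have h1 := hM.abs_bary_sub_le hd hγ hT hz z y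
  rw [(hM.nondeg hT).bary_self hz, (hM.nondeg hT).bary_of_ne hz hy hzy] at h1
  have h2 := dist_le_cellDiam (mem_cell hz) (mem_cell hy)
  have h3 : 0 < ‖z - y‖ := norm_pos_iff.2 (sub_ne_zero.2 hzy)
  norm_num at h1
  by_contra! h
  nlinarith

/-- On a segment near the vertex `z`, at distance at least `η` from `z`, the logarithm of
`1 - φ_z` is Lipschitz with constant `γ / η`. -/
theorem abs_log_one_sub_hat_le (hd : 0 < d) {γ : ℝ} (hγ : shapeRegularity 𝒯 ≤ γ) {z a b : E d}
    {η : ℝ} (hη : 0 < η) (hΩ : ∀ t ∈ Set.Icc (0 : ℝ) 1, a + t • (b - a) ∈ closure Ω)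
    (hz : ∀ t ∈ Set.Icc (0 : ℝ) 1, ∀ K ∈ 𝒯, a + t • (b - a) ∈ cell K → z ∈ K)
    (hfar : ∀ t ∈ Set.Icc (0 : ℝ) 1, η ≤ ‖a + t • (b - a) - z‖) :
    |Real.log (1 - hat 𝒯 z b) - Real.log (1 - hat 𝒯 z a)| ≤ γ * ‖b - a‖ / η := by
  -- The lower bound `η / diam K` for `1 - φ_z` and its slope `γ / diam K` scale alike, so the cell
  -- diameter cancels in the slope of the logarithm.
  have hlow : ∀ t ∈ Set.Icc (0 : ℝ) 1, ∀ K ∈ 𝒯, a + t • (b - a) ∈ cell K →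
      η / cellDiam K ≤ 1 - hat 𝒯 z (a + t • (b - a)) := fun t ht K hK htK => by
    have hzK := hz t ht K hK htK
    rw [hM.hat_eq_bary hK hzK htK, div_le_iff₀ ((hM.nondeg hK).cellDiam_pos hd)]
    exact (hfar t ht).trans ((hM.nondeg hK).norm_sub_vertex_le hzK htK)
  have hpos : ∀ t ∈ Set.Icc (0 : ℝ) 1, 0 < 1 - hat 𝒯 z (a + t • (b - a)) := fun t ht => by
    obtain ⟨K, hK, htK⟩ := hM.exists_mem_cell (hΩ t ht)
    exact (div_pos hη ((hM.nondeg hK).cellDiam_pos hd)).trans_le (hlow t ht K hK htK)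
  have key := abs_sub_le_of_piecewise 𝒯 (S := fun K => {t | a + t • (b - a) ∈ cell K})
    (G := fun t => Real.log (1 - hat 𝒯 z (a + t • (b - a)))) (L := γ * ‖b - a‖ / η)
    (fun K _ => (isCompact_cell K).isClosed.preimage (by fun_prop))
    (fun t ht => hM.exists_mem_cell (hΩ t ht)) ?_ ?_
  · simpa using key
  · refine ContinuousOn.log (continuousOn_const.sub ?_) fun t ht => (hpos t ht).ne'
    exact (hM.continuousOn_hat z).comp (by fun_prop) hΩ
  · intro K hK s hs t ht hs1 ht1
    have hD := (hM.nondeg hK).cellDiam_pos hd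
    have hzK := hz s hs1 K hK hs
    refine abs_log_sub_log_le (div_pos hη hD) (hlow s hs1 K hK hs) (hlow t ht1 K hK ht) ?_
    have h1 := hM.abs_bary_sub_le hd hγ hK hzK (a + s • (b - a)) (a + t • (b - a))
    rw [hM.hat_eq_bary hK hzK hs, hM.hat_eq_bary hK hzK ht]
    have h2 : a + s • (b - a) - (a + t • (b - a)) = (s - t) • (b - a) := by module
    rw [h2, norm_smul, Real.norm_eq_abs] at h1
    have h3 : γ * ‖b - a‖ / η * |s - t| * (η / cellDiam K) =
        γ * (|s - t| * ‖b - a‖) / cellDiam K := by field_simp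
    rw [h3, le_div_iff₀ hD, sub_sub_sub_cancel_left, abs_sub_comm]
    exact h1

theorem mem_of_mem_cell {T K : Finset (E d)} (hT : T ∈ 𝒯) (hK : K ∈ 𝒯) {z : E d} (hz : z ∈ T)
    (hzK : z ∈ cell K) : z ∈ K := by
  by_contra h
  have := hM.hat_eq_zero hK h hzK
  rw [hM.hat_self hT hz] at this
  exact one_ne_zero this

theorem exists_ball_vertex {T : Finset (E d)} (hT : T ∈ 𝒯) {z : E d} (hz : z ∈ T) :
    ∃ δ > 0, ∀ x ∈ Metric.ball z δ, ∀ K ∈ 𝒯, x ∈ cell K → z ∈ K := by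
  have : ∀ᶠ x in nhds z, ∀ K ∈ 𝒯, x ∈ cell K → z ∈ K := by
    rw [Finset.eventually_all]
    intro K hK
    by_cases hzK : z ∈ K
    · exact Filter.Eventually.of_forall fun _ _ => hzK
    · have h1 : z ∉ cell K := fun h => hzK (hM.mem_of_mem_cell hT hK hz h)
      filter_upwards [(isCompact_cell K).isClosed.isOpen_compl.mem_nhds h1] with x hx hx'
      exact absurd hx' hx
  exact Metric.eventually_nhds_iff_ball.1 this

theorem exists_mem_sphere (hd : 0 < d) {T : Finset (E d)} (hT : T ∈ 𝒯) {z : E d} (hz : z ∈ T) :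
    ∃ δ > 0, ∀ s, 0 < s → s ≤ δ → ∃ x ∈ cell T, ‖x - z‖ = s := by
  obtain ⟨y, hy, hyz⟩ := Finset.exists_mem_ne
    (by rw [hM.card_eq T hT]; omega : 1 < T.card) z
  have hn : 0 < ‖y - z‖ := norm_pos_iff.2 (sub_ne_zero.2 hyz)
  refine ⟨‖y - z‖, hn, fun s hs hsδ => ⟨z + (s / ‖y - z‖) • (y - z), ?_, ?_⟩⟩
  · refine (hM.nondeg hT).lineMap_mem_cell hz (mem_cell hy) (by positivity) ?_
    rw [(hM.nondeg hT).bary_of_ne hz hy hyz.symm, sub_zero, mul_one, div_le_one hn]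
    exact hsδ
  · rw [add_sub_cancel_left, norm_smul, Real.norm_of_nonneg (by positivity)]
    field_simp

/-- If `log (1 - φ_z)` oscillates by at most `c` on small spheres around `z`, then the sizes of the
cells at `z` are comparable. -/
theorem cellDiam_le_of_oscillation (hd : 0 < d) {γ : ℝ} (hγ : shapeRegularity 𝒯 ≤ γ)
    {T K : Finset (E d)} (hT : T ∈ 𝒯) (hK : K ∈ 𝒯) {z : E d} (hzT : z ∈ T) (hzK : z ∈ K) {c ρ : ℝ}
    (hρ : 0 < ρ) (hosc : ∀ δ, 0 < δ → δ < ρ → ∀ x ∈ closure Ω, ∀ y ∈ closure Ω, ‖x - z‖ = δ →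
      ‖y - z‖ = δ → |Real.log (1 - hat 𝒯 z x) - Real.log (1 - hat 𝒯 z y)| ≤ c) :
    cellDiam T ≤ γ * Real.exp c * cellDiam K := by
  obtain ⟨δ₁, hδ₁, h1⟩ := hM.exists_mem_sphere hd hT hzT
  obtain ⟨δ₂, hδ₂, h2⟩ := hM.exists_mem_sphere hd hK hzK
  set δ := min (min δ₁ δ₂) (ρ / 2) with hδ
  have hδ0 : 0 < δ := lt_min (lt_min hδ₁ hδ₂) (by linarith)
  obtain ⟨x, hx, hxδ⟩ := h1 δ hδ0 ((min_le_left _ _).trans (min_le_left _ _))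
  obtain ⟨y, hy, hyδ⟩ := h2 δ hδ0 ((min_le_left _ _).trans (min_le_right _ _))
  have hDT := (hM.nondeg hT).cellDiam_pos hd
  have hDK := (hM.nondeg hK).cellDiam_pos hd
  have hlog := hosc δ hδ0 ((min_le_right _ _).trans_lt (by linarith)) y (hM.cell_subset hK hy) x
    (hM.cell_subset hT hx) hyδ hxδ
  rw [hM.hat_eq_bary hT hzT hx, hM.hat_eq_bary hK hzK hy] at hlog
  -- At distance `δ` from `z`, `1 - φ_z` is at least `δ / diam` and at most `γ δ / diam` in any cell
  -- at `z`. Comparable values on the sphere therefore mean comparable diameters.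
  have hfx := (hM.nondeg hT).norm_sub_vertex_le hzT hx
  have hfy := (hM.nondeg hK).norm_sub_vertex_le hzK hy
  rw [hxδ] at hfx
  rw [hyδ] at hfy
  have hfx0 : 0 < 1 - bary T z x := pos_of_mul_pos_left (hδ0.trans_le hfx) hDT.le
  have hfy0 : 0 < 1 - bary K z y := pos_of_mul_pos_left (hδ0.trans_le hfy) hDK.le
  have h3 : 1 - bary K z y ≤ Real.exp c * (1 - bary T z x) := by
    rw [← Real.exp_log hfx0, ← Real.exp_add, ← Real.log_le_iff_le_exp hfy0]
    linarith [(abs_le.1 hlog).2]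
  have h4 := hM.abs_bary_sub_le hd hγ hT hzT z x
  rw [(hM.nondeg hT).bary_self hzT, abs_of_pos hfx0, norm_sub_rev, hxδ] at h4
  have h5 : δ * cellDiam T ≤ δ * (γ * Real.exp c * cellDiam K) := by
    calc δ * cellDiam T ≤ ((1 - bary K z y) * cellDiam K) * cellDiam T := by gcongr
      _ ≤ ((Real.exp c * (1 - bary T z x)) * cellDiam K) * cellDiam T := by gcongr
      _ = Real.exp c * cellDiam K * ((1 - bary T z x) * cellDiam T) := by ring
      _ ≤ Real.exp c * cellDiam K * (γ * δ) := by gcongr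
      _ = _ := by ring
  exact le_of_mul_le_mul_left h5 hδ0

end IsRegularMesh

/-- Provides an intermediate direction, so that two points of a sphere are joined by two chords
neither of which passes near the centre. In dimension one a sphere has only two points and this
fails. -/
theorem exists_orthogonal_norm_eq (hd : 2 ≤ d) (p q : E d) {δ : ℝ} (hδ : 0 < δ) :
    ∃ w : E d, ‖w‖ = δ ∧ inner ℝ p w = (0 : ℝ) ∧ (0 : ℝ) ≤ inner ℝ w q := by
  have hne : (ℝ ∙ p)ᗮ ≠ ⊥ := by
    intro h
    rw [Submodule.orthogonal_eq_bot_iff] at h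
    have h1 := finrank_span_le_card (R := ℝ) ({p} : Set (E d))
    rw [h, finrank_top, finrank_euclideanSpace, Fintype.card_fin, Set.toFinset_singleton,
      Finset.card_singleton] at h1
    omega
  obtain ⟨w, hw, hw0⟩ := Submodule.exists_mem_ne_zero_of_ne_bot hne
  rw [Submodule.mem_orthogonal_singleton_iff_inner_right] at hw
  have hn : 0 < ‖w‖ := norm_pos_iff.2 hw0
  have h1 : ‖(δ / ‖w‖) • w‖ = δ := by
    rw [norm_smul, Real.norm_of_nonneg (by positivity)]; field_simp
  have h2 : inner ℝ p ((δ / ‖w‖) • w) = (0 : ℝ) := by rw [real_inner_smul_right, hw, mul_zero]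
  rcases le_total 0 (inner ℝ ((δ / ‖w‖) • w) q) with h | h
  · exact ⟨_, h1, h2, h⟩
  · exact ⟨-((δ / ‖w‖) • w), by rw [norm_neg, h1], by rw [inner_neg_right, h2, neg_zero],
      by rw [inner_neg_left]; linarith⟩

/-- A chord subtending an angle of at most a right angle stays at distance `δ / √2` from the centre;
the cruder `δ / 2` suffices. -/
theorem half_le_norm_of_inner_nonneg {p q : E d} {δ : ℝ} (hp : ‖p‖ = δ) (hq : ‖q‖ = δ)
    (h : (0 : ℝ) ≤ inner ℝ p q) {t : ℝ} (ht : t ∈ Set.Icc (0 : ℝ) 1) :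
    δ / 2 ≤ ‖p + t • (q - p)‖ := by
  have h1 : p + t • (q - p) = (1 - t) • p + t • q := by module
  have h2 : ‖p + t • (q - p)‖ ^ 2 =
      (1 - t) ^ 2 * δ ^ 2 + 2 * ((1 - t) * t * inner ℝ p q) + t ^ 2 * δ ^ 2 := by
    rw [h1, norm_add_sq_real, norm_smul, norm_smul, real_inner_smul_left, real_inner_smul_right,
      mul_pow, mul_pow, hp, hq, Real.norm_eq_abs, Real.norm_eq_abs, sq_abs, sq_abs]
    ring
  have h3 : 0 ≤ (1 - t) * t * inner ℝ p q :=
    mul_nonneg (mul_nonneg (by linarith [ht.2]) ht.1) h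
  refine abs_le_of_sq_le_sq' ?_ (norm_nonneg _) |>.2
  rw [h2]
  nlinarith [mul_nonneg (sq_nonneg (2 * t - 1)) (sq_nonneg δ)]

namespace IsRegularMesh

variable {Ω : Set (E d)} {𝒯 : Finset (Finset (E d))} (hM : IsRegularMesh Ω 𝒯)

include hM

/-- Two chords through an intermediate direction, each of length at most `2 δ` and at distance at
least `δ / 2` from `z`, so each costs at most `4 γ`. The radius `δ` drops out. -/
theorem oscillation_interior (hd : 2 ≤ d) {γ : ℝ} (hγ : shapeRegularity 𝒯 ≤ γ) (hΩ : IsOpen Ω)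
    {T : Finset (E d)} (hT : T ∈ 𝒯) {z : E d} (hz : z ∈ T) (hzΩ : z ∈ Ω) :
    ∃ ρ > 0, ∀ δ, 0 < δ → δ < ρ → ∀ x ∈ closure Ω, ∀ y ∈ closure Ω, ‖x - z‖ = δ → ‖y - z‖ = δ →
      |Real.log (1 - hat 𝒯 z x) - Real.log (1 - hat 𝒯 z y)| ≤ 8 * γ := by
  obtain ⟨δ₀, hδ₀, hnear⟩ := hM.exists_ball_vertex hT hz
  obtain ⟨δ₁, hδ₁, hball⟩ := Metric.isOpen_iff.1 hΩ z hzΩ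
  have hγ0 : 0 ≤ γ := zero_le_one.trans (hM.one_le_shape (by omega) hγ hT)
  refine ⟨min δ₀ δ₁, lt_min hδ₀ hδ₁, fun δ hδ hδρ x _ y _ hx hy => ?_⟩
  have hstep : ∀ p q : E d, ‖p‖ = δ → ‖q‖ = δ → (0 : ℝ) ≤ inner ℝ p q →
      |Real.log (1 - hat 𝒯 z (z + q)) - Real.log (1 - hat 𝒯 z (z + p))| ≤ 4 * γ := by
    intro p q hp hq hpq
    have hmem : ∀ t ∈ Set.Icc (0 : ℝ) 1, z + p + t • (z + q - (z + p)) ∈ Metric.ball z (min δ₀ δ₁) :=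
      fun t ht => by
        have h1 : z + p + t • (z + q - (z + p)) - z = (1 - t) • p + t • q := by module
        rw [Metric.mem_ball, dist_eq_norm, h1]
        refine (norm_add_le _ _).trans_lt ?_
        rw [norm_smul, norm_smul, hp, hq, Real.norm_of_nonneg (by linarith [ht.2]),
          Real.norm_of_nonneg ht.1]
        linarith
    refine (hM.abs_log_one_sub_hat_le (by omega) hγ (η := δ / 2) (by linarith)
      (fun t ht => subset_closure (hball (Metric.ball_subset_ball (min_le_right _ _) (hmem t ht))))
      (fun t ht K hK h => hnear _ (Metric.ball_subset_ball (min_le_left _ _) (hmem t ht)) K hK h)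
      (fun t ht => ?_)).trans ?_
    · have h1 : z + p + t • (z + q - (z + p)) - z = p + t • (q - p) := by module
      rw [h1]
      exact half_le_norm_of_inner_nonneg hp hq hpq ht
    · rw [add_sub_add_left_eq_sub, div_le_iff₀ (by linarith)]
      have h1 : ‖q - p‖ ≤ 2 * δ := (norm_sub_le _ _).trans (by rw [hp, hq]; linarith)
      calc γ * ‖q - p‖ ≤ γ * (2 * δ) := by gcongr
        _ = 4 * γ * (δ / 2) := by ring
  obtain ⟨w, hw, hw1, hw2⟩ := exists_orthogonal_norm_eq hd (x - z) (y - z) hδ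
  have h1 := hstep (x - z) w hx hw hw1.ge
  have h2 := hstep w (y - z) hw hy hw2
  rw [add_sub_cancel] at h1 h2
  rw [abs_sub_comm]
  refine (abs_sub_le _ (Real.log (1 - hat 𝒯 z (z + w))) _).trans ?_
  linarith

/-- The sphere may leave `Ω`, so every `x` is joined to the common point `z + M e`: first up the
cone axis to `x + M e`, then across inside the cone with apex `z`. The two legs cost at most `4 γ /
θ²` and `2 γ / θ²`. -/
theorem oscillation_boundary (hd : 0 < d) {γ : ℝ} (hγ : shapeRegularity 𝒯 ≤ γ) (hΩ : IsOpen Ω)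
    {r θ : ℝ} (hc : HasCone Ω r θ) {T : Finset (E d)} (hT : T ∈ 𝒯) {z : E d} (hz : z ∈ T)
    (hzΩ : z ∈ frontier Ω) :
    ∃ ρ > 0, ∀ δ, 0 < δ → δ < ρ → ∀ x ∈ closure Ω, ∀ y ∈ closure Ω, ‖x - z‖ = δ → ‖y - z‖ = δ →
      |Real.log (1 - hat 𝒯 z x) - Real.log (1 - hat 𝒯 z y)| ≤ 12 * γ / θ ^ 2 := by
  obtain ⟨δ₀, hδ₀, hnear⟩ := hM.exists_ball_vertex hT hz
  obtain ⟨e, he, hcone⟩ := hc.cone z hzΩ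
  have hγ0 : 0 ≤ γ := zero_le_one.trans (hM.one_le_shape hd hγ hT)
  have hθ := hc.θ_pos
  have hθ1 := hc.θ_le
  have hr := hc.r_pos
  set m := min δ₀ r with hm
  have hm0 : 0 < m := lt_min hδ₀ hr
  have hzcl : z ∈ closure Ω := frontier_subset_closure hzΩ
  refine ⟨m * θ / 3, by positivity, fun δ hδ hδρ => ?_⟩
  have hδm : δ + 2 * δ / θ < m := by
    have h1 : δ ≤ δ / θ := by rw [le_div_iff₀ hθ]; nlinarith
    have h2 : δ / θ < m / 3 := by rw [div_lt_iff₀ hθ]; linarith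
    have h3 : 2 * δ / θ = 2 * (δ / θ) := by ring
    rw [h3]; linarith
  -- At this height the cone at `z` has radius `2 δ`, twice what the horizontal leg needs, and that
  -- leg stays at distance at least `M - δ ≥ δ` from `z`.
  set M := 2 * δ / θ with hMdef
  have hMθ : θ * M = 2 * δ := by rw [hMdef]; field_simp
  have hM2 : 2 * δ ≤ M := by nlinarith
  have hM0 : 0 < M := by linarith
  have key : ∀ x ∈ closure Ω, ‖x - z‖ = δ →
      |Real.log (1 - hat 𝒯 z (z + M • e)) - Real.log (1 - hat 𝒯 z x)| ≤ 6 * γ / θ ^ 2 := by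
    intro x hx hxδ
    have hxr : x ∈ Metric.ball z r := by
      rw [Metric.mem_ball, dist_eq_norm, hxδ]
      linarith [min_le_right δ₀ r]
    have hball1 : ∀ t ∈ Set.Icc (0 : ℝ) 1, x + (t * M) • e ∈ Metric.ball z m := fun t ht => by
      rw [Metric.mem_ball, dist_eq_norm, add_sub_right_comm]
      refine (norm_add_le _ _).trans_lt ?_
      rw [hxδ, norm_smul, he, mul_one, Real.norm_of_nonneg (mul_nonneg ht.1 hM0.le)]
      nlinarith [ht.2]
    have hball2 : ∀ t ∈ Set.Icc (0 : ℝ) 1, z + (M • e + (1 - t) • (x - z)) ∈ Metric.ball z m :=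
      fun t ht => by
        rw [Metric.mem_ball, dist_eq_norm, add_sub_cancel_left]
        refine (norm_add_le _ _).trans_lt ?_
        rw [norm_smul, norm_smul, he, hxδ, mul_one, Real.norm_of_nonneg hM0.le,
          Real.norm_of_nonneg (by linarith [ht.2])]
        nlinarith [ht.1]
    have e1 : ∀ t : ℝ, x + t • (x + M • e - x) = x + (t * M) • e := fun t => by module
    have e2 : ∀ t : ℝ, x + M • e + t • (z + M • e - (x + M • e)) =
        z + (M • e + (1 - t) • (x - z)) := fun t => by module
    have s1 := hM.abs_log_one_sub_hat_le hd hγ (z := z) (a := x) (b := x + M • e) (η := θ * δ / 2)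
      (by positivity) (fun t ht => by
        rw [e1]
        rcases ht.1.eq_or_lt with h0 | h0
        · rw [← h0]; simpa using hx
        · refine subset_closure (hcone x hx hxr (t * M) (by positivity) _ ?_
            (Metric.ball_subset_ball (min_le_right _ _) (hball1 t ht)))
          rw [sub_self, norm_zero]; positivity)
      (fun t ht K hK h => hnear _ (Metric.ball_subset_ball (min_le_left _ _)
        (by rw [e1]; exact hball1 t ht)) K hK h)
      (fun t ht => by
        rw [e1]
        set s := t * M with hs
        have hs0 : 0 ≤ s := mul_nonneg ht.1 hM0.le
        have h1 : δ - s ≤ ‖x + s • e - z‖ := by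
          have h2 : x - z = (x + s • e - z) - s • e := by abel
          have h3 := norm_sub_le (x + s • e - z) (s • e)
          rw [← h2, hxδ, norm_smul, he, mul_one, Real.norm_of_nonneg hs0] at h3
          linarith
        -- Otherwise `z - x` would belong to the cone, and `z` would lie in `Ω`.
        have h2 : θ * s ≤ ‖x + s • e - z‖ := by
          by_contra! hlt
          have hs' : 0 < s := by
            by_contra! h
            have : θ * s ≤ 0 := mul_nonpos_of_nonneg_of_nonpos hθ.le h
            linarith [norm_nonneg (x + s • e - z)]
          have h4 := hcone x hx hxr s hs' (z - x) (by
            rwa [← norm_neg, show -(z - x - s • e) = x + s • e - z by abel])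
            (by rw [add_sub_cancel]; exact Metric.mem_ball_self hr)
          rw [add_sub_cancel] at h4
          exact notMem_of_mem_frontier hΩ hzΩ h4
        rcases le_total (δ / 2) s with h | h
        · have := mul_le_mul_of_nonneg_left h hθ.le
          linarith
        · have := mul_le_of_le_one_left hδ.le hθ1
          linarith)
    have s2 := hM.abs_log_one_sub_hat_le hd hγ (z := z) (a := x + M • e) (b := z + M • e)
      (η := δ) hδ (fun t ht => by
        rw [e2]
        refine subset_closure (hcone z hzcl (Metric.mem_ball_self hr) M hM0 _ ?_
          (Metric.ball_subset_ball (min_le_right _ _) (hball2 t ht)))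
        rw [add_sub_cancel_left, norm_smul, hxδ, Real.norm_of_nonneg (by linarith [ht.2]), hMθ]
        nlinarith [ht.1])
      (fun t ht K hK h => hnear _ (Metric.ball_subset_ball (min_le_left _ _)
        (by rw [e2]; exact hball2 t ht)) K hK h)
      (fun t ht => by
        rw [e2, add_sub_cancel_left]
        have h3 := norm_sub_le (M • e + (1 - t) • (x - z)) ((1 - t) • (x - z))
        rw [add_sub_cancel_right, norm_smul, norm_smul, he, hxδ, mul_one,
          Real.norm_of_nonneg hM0.le, Real.norm_of_nonneg (by linarith [ht.2])] at h3
        nlinarith [ht.1])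
    have n1 : ‖x + M • e - x‖ = M := by
      rw [add_sub_cancel_left, norm_smul, he, mul_one, Real.norm_of_nonneg hM0.le]
    have n2 : ‖z + M • e - (x + M • e)‖ = δ := by
      rw [add_sub_add_right_eq_sub, norm_sub_rev, hxδ]
    rw [n1] at s1
    rw [n2] at s2
    have t1 : γ * M / (θ * δ / 2) = 4 * γ / θ ^ 2 := by rw [hMdef]; field_simp; ring
    have t2 : γ * δ / δ ≤ 2 * γ / θ ^ 2 := by
      rw [mul_div_cancel_right₀ _ hδ.ne', le_div_iff₀ (by positivity)]
      have : θ ^ 2 ≤ 1 := pow_le_one₀ hθ.le hθ1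
      nlinarith
    rw [t1] at s1
    refine (abs_sub_le _ (Real.log (1 - hat 𝒯 z (x + M • e))) _).trans ?_
    have : 6 * γ / θ ^ 2 = 2 * γ / θ ^ 2 + 4 * γ / θ ^ 2 := by ring
    linarith
  intro x hx y hy hxδ hyδ
  have k1 := key x hx hxδ
  have k2 := key y hy hyδ
  rw [abs_sub_comm] at k1
  refine (abs_sub_le _ (Real.log (1 - hat 𝒯 z (z + M • e))) _).trans ?_
  have : 12 * γ / θ ^ 2 = 6 * γ / θ ^ 2 + 6 * γ / θ ^ 2 := by ring
  linarith

/-- Cells of a shape regular mesh with a common vertex have comparable diameters. -/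
theorem cellDiam_le (hd : 2 ≤ d) {γ : ℝ} (hγ : shapeRegularity 𝒯 ≤ γ) (hΩ : IsOpen Ω)
    {r θ : ℝ} (hc : HasCone Ω r θ) {T K : Finset (E d)} (hT : T ∈ 𝒯) (hK : K ∈ 𝒯) {z : E d}
    (hzT : z ∈ T) (hzK : z ∈ K) :
    cellDiam T ≤ γ * Real.exp (12 * γ / θ ^ 2) * cellDiam K := by
  have hγ0 : 0 ≤ γ := zero_le_one.trans (hM.one_le_shape (by omega) hγ hT)
  by_cases hzΩ : z ∈ Ω
  · obtain ⟨ρ, hρ, hosc⟩ := hM.oscillation_interior hd hγ hΩ hT hzT hzΩ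
    refine (hM.cellDiam_le_of_oscillation (by omega) hγ hT hK hzT hzK hρ hosc).trans ?_
    have : 8 * γ ≤ 12 * γ / θ ^ 2 := by
      have hθ := hc.θ_pos
      rw [le_div_iff₀ (by positivity)]
      have : θ ^ 2 ≤ 1 := pow_le_one₀ hθ.le hc.θ_le
      nlinarith
    have hD := ((hM.nondeg hK).cellDiam_pos (by omega)).le
    gcongr
  · have hzf : z ∈ frontier Ω := by
      rw [hΩ.frontier_eq]; exact ⟨hM.cell_subset hT (mem_cell hzT), hzΩ⟩
    obtain ⟨ρ, hρ, hosc⟩ := hM.oscillation_boundary (by omega) hγ hΩ hc hT hzT hzf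
    exact hM.cellDiam_le_of_oscillation (by omega) hγ hT hK hzT hzK hρ hosc

/-! ### Balls contained in vertex patches -/

theorem half_le_hat (hd : 0 < d) {γ : ℝ} (hγ : shapeRegularity 𝒯 ≤ γ) {T : Finset (E d)}
    (hT : T ∈ 𝒯) {z x : E d} (hz : z ∈ T) (hx : x ∈ cell T) (h : 2 * γ * ‖x - z‖ ≤ cellDiam T) :
    1 / 2 ≤ hat 𝒯 z x := by
  have hD := (hM.nondeg hT).cellDiam_pos hd
  have h1 := hM.abs_bary_sub_le hd hγ hT hz z x
  rw [(hM.nondeg hT).bary_self hz, norm_sub_rev] at h1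
  rw [hM.hat_eq_bary hT hz hx]
  have h2 := le_abs_self (1 - bary T z x)
  by_contra! h3
  nlinarith

/-- A ray that starts at a vertex `z` into the closure of `Ω` stays in a cell at `z` up to a distance
proportional to the size of the cells. -/
theorem exists_cell_of_ray (hd : 0 < d) {γ : ℝ} (hγ : shapeRegularity 𝒯 ≤ γ) {T₀ : Finset (E d)}
    (hT₀ : T₀ ∈ 𝒯) {z u : E d} (hz : z ∈ T₀)
    (hu : ∃ τ > (0 : ℝ), ∀ t : ℝ, 0 < t → t < τ → z + t • u ∈ closure Ω)
    (hsize : ∀ T ∈ 𝒯, z ∈ T → γ * ‖u‖ ≤ cellDiam T) : ∃ T ∈ 𝒯, z ∈ T ∧ z + u ∈ cell T := by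
  obtain ⟨δ₀, hδ₀, hnear⟩ := hM.exists_ball_vertex hT₀ hz
  obtain ⟨τ, hτ, hu⟩ := hu
  set t := min (τ / 2) (δ₀ / (‖u‖ + 1)) with ht
  have hu0 := norm_nonneg u
  have ht0 : 0 < t := lt_min (by linarith) (by positivity)
  have htu : t * ‖u‖ < δ₀ := by
    have h1 : t * (‖u‖ + 1) ≤ δ₀ := by
      rw [← le_div_iff₀ (by positivity)]; exact min_le_right _ _
    nlinarith
  have hmem := hu t ht0 ((min_le_left _ _).trans_lt (by linarith))
  obtain ⟨T, hT, hTx⟩ := hM.exists_mem_cell hmem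
  have hzT := hnear _ (by
    rw [Metric.mem_ball, dist_eq_norm, add_sub_cancel_left, norm_smul, Real.norm_of_nonneg ht0.le]
    exact htu) T hT hTx
  refine ⟨T, hT, hzT, ?_⟩
  have h1 := hM.abs_bary_sub_le hd hγ hT hzT z (z + t • u)
  rw [(hM.nondeg hT).bary_self hzT, norm_sub_rev, add_sub_cancel_left, norm_smul,
    Real.norm_of_nonneg ht0.le] at h1
  have hD := (hM.nondeg hT).cellDiam_pos hd
  -- For tiny `t` the point `z + t u` lies in some cell at `z`. Since `1 - λ_z ≤ t` there, the ray
  -- may be stretched by `1 / t` without leaving that cell.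
  have h2 : 1 - bary T z (z + t • u) ≤ t := by
    have h3 := (mul_le_mul_of_nonneg_right (le_abs_self (1 - bary T z (z + t • u))) hD.le).trans h1
    have h4 : γ * (t * ‖u‖) ≤ t * cellDiam T := by nlinarith [hsize T hT hzT]
    exact le_of_mul_le_mul_right (h3.trans h4) hD
  have h5 := (hM.nondeg hT).lineMap_mem_cell hzT hTx (t := t⁻¹) (by positivity)
    (by rw [inv_mul_le_iff₀ ht0, mul_one]; exact h2)
  rwa [add_sub_cancel_left, smul_smul, inv_mul_cancel₀ ht0.ne', one_smul] at h5

/-- This close to `z`, `φ_z` is either `0` or at least `1 / 2`. Being continuous, it cannot jump the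
gap along a segment in the closure of `Ω`. -/
theorem half_le_hat_of_segment (hd : 0 < d) {γ : ℝ} (hγ : shapeRegularity 𝒯 ≤ γ) {z a b : E d}
    (hΩ : ∀ t ∈ Set.Icc (0 : ℝ) 1, a + t • (b - a) ∈ closure Ω)
    (hsize : ∀ t ∈ Set.Icc (0 : ℝ) 1, ∀ T ∈ 𝒯, z ∈ T → 2 * γ * ‖a + t • (b - a) - z‖ ≤ cellDiam T)
    (ha : 1 / 2 ≤ hat 𝒯 z a) : 1 / 2 ≤ hat 𝒯 z b := by
  have hgap : ∀ t ∈ Set.Icc (0 : ℝ) 1, hat 𝒯 z (a + t • (b - a)) = 0 ∨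
      1 / 2 ≤ hat 𝒯 z (a + t • (b - a)) := fun t ht => by
    obtain ⟨T, hT, hx⟩ := hM.exists_mem_cell (hΩ t ht)
    by_cases hz : z ∈ T
    · exact Or.inr (hM.half_le_hat hd hγ hT hz hx (hsize t ht T hT hz))
    · exact Or.inl (hM.hat_eq_zero hT hz hx)
  have h1 := hgap 1 (by simp)
  simp only [one_smul, add_sub_cancel] at h1
  rcases h1 with h1 | h1
  · exfalso
    have hcont : ContinuousOn (fun t : ℝ => hat 𝒯 z (a + t • (b - a))) (Set.Icc 0 1) :=
      (hM.continuousOn_hat z).comp (by fun_prop) hΩ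
    have hivt := intermediate_value_Icc' zero_le_one hcont
    obtain ⟨t, ht, hval⟩ := hivt (show (1 / 4 : ℝ) ∈ _ by
      simp only [one_smul, add_sub_cancel, zero_smul, add_zero, h1]
      constructor <;> linarith)
    simp only at hval
    rcases hgap t ht with h | h <;> linarith
  · exact h1

omit hM in
theorem exists_cell_of_hat_ne_zero {z x : E d} (h : hat 𝒯 z x ≠ 0) :
    ∃ T ∈ 𝒯, z ∈ T ∧ x ∈ cell T := by
  by_contra! hcon
  exact h (hat_eq_zero_of_forall hcon)

/-- Around an interior vertex, a ball of radius comparable to the mesh size is contained in the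
vertex patch. -/
theorem ball_subset_interior (hd : 0 < d) {γ : ℝ} (hγ : shapeRegularity 𝒯 ≤ γ) (hΩ : IsOpen Ω)
    {r θ : ℝ} (hc : HasCone Ω r θ) {T₀ : Finset (E d)} (hT₀ : T₀ ∈ 𝒯) {z : E d} (hz : z ∈ T₀)
    (hzΩ : z ∈ Ω) {ρ : ℝ} (hsize : ∀ T ∈ 𝒯, z ∈ T → 2 * γ * ρ ≤ cellDiam T) :
    ∀ x ∈ Metric.ball z ρ, x ∈ Ω ∧ 1 / 2 ≤ hat 𝒯 z x := by
  have hγ0 : 0 ≤ γ := zero_le_one.trans (hM.one_le_shape hd hγ hT₀)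
  have key : ∀ x ∈ Metric.ball z ρ, ∃ T ∈ 𝒯, z ∈ T ∧ x ∈ cell T := by
    intro x hx
    rw [Metric.mem_ball, dist_eq_norm] at hx
    obtain ⟨δ, hδ, hball⟩ := Metric.isOpen_iff.1 hΩ z hzΩ
    have hn := norm_nonneg (x - z)
    have := hM.exists_cell_of_ray hd hγ hT₀ hz (u := x - z)
      ⟨δ / (‖x - z‖ + 1), by positivity, fun t ht htδ => subset_closure (hball (by
        rw [lt_div_iff₀ (by positivity)] at htδ
        rw [Metric.mem_ball, dist_eq_norm, add_sub_cancel_left, norm_smul,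
          Real.norm_of_nonneg ht.le]
        linarith))⟩
      (fun T hT hzT => by
        have h1 := hsize T hT hzT
        have h2 : γ * ‖x - z‖ ≤ γ * ρ := by gcongr
        have h3 : 0 ≤ γ * ρ := mul_nonneg hγ0 (hn.trans hx.le)
        linarith)
    rwa [add_sub_cancel] at this
  intro x hx
  constructor
  -- The ball is covered by cells, hence is contained in the interior of the closure.
  · rw [← hc.interior_closure hΩ]
    refine mem_interior.2 ⟨Metric.ball z ρ, fun y hy => ?_, Metric.isOpen_ball, hx⟩
    obtain ⟨T, hT, -, hyT⟩ := key y hy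
    exact hM.cell_subset hT hyT
  · obtain ⟨T, hT, hzT, hxT⟩ := key x hx
    refine hM.half_le_hat hd hγ hT hzT hxT (le_trans ?_ (hsize T hT hzT))
    rw [Metric.mem_ball, dist_eq_norm] at hx
    gcongr

/-- Around a boundary vertex, the part in `Ω` of a ball of radius comparable to the mesh size is
contained in the vertex patch. -/
theorem ball_subset_boundary (hd : 0 < d) {γ : ℝ} (hγ : shapeRegularity 𝒯 ≤ γ)
    {r θ : ℝ} (hc : HasCone Ω r θ) {T₀ : Finset (E d)} (hT₀ : T₀ ∈ 𝒯) {z : E d} (hz : z ∈ T₀)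
    (hzΩ : z ∈ frontier Ω) {ρ : ℝ} (hρr : 3 * ρ < θ * r)
    (hsize : ∀ T ∈ 𝒯, z ∈ T → 6 * γ * ρ ≤ θ * cellDiam T) {x : E d} (hxΩ : x ∈ Ω)
    (hxz : x ≠ z) (hx : ‖x - z‖ ≤ ρ) : ∃ T ∈ 𝒯, z ∈ T ∧ x ∈ cell T := by
  obtain ⟨e, he, hcone⟩ := hc.cone z hzΩ
  have hγ0 : 0 ≤ γ := zero_le_one.trans (hM.one_le_shape hd hγ hT₀)
  have hθ := hc.θ_pos
  have hθ1 := hc.θ_le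
  have hr := hc.r_pos
  set δ := ‖x - z‖ with hδdef
  have hδ : 0 < δ := norm_pos_iff.2 (sub_ne_zero.2 hxz)
  have hzcl : z ∈ closure Ω := frontier_subset_closure hzΩ
  set M := 2 * δ / θ with hMdef
  have hMθ : θ * M = 2 * δ := by rw [hMdef]; field_simp
  have hM2 : 2 * δ ≤ M := by nlinarith
  have hM0 : 0 < M := by linarith
  -- A bound for the distance from `z` along the whole path `z`, `z + M e`, `x + M e`, `x`. As `θ R
  -- = 3 δ`, it is the source of the factors `3` and `6` in the hypotheses. The bound `φ_z ≥ 1 / 2`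
  -- is established at `z + M e` and carried along to `x`.
  set R := M + δ with hR
  have hRθ : θ * R ≤ 3 * ρ := by rw [hR, mul_add, hMθ]; nlinarith
  have hRr : R < r := by
    by_contra! h
    nlinarith
  have hRs : ∀ T ∈ 𝒯, z ∈ T → 2 * γ * R ≤ cellDiam T := fun T hT hzT => by
    have h1 := hsize T hT hzT
    have h2 : θ * (2 * γ * R) ≤ θ * cellDiam T := by nlinarith
    exact le_of_mul_le_mul_left h2 hθ
  have hsize' : ∀ p : E d, ‖p - z‖ ≤ R → ∀ T ∈ 𝒯, z ∈ T → 2 * γ * ‖p - z‖ ≤ cellDiam T :=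
    fun p hp T hT hzT => (by gcongr : 2 * γ * ‖p - z‖ ≤ 2 * γ * R).trans (hRs T hT hzT)
  have hball : ∀ p : E d, ‖p - z‖ ≤ R → p ∈ Metric.ball z r := fun p hp => by
    rw [Metric.mem_ball, dist_eq_norm]; linarith
  have hxcl := subset_closure hxΩ
  have hxr : x ∈ Metric.ball z r := hball x (by linarith)
  have n0 : ‖M • e‖ = M := by rw [norm_smul, he, mul_one, Real.norm_of_nonneg hM0.le]
  have htop : 1 / 2 ≤ hat 𝒯 z (z + M • e) := by
    obtain ⟨T, hT, hzT, hTx⟩ := hM.exists_cell_of_ray hd hγ hT₀ hz (u := M • e)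
      ⟨1, one_pos, fun t ht ht1 => by
        rw [smul_smul]
        refine subset_closure (hcone z hzcl (Metric.mem_ball_self hr) (t * M) (by positivity) _
          (by rw [sub_self, norm_zero]; positivity) (hball _ ?_))
        rw [add_sub_cancel_left, norm_smul, he, mul_one, Real.norm_of_nonneg (by positivity)]
        nlinarith⟩
      (fun T hT hzT => by
        rw [n0]
        have := hRs T hT hzT
        nlinarith)
    refine hM.half_le_hat hd hγ hT hzT hTx (hsize' _ ?_ T hT hzT)
    rw [add_sub_cancel_left, n0]; linarith
  have e2 : ∀ t : ℝ, z + M • e + t • (x + M • e - (z + M • e)) =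
      z + (M • e + t • (x - z)) := fun t => by module
  have e3 : ∀ t : ℝ, x + M • e + t • (x - (x + M • e)) = x + ((1 - t) * M) • e :=
    fun t => by module
  have b2 : ∀ t ∈ Set.Icc (0 : ℝ) 1, ‖z + (M • e + t • (x - z)) - z‖ ≤ R := fun t ht => by
    rw [add_sub_cancel_left]
    refine (norm_add_le _ _).trans ?_
    rw [n0, norm_smul, Real.norm_of_nonneg ht.1, ← hδdef]
    nlinarith [ht.2]
  have b3 : ∀ t ∈ Set.Icc (0 : ℝ) 1, ‖x + ((1 - t) * M) • e - z‖ ≤ R := fun t ht => by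
    rw [add_sub_right_comm]
    refine (norm_add_le _ _).trans ?_
    rw [norm_smul, he, mul_one, Real.norm_of_nonneg (mul_nonneg (by linarith [ht.2]) hM0.le),
      ← hδdef]
    nlinarith [ht.1]
  have h2 := hM.half_le_hat_of_segment hd hγ (z := z) (a := z + M • e) (b := x + M • e)
    (fun t ht => by
      rw [e2]
      refine subset_closure (hcone z hzcl (Metric.mem_ball_self hr) M hM0 _ ?_ (hball _ (b2 t ht)))
      rw [add_sub_cancel_left, norm_smul, Real.norm_of_nonneg ht.1, ← hδdef, hMθ]
      nlinarith [ht.2])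
    (fun t ht => by rw [e2]; exact hsize' _ (b2 t ht)) htop
  have h3 := hM.half_le_hat_of_segment hd hγ (z := z) (a := x + M • e) (b := x)
    (fun t ht => by
      rw [e3]
      rcases ht.2.eq_or_lt with h0 | h0
      · rw [h0]; simpa using hxcl
      · have : 0 < (1 - t) * M := mul_pos (by linarith) hM0
        refine subset_closure (hcone x hxcl hxr _ this _ ?_ (hball _ (b3 t ht)))
        rw [sub_self, norm_zero]; positivity)
    (fun t ht => by rw [e3]; exact hsize' _ (b3 t ht)) h2
  exact exists_cell_of_hat_ne_zero (by linarith)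

end IsRegularMesh

/-! ### The local approximation estimate for smooth functions -/

theorem setIntegral_le_sum_cells {𝒮 : Finset (Finset (E d))} {S : Set (E d)} (hS : MeasurableSet S)
    {F G : E d → ℝ} (hF : Continuous F) (hF0 : ∀ x, 0 ≤ F x) (hG : IntegrableOn G S)
    (h : ∀ x ∈ S, G x ≤ 0 ∨ ∃ T ∈ 𝒮, x ∈ cell T ∧ G x ≤ F x) :
    ∫ x in S, G x ≤ ∑ T ∈ 𝒮, ∫ x in cell T, F x := by
  have hi : ∀ T ∈ 𝒮, Integrable ((cell T).indicator F) := fun T _ =>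
    (hF.continuousOn.integrableOn_compact (isCompact_cell T)).integrable_indicator
      (isCompact_cell T).measurableSet
  have h0 : ∀ x, ∀ T ∈ 𝒮, 0 ≤ (cell T).indicator F x := fun x T _ =>
    Set.indicator_nonneg (fun x _ => hF0 x) x
  have e1 : ∑ T ∈ 𝒮, ∫ x in cell T, F x = ∫ x, ∑ T ∈ 𝒮, (cell T).indicator F x := by
    rw [integral_finsetSum _ hi]
    exact Finset.sum_congr rfl fun T _ => (integral_indicator (isCompact_cell T).measurableSet).symm
  rw [e1]
  have hsi := integrable_finsetSum 𝒮 hi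
  calc ∫ x in S, G x ≤ ∫ x in S, ∑ T ∈ 𝒮, (cell T).indicator F x := by
        refine setIntegral_mono_on hG hsi.integrableOn hS fun x hx => ?_
        rcases h x hx with h1 | ⟨T, hT, hxT, h1⟩
        · exact h1.trans (Finset.sum_nonneg (h0 x))
        · refine h1.trans (le_trans (le_of_eq ?_) (Finset.single_le_sum (h0 x) hT))
          rw [Set.indicator_of_mem hxT]
    _ ≤ _ := setIntegral_le_integral hsi
        (Filter.Eventually.of_forall fun x => Finset.sum_nonneg (h0 x))

theorem volume_real_closedBall (z : E d) {R : ℝ} (hR : 0 ≤ R) :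
    volume.real (Metric.closedBall z R) = R ^ d * volume.real (Metric.ball (0 : E d) 1) := by
  rw [Measure.real, Measure.addHaar_closedBall _ _ hR, ENNReal.toReal_mul,
    ENNReal.toReal_ofReal (by positivity), finrank_euclideanSpace, Fintype.card_fin, Measure.real]

theorem volume_real_closedBall_pos (z : E d) {R : ℝ} (hR : 0 < R) :
    0 < volume.real (Metric.closedBall z R) :=
  ENNReal.toReal_pos (Metric.measure_closedBall_pos _ _ hR).ne' measure_closedBall_lt_top.ne

namespace IsRegularMesh

variable {Ω : Set (E d)} {𝒯 : Finset (Finset (E d))} (hM : IsRegularMesh Ω 𝒯)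

include hM

/-- A Poincaré or Friedrichs inequality on a small ball around a vertex. -/
theorem exists_poincare_ball (hd : 0 < d) {γ : ℝ} (hγ : shapeRegularity 𝒯 ≤ γ) (hΩ : IsOpen Ω)
    {r θ : ℝ} (hc : HasCone Ω r θ) {T₀ : Finset (E d)} (hT₀ : T₀ ∈ 𝒯) {z : E d} (hz : z ∈ T₀)
    {𝒮 : Finset (Finset (E d))} (h𝒮 : ∀ T, T ∈ 𝒮 ↔ T ∈ 𝒯 ∧ z ∈ T) {ρ : ℝ} (hρ : 0 < ρ)
    (hρr : 3 * ρ < θ * r) (hsize : ∀ T ∈ 𝒮, 6 * γ * ρ ≤ θ * cellDiam T) {φ : E d → ℝ}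
    (hφ : ContDiff ℝ 1 φ) (hsupp : tsupport φ ⊆ Ω) :
    ∃ b : ℝ, (z ∉ Ω → b = 0) ∧ ∫ x in Metric.closedBall z ρ, (φ x - b) ^ 2 ≤
      16 * ρ ^ 2 * (4 / θ) ^ d * ∑ T ∈ 𝒮, ∫ x in cell T, ‖fderiv ℝ φ x‖ ^ 2 := by
  have hγ1 := hM.one_le_shape hd hγ hT₀
  have hθ := hc.θ_pos
  have hθ1 := hc.θ_le
  have hfc : Continuous (fderiv ℝ φ) := hφ.continuous_fderiv one_ne_zero
  have hB := isCompact_closedBall z ρ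
  -- Only the part of the ball in `Ω` is covered by the patch; outside `Ω` the gradient of `φ`
  -- vanishes anyway.
  have hpatch : ∀ x ∈ Metric.closedBall z ρ, x ∈ Ω → ∃ T ∈ 𝒮, x ∈ cell T := by
    intro x hx hxΩ
    have key : ∃ T ∈ 𝒯, z ∈ T ∧ x ∈ cell T := by
      rcases eq_or_ne x z with rfl | hxz
      · exact ⟨T₀, hT₀, hz, mem_cell hz⟩
      rw [Metric.mem_closedBall, dist_eq_norm] at hx
      by_cases hzΩ : z ∈ Ω
      · have := (hM.ball_subset_interior hd hγ hΩ hc hT₀ hz hzΩ (ρ := 2 * ρ) (fun T hT hzT => by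
          have h1 := hsize T ((h𝒮 T).2 ⟨hT, hzT⟩)
          have h2 := (hM.nondeg hT).cellDiam_pos hd
          nlinarith) x (by rw [Metric.mem_ball, dist_eq_norm]; linarith)).2
        exact exists_cell_of_hat_ne_zero (by linarith)
      · have hzf : z ∈ frontier Ω := by
          rw [hΩ.frontier_eq]; exact ⟨hM.cell_subset hT₀ (mem_cell hz), hzΩ⟩
        exact hM.ball_subset_boundary hd hγ hc hT₀ hz hzf hρr
          (fun T hT hzT => hsize T ((h𝒮 T).2 ⟨hT, hzT⟩)) hxΩ hxz hx
    obtain ⟨T, hT, hzT, hxT⟩ := key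
    exact ⟨T, (h𝒮 T).2 ⟨hT, hzT⟩, hxT⟩
  have hgrad : ∫ x in Metric.closedBall z ρ, ‖fderiv ℝ φ x‖ ^ 2 ≤
      ∑ T ∈ 𝒮, ∫ x in cell T, ‖fderiv ℝ φ x‖ ^ 2 := by
    refine setIntegral_le_sum_cells hB.measurableSet (by fun_prop) (fun x => sq_nonneg _)
      (Continuous.continuousOn (by fun_prop) |>.integrableOn_compact hB) fun x hx => ?_
    by_cases hxΩ : x ∈ Ω
    · obtain ⟨T, hT, hxT⟩ := hpatch x hx hxΩ
      exact Or.inr ⟨T, hT, hxT, le_rfl⟩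
    · left
      rw [fderiv_of_notMem_tsupport ℝ (fun h => hxΩ (hsupp h))]
      simp
  have hdiam : ∀ x ∈ Metric.closedBall z ρ, ∀ y ∈ Metric.closedBall z ρ, ‖x - y‖ ≤ 2 * ρ :=
    fun x hx y hy => by
      rw [← dist_eq_norm]
      have := dist_triangle_right x y z
      rw [Metric.mem_closedBall] at hx hy
      linarith
  have hκ : 0 < (θ / 2) ^ d := by positivity
  have hconst : 4 * ((θ / 2) ^ d)⁻¹ * (2 * ρ) ^ 2 * 2 ^ d = 16 * ρ ^ 2 * (4 / θ) ^ d := by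
    rw [← inv_pow, inv_div]
    have : (4 / θ) ^ d = (2 / θ) ^ d * 2 ^ d := by rw [← mul_pow]; ring
    rw [this]; ring
  have hfin : ∀ P : Set (E d), MeasurableSet P → P ⊆ Metric.closedBall z ρ →
      (θ / 2) ^ d * volume.real (Metric.closedBall z ρ) ≤ volume.real P →
      ∃ y ∈ P, ∫ x in Metric.closedBall z ρ, (φ x - φ y) ^ 2 ≤
      16 * ρ ^ 2 * (4 / θ) ^ d * ∑ T ∈ 𝒮, ∫ x in cell T, ‖fderiv ℝ φ x‖ ^ 2 := by
    intro P hP hPB hPκ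
    obtain ⟨y, hy, h⟩ := exists_integral_sq_sub_le hφ hB (convex_closedBall z ρ) hdiam hP hPB hκ
      (volume_real_closedBall_pos z hρ) hPκ
    refine ⟨y, hy, h.trans ?_⟩
    rw [hconst]
    gcongr
  -- An interior vertex may use any value in the ball. At a boundary vertex the value is taken
  -- outside `Ω`, where it is `0`.
  by_cases hzΩ : z ∈ Ω
  · obtain ⟨y, -, h⟩ := hfin _ hB.measurableSet subset_rfl (mul_le_of_le_one_left measureReal_nonneg
      (pow_le_one₀ (by positivity) (by linarith)))
    exact ⟨φ y, fun h => absurd hzΩ h, h⟩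
  · have hzf : z ∈ frontier Ω := by
      rw [hΩ.frontier_eq]; exact ⟨hM.cell_subset hT₀ (mem_cell hz), hzΩ⟩
    have hr := hc.r_pos
    obtain ⟨y, hy, h⟩ := hfin _ (hB.measurableSet.diff hΩ.measurableSet) Set.sdiff_subset
      (hc.volume_diff_ge hΩ hzf hρ (by nlinarith))
    have hφy : φ y = 0 := image_eq_zero_of_notMem_tsupport fun h' => hy.2 (hsupp h')
    exact ⟨0, fun _ => rfl, by rw [hφy] at h; exact h⟩

/-- Transfer from a small ball around a vertex to the vertex patch by scaling towards the vertex. -/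
theorem sum_integral_le_of_ball {z : E d} {𝒮 : Finset (Finset (E d))}
    (h𝒮 : ∀ T ∈ 𝒮, T ∈ 𝒯 ∧ z ∈ T) {ε ρ R : ℝ} (hε : 0 < ε) (hε1 : ε ≤ 1)
    (hR : ∀ T ∈ 𝒮, cellDiam T ≤ R) (hερ : ε * R ≤ ρ) {φ : E d → ℝ} (hφ : ContDiff ℝ 1 φ) (b : ℝ) :
    ∑ T ∈ 𝒮, ∫ x in cell T, (φ x - b) ^ 2 ≤
      2 * (ε ^ d)⁻¹ * (R ^ 2 * (∑ T ∈ 𝒮, ∫ x in cell T, ‖fderiv ℝ φ x‖ ^ 2) +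
        ∫ x in Metric.closedBall z ρ, (φ x - b) ^ 2) := by
  have hφc := hφ.continuous
  have hB := isCompact_closedBall z ρ
  have hT : ∀ T ∈ 𝒮, ∫ x in cell T, (φ x - b) ^ 2 ≤
      2 * (ε ^ d)⁻¹ * (R ^ 2 * ∫ x in cell T, ‖fderiv ℝ φ x‖ ^ 2) +
      2 * (ε ^ d)⁻¹ * ∫ x in cell T, (φ x - b) ^ 2 ∂(volume.restrict (Metric.closedBall z ρ)) := by
    intro T hTS
    have hzT := (h𝒮 T hTS).2
    have hK := isCompact_cell T
    have hstar : ∀ x ∈ cell T, ∀ t ∈ Set.Icc (0 : ℝ) 1, z + t • (x - z) ∈ cell T :=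
      fun x hx t ht => by
        have : z + t • (x - z) = (1 - t) • z + t • x := by module
        rw [this]
        exact convex_cell T (mem_cell hzT) hx (by linarith [ht.2]) ht.1 (by ring)
    have hnorm : ∀ x ∈ cell T, ‖x - z‖ ≤ R := fun x hx =>
      (dist_le_cellDiam hx (mem_cell hzT)).trans (hR T hTS)
    have h1 := integral_sq_sub_comp_homothety_le hφ hK hε hε1
      (fun x hx t ht => hstar x hx t ⟨hε.le.trans ht.1, ht.2⟩) hnorm
    have h2 := integral_comp_homothety_le hK (hK.inter hB) z hε
      (fun x hx => ⟨hstar x hx ε ⟨hε.le, hε1⟩, by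
        rw [Metric.mem_closedBall, dist_eq_norm, add_sub_cancel_left, norm_smul,
          Real.norm_of_nonneg hε.le]
        exact (mul_le_mul_of_nonneg_left (hnorm x hx) hε.le).trans hερ⟩)
      (F := fun x => (φ x - b) ^ 2) (by fun_prop) (fun x => sq_nonneg _)
    rw [Measure.restrict_restrict hK.measurableSet]
    have hi1 : IntegrableOn (fun x => 2 * (φ x - φ (z + ε • (x - z))) ^ 2) (cell T) :=
      Continuous.continuousOn (by fun_prop) |>.integrableOn_compact hK
    have hi2 : IntegrableOn (fun x => 2 * (φ (z + ε • (x - z)) - b) ^ 2) (cell T) :=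
      Continuous.continuousOn (by fun_prop) |>.integrableOn_compact hK
    -- The intermediate value is taken at the contracted point, which lies in the cell and, by `ε R
    -- ≤ ρ`, in the ball.
    calc ∫ x in cell T, (φ x - b) ^ 2 ≤ ∫ x in cell T, (2 * (φ x - φ (z + ε • (x - z))) ^ 2 +
          2 * (φ (z + ε • (x - z)) - b) ^ 2) := by
          refine setIntegral_mono_on (Continuous.continuousOn (by fun_prop)
            |>.integrableOn_compact hK) (hi1.add hi2) hK.measurableSet fun x _ => ?_
          nlinarith [sq_nonneg ((φ x - φ (z + ε • (x - z))) - (φ (z + ε • (x - z)) - b))]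
      _ = 2 * (∫ x in cell T, (φ x - φ (z + ε • (x - z))) ^ 2) +
          2 * ∫ x in cell T, (φ (z + ε • (x - z)) - b) ^ 2 := by
          rw [integral_add hi1 hi2, integral_const_mul, integral_const_mul]
      _ ≤ _ := by
          have h3 : 2 * (ε ^ d)⁻¹ * (R ^ 2 * ∫ x in cell T, ‖fderiv ℝ φ x‖ ^ 2) =
            2 * (R ^ 2 * (ε ^ d)⁻¹ * ∫ x in cell T, ‖fderiv ℝ φ x‖ ^ 2) := by ring
          rw [h3, mul_assoc 2 (ε ^ d)⁻¹]
          gcongr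
  refine (Finset.sum_le_sum hT).trans ?_
  rw [Finset.sum_add_distrib, ← Finset.mul_sum, ← Finset.mul_sum, ← Finset.mul_sum, ← mul_add]
  gcongr
  exact hM.sum_setIntegral_cell_le (fun T hT => (h𝒮 T hT).1)
    Measure.absolutelyContinuous_restrict
    (Continuous.continuousOn (by fun_prop) |>.integrableOn_compact hB)
    (Filter.Eventually.of_forall fun x => sq_nonneg _)

theorem integrableOn_mul_hat (hb : Bornology.IsBounded Ω) (z : E d) {F : E d → ℝ}
    (hF : Continuous F) : IntegrableOn (fun x => F x * hat 𝒯 z x) Ω := by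
  have hc : IsCompact (closure Ω) := hb.isCompact_closure
  exact ((hF.continuousOn.mul (hM.continuousOn_hat z)).integrableOn_compact hc).mono_set
    subset_closure

/-- Replacing the constant of a patch by the weighted mean. -/
theorem sum_integral_le_of_mean (hd : 0 < d) {γ : ℝ} (hγ : shapeRegularity 𝒯 ≤ γ)
    (hΩ : IsLipschitzDomain Ω) {r θ : ℝ} (hc : HasCone Ω r θ) {T₀ : Finset (E d)} (hT₀ : T₀ ∈ 𝒯)
    {z : E d} (hz : z ∈ T₀) (hzΩ : z ∈ Ω) {𝒮 : Finset (Finset (E d))}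
    (h𝒮 : ∀ T, T ∈ 𝒮 ↔ T ∈ 𝒯 ∧ z ∈ T) {ε ρ R : ℝ} (hε : 0 < ε) (hρ : 0 < ρ)
    (hsize : ∀ T ∈ 𝒮, 6 * γ * ρ ≤ cellDiam T)
    (hR : ∀ T ∈ 𝒮, cellDiam T ≤ R) (hερ : ε * R = ρ) {φ : E d → ℝ} (hφ : Continuous φ)
    {m : ℝ} (hm : m * ∫ x in Ω, hat 𝒯 z x = ∫ x in Ω, φ x * hat 𝒯 z x) (b : ℝ) :
    ∑ T ∈ 𝒮, ∫ x in cell T, (φ x - m) ^ 2 ≤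
      (2 + 4 * (ε ^ d)⁻¹) * ∑ T ∈ 𝒮, ∫ x in cell T, (φ x - b) ^ 2 := by
  set Q := ∑ T ∈ 𝒮, ∫ x in cell T, (φ x - b) ^ 2 with hQ
  have hB := isCompact_closedBall z ρ
  have hγ1 := hM.one_le_shape hd hγ hT₀
  have hR0 : 0 < R := by nlinarith
  have hball : ∀ x ∈ Metric.closedBall z ρ, x ∈ Ω ∧ 1 / 2 ≤ hat 𝒯 z x := fun x hx =>
    hM.ball_subset_interior hd hγ hΩ.isOpen hc hT₀ hz hzΩ (ρ := 2 * ρ) (fun T hT hzT => by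
      have h1 := hsize T ((h𝒮 T).2 ⟨hT, hzT⟩)
      nlinarith) x (by rw [Metric.mem_closedBall] at hx; rw [Metric.mem_ball]; linarith)
  have ihat : ∀ F : E d → ℝ, Continuous F → IntegrableOn (fun x => F x * hat 𝒯 z x) Ω :=
    fun F hF => hM.integrableOn_mul_hat hΩ.isBounded z hF
  have ihat1 : IntegrableOn (hat 𝒯 z) Ω := by simpa using ihat (fun _ => 1) continuous_const
  set I := ∫ x in Ω, hat 𝒯 z x with hI
  have hIB : volume.real (Metric.closedBall z ρ) / 2 ≤ I := by
    have hsub : Metric.closedBall z ρ ⊆ Ω := fun x hx => (hball x hx).1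
    calc volume.real (Metric.closedBall z ρ) / 2 = ∫ x in Metric.closedBall z ρ, (1 / 2 : ℝ) := by
          rw [setIntegral_const, smul_eq_mul]; ring
      _ ≤ ∫ x in Metric.closedBall z ρ, hat 𝒯 z x :=
          setIntegral_mono_on (integrableOn_const hB.measure_lt_top.ne (by simp))
            (ihat1.mono_set hsub) hB.measurableSet fun x hx => (hball x hx).2
      _ ≤ I := setIntegral_mono_set ihat1 (Filter.Eventually.of_forall fun x => hM.hat_nonneg z x)
          (Filter.Eventually.of_forall hsub)
  -- Because `m` is the mean with weight `φ_z`, expanding `∫ (φ - m)² φ_z ≥ 0` gives `(m - b)² I ≤ ∫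
  -- (φ - b)² φ_z`.
  have hjensen : (m - b) ^ 2 * I ≤ Q := by
    have h1 : 0 ≤ ∫ x in Ω, (φ x - m) ^ 2 * hat 𝒯 z x :=
      integral_nonneg fun x => mul_nonneg (sq_nonneg _) (hM.hat_nonneg z x)
    have h2 : ∫ x in Ω, (φ x - m) ^ 2 * hat 𝒯 z x =
        (∫ x in Ω, (φ x - b) ^ 2 * hat 𝒯 z x) - (2 * (m - b)) * (∫ x in Ω, φ x * hat 𝒯 z x)
          + (m ^ 2 - b ^ 2) * I := by
      have i1 := ihat (fun x => (φ x - b) ^ 2) (by fun_prop)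
      have i2 := (ihat φ hφ).const_mul (2 * (m - b))
      have i3 : IntegrableOn (fun x => (φ x - b) ^ 2 * hat 𝒯 z x -
        2 * (m - b) * (φ x * hat 𝒯 z x)) Ω := i1.sub i2
      rw [hI, ← integral_const_mul, ← integral_const_mul, ← integral_sub i1 i2,
        ← integral_add i3 (ihat1.const_mul _)]
      refine integral_congr_ae (Filter.Eventually.of_forall fun x => ?_)
      simp only
      ring
    have h3 : ∫ x in Ω, (φ x - b) ^ 2 * hat 𝒯 z x ≤ Q := by
      refine setIntegral_le_sum_cells hΩ.isOpen.measurableSet (by fun_prop) (fun x => sq_nonneg _)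
        (ihat _ (by fun_prop)) fun x _ => ?_
      by_cases hx : hat 𝒯 z x = 0
      · left; rw [hx, mul_zero]
      · obtain ⟨T, hT, hzT, hxT⟩ := exists_cell_of_hat_ne_zero hx
        exact Or.inr ⟨T, (h𝒮 T).2 ⟨hT, hzT⟩, hxT,
          mul_le_of_le_one_right (sq_nonneg _) (hM.hat_le_one z x)⟩
    rw [← hm] at h2
    nlinarith
  -- The cells overlap in null sets and lie in the ball of radius `R = ρ / ε` about `z`.
  have hvol : ∑ T ∈ 𝒮, volume.real (cell T) ≤
      (ε ^ d)⁻¹ * volume.real (Metric.closedBall z ρ) := by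
    have h1 := hM.sum_setIntegral_cell_le (𝒮 := 𝒮) (fun T hT => ((h𝒮 T).1 hT).1)
      (μ := volume.restrict (Metric.closedBall z R)) Measure.absolutelyContinuous_restrict
      (F := fun _ => (1 : ℝ)) (integrableOn_const measure_closedBall_lt_top.ne (by simp))
      (Filter.Eventually.of_forall fun _ => zero_le_one)
    have h2 : ∀ T ∈ 𝒮, ∫ _ in cell T, (1 : ℝ) ∂(volume.restrict (Metric.closedBall z R)) =
        volume.real (cell T) := fun T hT => by
      have hsub : cell T ⊆ Metric.closedBall z R := fun x hx => by
        rw [Metric.mem_closedBall, dist_eq_norm]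
        exact (dist_le_cellDiam hx (mem_cell ((h𝒮 T).1 hT).2)).trans (hR T hT)
      rw [Measure.restrict_restrict (isCompact_cell T).measurableSet,
        Set.inter_eq_self_of_subset_left hsub]
      simp
    rw [Finset.sum_congr rfl h2] at h1
    refine h1.trans (le_of_eq ?_)
    rw [setIntegral_const, smul_eq_mul, mul_one, volume_real_closedBall z hR0.le,
      volume_real_closedBall z hρ.le, ← hερ, mul_pow]
    field_simp
  have hcell : ∀ T ∈ 𝒮, ∫ x in cell T, (φ x - m) ^ 2 ≤
      2 * (∫ x in cell T, (φ x - b) ^ 2) + 2 * (m - b) ^ 2 * volume.real (cell T) := by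
    intro T _
    have hK := isCompact_cell T
    have hi : IntegrableOn (fun x => 2 * (φ x - b) ^ 2) (cell T) :=
      Continuous.continuousOn (by fun_prop) |>.integrableOn_compact hK
    have hi' : IntegrableOn (fun _ : E d => 2 * (m - b) ^ 2) (cell T) :=
      integrableOn_const hK.measure_lt_top.ne enorm_ne_top
    calc ∫ x in cell T, (φ x - m) ^ 2 ≤ ∫ x in cell T, (2 * (φ x - b) ^ 2 + 2 * (m - b) ^ 2) := by
          refine setIntegral_mono_on (Continuous.continuousOn (by fun_prop)
            |>.integrableOn_compact hK) (hi.add hi') hK.measurableSet fun x _ => ?_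
          nlinarith [sq_nonneg ((φ x - b) + (m - b))]
      _ = _ := by
          rw [integral_add hi hi', integral_const_mul, setIntegral_const, smul_eq_mul]; ring
  refine (Finset.sum_le_sum hcell).trans ?_
  rw [Finset.sum_add_distrib, ← Finset.mul_sum, ← Finset.mul_sum, ← hQ]
  have h4 : (m - b) ^ 2 * volume.real (Metric.closedBall z ρ) ≤ 2 * Q := by
    have := mul_le_mul_of_nonneg_left hIB (sq_nonneg (m - b))
    linarith
  have h5 : 2 * (m - b) ^ 2 * ∑ T ∈ 𝒮, volume.real (cell T) ≤ 4 * (ε ^ d)⁻¹ * Q := by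
    calc 2 * (m - b) ^ 2 * ∑ T ∈ 𝒮, volume.real (cell T)
        ≤ 2 * (m - b) ^ 2 * ((ε ^ d)⁻¹ * volume.real (Metric.closedBall z ρ)) := by gcongr
      _ = 2 * (ε ^ d)⁻¹ * ((m - b) ^ 2 * volume.real (Metric.closedBall z ρ)) := by ring
      _ ≤ 2 * (ε ^ d)⁻¹ * (2 * Q) := by gcongr
      _ = _ := by ring
  linarith

end IsRegularMesh

theorem IsRegularMesh.cellDiam_le_diam {Ω : Set (E d)} {𝒯 : Finset (Finset (E d))}
    (hM : IsRegularMesh Ω 𝒯) (hΩ : Bornology.IsBounded Ω) {T : Finset (E d)} (hT : T ∈ 𝒯) :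
    cellDiam T ≤ Metric.diam (closure Ω) :=
  Metric.diam_mono (hM.cell_subset hT) hΩ.closure

/-- The error of the weighted mean on a vertex patch, for a function that vanishes outside `Ω`; at
boundary vertices the mean is replaced by `0`. -/
theorem exists_vertex_estimate (hd : 2 ≤ d) {Ω : Set (E d)} (hΩ : IsLipschitzDomain Ω) (γ : ℝ) :
    ∃ C : ℝ, 0 ≤ C ∧ ∀ 𝒯 : Finset (Finset (E d)), IsRegularMesh Ω 𝒯 → shapeRegularity 𝒯 ≤ γ →
      ∀ T₀ ∈ 𝒯, ∀ z ∈ T₀, ∀ 𝒮 : Finset (Finset (E d)), (∀ T, T ∈ 𝒮 ↔ T ∈ 𝒯 ∧ z ∈ T) →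
      ∀ φ : E d → ℝ, ContDiff ℝ 1 φ → tsupport φ ⊆ Ω → ∀ m : ℝ,
      (z ∈ Ω → m * ∫ x in Ω, hat 𝒯 z x = ∫ x in Ω, φ x * hat 𝒯 z x) → (z ∉ Ω → m = 0) →
      ∑ T ∈ 𝒮, (cellDiam T ^ 2)⁻¹ * ∫ x in cell T, (φ x - m) ^ 2 ≤
        C * ∑ T ∈ 𝒮, ∫ x in cell T, ‖fderiv ℝ φ x‖ ^ 2 := by
  obtain ⟨r, θ, hc⟩ := hΩ.exists_hasCone
  have hθ := hc.θ_pos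
  have hθ1 := hc.θ_le
  have hr := hc.r_pos
  set D := Metric.diam (closure Ω) + 1 with hD
  have hD0 : 0 < D := by have := Metric.diam_nonneg (s := closure Ω); linarith
  -- Keeps the constants positive and at least one whatever `γ` is.
  set g := max γ 1 with hg
  have hg1 : 1 ≤ g := le_max_right _ _
  set Λ := g * Real.exp (12 * g / θ ^ 2) with hΛ
  have hΛ1 : 1 ≤ Λ := one_le_mul_of_one_le_of_one_le hg1 (Real.one_le_exp (by positivity))
  have hΛ0 : 0 < Λ := by linarith
  -- The ball has radius `c h`, `h = diam T₀`. The first term makes it small against every cell at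
  -- `z`, each of size at least `h / Λ`; the second keeps it within the reach of the cone, since `h
  -- ≤ D`.
  set c := min (θ / (6 * g * Λ)) (θ * r / (4 * D)) with hcdef
  have hc0 : 0 < c := lt_min (by positivity) (by positivity)
  have hc1 : 6 * g * c * Λ ≤ θ := by
    have : c ≤ θ / (6 * g * Λ) := min_le_left _ _
    rw [le_div_iff₀ (by positivity)] at this
    linarith
  have hc2 : 4 * c * D ≤ θ * r := by
    have : c ≤ θ * r / (4 * D) := min_le_right _ _
    rw [le_div_iff₀ (by positivity)] at this
    linarith
  -- Contraction by `ε` takes the patch, of radius at most `Λ h`, into the ball of radius `c h`.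
  set ε := c / Λ with hε
  have hε0 : 0 < ε := by positivity
  have hε1 : ε ≤ 1 := by
    rw [hε, div_le_one hΛ0]
    have h1 : c * 1 ≤ 6 * g * c * Λ := by
      have h2 : 1 ≤ 6 * g * Λ := by nlinarith
      nlinarith
    linarith
  set N := (ε ^ d)⁻¹ with hN
  have hN0 : 0 < N := by positivity
  refine ⟨Λ ^ 2 * ((2 + 4 * N) * (2 * N * (Λ ^ 2 + 16 * c ^ 2 * (4 / θ) ^ d))), by positivity, ?_⟩
  intro 𝒯 hM hγ T₀ hT₀ z hz 𝒮 h𝒮 φ hφ hsupp m hm1 hm2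
  have hd0 : 0 < d := by omega
  have hγg : shapeRegularity 𝒯 ≤ g := hγ.trans (le_max_left _ _)
  set h := cellDiam T₀ with hh
  have hh0 : 0 < h := (hM.nondeg hT₀).cellDiam_pos hd0
  have hhD : h ≤ D := by have := hM.cellDiam_le_diam hΩ.isBounded hT₀; linarith
  have hup : ∀ T ∈ 𝒮, cellDiam T ≤ Λ * h := fun T hT =>
    hM.cellDiam_le hd hγg hΩ.isOpen hc ((h𝒮 T).1 hT).1 hT₀ ((h𝒮 T).1 hT).2 hz
  have hlow : ∀ T ∈ 𝒮, h ≤ Λ * cellDiam T := fun T hT =>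
    hM.cellDiam_le hd hγg hΩ.isOpen hc hT₀ ((h𝒮 T).1 hT).1 hz ((h𝒮 T).1 hT).2
  have hsize : ∀ T ∈ 𝒮, 6 * g * (c * h) ≤ θ * cellDiam T := fun T hT => by
    have hDT := (hM.nondeg ((h𝒮 T).1 hT).1).cellDiam_pos hd0
    calc 6 * g * (c * h) ≤ 6 * g * (c * (Λ * cellDiam T)) := by gcongr; exact hlow T hT
      _ = 6 * g * c * Λ * cellDiam T := by ring
      _ ≤ θ * cellDiam T := by gcongr
  have hρr : 3 * (c * h) < θ * r := by
    have h1 : c * h ≤ c * D := by gcongr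
    have h2 : 0 < c * h := by positivity
    linarith
  have hερ : ε * (Λ * h) = c * h := by rw [hε]; field_simp
  set G := ∑ T ∈ 𝒮, ∫ x in cell T, ‖fderiv ℝ φ x‖ ^ 2 with hG
  have hG0 : 0 ≤ G := Finset.sum_nonneg fun T _ => integral_nonneg fun _ => sq_nonneg _
  obtain ⟨b, hb, hpoinc⟩ := hM.exists_poincare_ball hd0 hγg hΩ.isOpen hc hT₀ hz h𝒮
    (by positivity : 0 < c * h) hρr hsize hφ hsupp
  have hQ := hM.sum_integral_le_of_ball (z := z) (fun T hT => (h𝒮 T).1 hT) hε0 hε1 hup hερ.le hφ b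
  rw [← hG] at hpoinc hQ
  set Q := ∑ T ∈ 𝒮, ∫ x in cell T, (φ x - b) ^ 2 with hQdef
  have hQ0 : 0 ≤ Q := Finset.sum_nonneg fun T _ => integral_nonneg fun _ => sq_nonneg _
  have hQ2 : Q ≤ 2 * N * (Λ ^ 2 + 16 * c ^ 2 * (4 / θ) ^ d) * (h ^ 2 * G) := by
    calc Q ≤ 2 * N * ((Λ * h) ^ 2 * G + 16 * (c * h) ^ 2 * (4 / θ) ^ d * G) :=
          hQ.trans (by gcongr)
      _ = _ := by ring
  have hmean : ∑ T ∈ 𝒮, ∫ x in cell T, (φ x - m) ^ 2 ≤ (2 + 4 * N) * Q := by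
    by_cases hzΩ : z ∈ Ω
    · exact hM.sum_integral_le_of_mean hd0 hγg hΩ hc hT₀ hz hzΩ h𝒮 hε0 (by positivity)
        (fun T hT => (hsize T hT).trans (mul_le_of_le_one_left
          ((hM.nondeg ((h𝒮 T).1 hT).1).cellDiam_pos hd0).le hθ1)) hup hερ hφ.continuous (hm1 hzΩ) b
    · rw [hm2 hzΩ, ← hb hzΩ, ← hQdef]
      exact le_mul_of_one_le_left hQ0 (by linarith)
  calc ∑ T ∈ 𝒮, (cellDiam T ^ 2)⁻¹ * ∫ x in cell T, (φ x - m) ^ 2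
      ≤ ∑ T ∈ 𝒮, Λ ^ 2 * (h ^ 2)⁻¹ * ∫ x in cell T, (φ x - m) ^ 2 := by
        refine Finset.sum_le_sum fun T hT => mul_le_mul_of_nonneg_right ?_
          (integral_nonneg fun _ => sq_nonneg _)
        have hDT := (hM.nondeg ((h𝒮 T).1 hT).1).cellDiam_pos hd0
        rw [← div_eq_mul_inv, le_div_iff₀ (by positivity), inv_mul_le_iff₀ (by positivity)]
        calc h ^ 2 ≤ (Λ * cellDiam T) ^ 2 := by gcongr; exact hlow T hT
          _ = _ := by ring
    _ = Λ ^ 2 * (h ^ 2)⁻¹ * ∑ T ∈ 𝒮, ∫ x in cell T, (φ x - m) ^ 2 := by rw [Finset.mul_sum]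
    _ ≤ Λ ^ 2 * (h ^ 2)⁻¹ * ((2 + 4 * N) *
          (2 * N * (Λ ^ 2 + 16 * c ^ 2 * (4 / θ) ^ d) * (h ^ 2 * G))) := by
        gcongr
        exact hmean.trans (by gcongr)
    _ = _ := by field_simp

/-! ### From vertex patches to the global interpolation error -/

/-- The values of the quasi-interpolant at all vertices, those on the boundary included. -/
def nodalValue (Ω : Set (E d)) (𝒯 : Finset (Finset (E d))) (v : Pairs Ω) (z : E d) : ℝ :=
  (Ω.indicator fun z => clementValue Ω 𝒯 v z) z

namespace IsRegularMesh

variable {Ω : Set (E d)} {𝒯 : Finset (Finset (E d))} (hM : IsRegularMesh Ω 𝒯)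

include hM

/-- Giving boundary vertices the value `0` lets the sum run over all vertices of `T`, whose
coordinates sum to `1`. -/
theorem clement_eq_sum_bary {T : Finset (E d)} (hT : T ∈ 𝒯) {x : E d} (hx : x ∈ cell T)
    (v : Pairs Ω) : clement Ω 𝒯 v x = ∑ z ∈ T, nodalValue Ω 𝒯 v z * bary T z x := by
  classical
  have h1 : clement Ω 𝒯 v x =
      ∑ z ∈ interiorVertices Ω 𝒯 ∩ T, nodalValue Ω 𝒯 v z * hat 𝒯 z x := by
    rw [clement, ← Finset.sum_subset (Finset.inter_subset_left (s₁ := interiorVertices Ω 𝒯)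
      (s₂ := T))]
    · refine Finset.sum_congr rfl fun z hz => ?_
      have hzΩ : z ∈ Ω := by
        have := (Finset.mem_inter.1 hz).1
        rw [interiorVertices, Finset.mem_filter] at this
        exact this.2
      rw [nodalValue, Set.indicator_of_mem hzΩ]
    · intro z hz hz'
      have hzT : z ∉ T := fun h => hz' (Finset.mem_inter.2 ⟨hz, h⟩)
      rw [hM.hat_eq_zero hT hzT hx, mul_zero]
  rw [h1, Finset.sum_subset (Finset.inter_subset_right (s₁ := interiorVertices Ω 𝒯) (s₂ := T))]
  · exact Finset.sum_congr rfl fun z hz => by rw [hM.hat_eq_bary hT hz hx]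
  · intro z hz hz'
    have hzΩ : z ∉ Ω := fun h => hz' (Finset.mem_inter.2 ⟨by
      rw [interiorVertices, Finset.mem_filter, Finset.mem_biUnion]
      exact ⟨⟨T, hT, hz⟩, h⟩, hz⟩)
    rw [nodalValue, Set.indicator_of_notMem hzΩ, zero_mul]

/-- On a cell the error is a convex combination of the differences `a - (I_H v)(z)`, and the square
is convex. Each vertex can thus be treated separately. -/
theorem sq_sub_clement_le {T : Finset (E d)} (hT : T ∈ 𝒯) {x : E d} (hx : x ∈ cell T)
    (v : Pairs Ω) (a : ℝ) :
    (a - clement Ω 𝒯 v x) ^ 2 ≤ ∑ z ∈ T, (a - nodalValue Ω 𝒯 v z) ^ 2 := by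
  have hnd := hM.nondeg hT
  have h1 : a - clement Ω 𝒯 v x = ∑ z ∈ T, bary T z x * (a - nodalValue Ω 𝒯 v z) := by
    rw [hM.clement_eq_sum_bary hT hx]
    simp only [mul_sub, Finset.sum_sub_distrib]
    rw [← Finset.sum_mul, hnd.sum_bary, one_mul]
    congr 1
    exact Finset.sum_congr rfl fun z _ => mul_comm _ _
  rw [h1]
  refine (Real.pow_arith_mean_le_arith_mean_pow_of_even T _ _ (hnd.mem_cell_iff.1 hx)
    (hnd.sum_bary x) even_two).trans (Finset.sum_le_sum fun z hz => ?_)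
  exact mul_le_of_le_one_left (sq_nonneg _) (hnd.bary_le_one hz hx)

/-- Ensures that the nodal values are true quotients and not the default for division by zero. -/
theorem integral_hat_pos (hΩ : IsOpen Ω) (hb : Bornology.IsBounded Ω) {z : E d}
    (hz : z ∈ interiorVertices Ω 𝒯) : 0 < ∫ x in Ω, hat 𝒯 z x := by
  classical
  rw [interiorVertices, Finset.mem_filter, Finset.mem_biUnion] at hz
  obtain ⟨⟨T, hT, hzT⟩, hzΩ⟩ := hz
  have hi : IntegrableOn (hat 𝒯 z) Ω := by
    simpa using hM.integrableOn_mul_hat hb z (continuous_const (y := (1 : ℝ)))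
  rw [setIntegral_pos_iff_support_of_nonneg_ae
    (Filter.Eventually.of_forall fun x => hM.hat_nonneg z x) hi]
  have hcont : ContinuousAt (hat 𝒯 z) z := (hM.continuousOn_hat z).continuousAt
    (Filter.mem_of_superset (hΩ.mem_nhds hzΩ) subset_closure)
  have hne : ∀ᶠ x in nhds z, hat 𝒯 z x ≠ 0 :=
    hcont.eventually_ne (by rw [hM.hat_self hT hzT]; exact one_ne_zero)
  exact Measure.measure_pos_of_mem_nhds volume (Filter.inter_mem hne (hΩ.mem_nhds hzΩ))

end IsRegularMesh

/-- The squared norm `‖H⁻¹ (v - I_H v)‖²`, cell by cell. -/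
def clementError (Ω : Set (E d)) (𝒯 : Finset (Finset (E d))) (v : Pairs Ω) : ℝ :=
  ∑ T ∈ 𝒯, (cellDiam T ^ 2)⁻¹ *
    ∫ x in cell T, (v.1 x - clement Ω 𝒯 v x) ^ 2 ∂(volume.restrict Ω)

theorem norm_gradient (φ : E d → ℝ) (x : E d) : ‖gradient φ x‖ = ‖fderiv ℝ φ x‖ := by
  rw [gradient, LinearIsometryEquiv.norm_map]

theorem integral_norm_fderiv_sq {Ω : Set (E d)} {φ : E d → ℝ} {v : Pairs Ω}
    (hv : v.2 =ᵐ[volume.restrict Ω] gradient φ) :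
    ∫ x in Ω, ‖fderiv ℝ φ x‖ ^ 2 = ‖v.2‖ ^ 2 := by
  rw [← integral_norm_sq]
  refine integral_congr_ae ?_
  filter_upwards [hv] with x hx
  rw [hx, norm_gradient]

/-- The cell errors are split over the vertices, and the order of summation is exchanged so that the
patch estimate applies. Exchanging back counts the gradient on each cell once per vertex, hence the
factor `d + 1`. -/
theorem exists_clementError_le_of_test (hd : 2 ≤ d) {Ω : Set (E d)} (hΩ : IsLipschitzDomain Ω)
    (γ : ℝ) : ∃ C : ℝ, 0 ≤ C ∧ ∀ 𝒯 : Finset (Finset (E d)), IsRegularMesh Ω 𝒯 →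
      shapeRegularity 𝒯 ≤ γ → ∀ v ∈ testPairs Ω, clementError Ω 𝒯 v ≤ C * ‖v.2‖ ^ 2 := by
  classical
  obtain ⟨C, hC, hvert⟩ := exists_vertex_estimate hd hΩ γ
  refine ⟨C * (d + 1), by positivity, fun 𝒯 hM hγ v hv => ?_⟩
  obtain ⟨φ, hφs, hφc, hsupp, hv1, hv2⟩ := hv
  have hφ : ContDiff ℝ 1 φ := hφs.of_le (by exact_mod_cast le_top)
  have hφcont := hφ.continuous
  have hfc : Continuous (fderiv ℝ φ) := hφ.continuous_fderiv one_ne_zero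
  set m := nodalValue Ω 𝒯 v with hm
  have hcell : ∀ T ∈ 𝒯, ∫ x in cell T, (v.1 x - clement Ω 𝒯 v x) ^ 2 ∂(volume.restrict Ω) ≤
      ∑ z ∈ T, ∫ x in cell T, (φ x - m z) ^ 2 := by
    intro T hT
    have hK := isCompact_cell T
    have hi : ∀ z ∈ T, IntegrableOn (fun x => (φ x - m z) ^ 2) (cell T) := fun z _ =>
      Continuous.continuousOn (by fun_prop) |>.integrableOn_compact hK
    have hs : IntegrableOn (fun x => ∑ z ∈ T, (φ x - m z) ^ 2) (cell T) :=
      integrable_finsetSum T hi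
    have hle : (volume.restrict Ω).restrict (cell T) ≤ volume.restrict (cell T) :=
      Measure.restrict_mono subset_rfl Measure.restrict_le_self
    calc ∫ x in cell T, (v.1 x - clement Ω 𝒯 v x) ^ 2 ∂(volume.restrict Ω)
        ≤ ∫ x in cell T, ∑ z ∈ T, (φ x - m z) ^ 2 ∂(volume.restrict Ω) := by
          refine integral_mono_of_nonneg (Filter.Eventually.of_forall fun x => sq_nonneg _)
            (Integrable.mono_measure hs hle) ?_
          filter_upwards [ae_restrict_of_ae hv1, ae_restrict_mem hK.measurableSet] with x hx hxT
          rw [hx]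
          exact hM.sq_sub_clement_le hT hxT v (φ x)
      _ ≤ ∫ x in cell T, ∑ z ∈ T, (φ x - m z) ^ 2 :=
          integral_mono_measure hle
            (Filter.Eventually.of_forall fun x => Finset.sum_nonneg fun z _ => sq_nonneg _) hs
      _ = _ := integral_finsetSum T hi
  set 𝒱 := 𝒯.biUnion id with h𝒱
  have hmem : ∀ T z, T ∈ 𝒯 ∧ z ∈ T ↔ T ∈ 𝒯.filter (z ∈ ·) ∧ z ∈ 𝒱 := fun T z => by
    simp only [Finset.mem_filter, h𝒱, Finset.mem_biUnion, id]
    exact ⟨fun h => ⟨h, T, h⟩, fun h => h.1⟩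
  have hvz : ∀ z ∈ 𝒱, ∑ T ∈ 𝒯.filter (z ∈ ·),
      (cellDiam T ^ 2)⁻¹ * ∫ x in cell T, (φ x - m z) ^ 2 ≤
      C * ∑ T ∈ 𝒯.filter (z ∈ ·), ∫ x in cell T, ‖fderiv ℝ φ x‖ ^ 2 := by
    intro z hz
    obtain ⟨T₀, hT₀, hzT₀⟩ := Finset.mem_biUnion.1 hz
    refine hvert 𝒯 hM hγ T₀ hT₀ z hzT₀ _ (fun T => Finset.mem_filter) φ hφ hsupp (m z)
      (fun hzΩ => ?_) (fun hzΩ => ?_)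
    · have hpos := hM.integral_hat_pos hΩ.isOpen hΩ.isBounded (z := z)
        (by rw [interiorVertices, Finset.mem_filter]; exact ⟨hz, hzΩ⟩)
      rw [hm, nodalValue, Set.indicator_of_mem hzΩ, clementValue, div_mul_cancel₀ _ hpos.ne']
      refine integral_congr_ae ?_
      filter_upwards [hv1] with x hx
      rw [hx]
    · rw [hm, nodalValue, Set.indicator_of_notMem hzΩ]
  calc clementError Ω 𝒯 v
      ≤ ∑ T ∈ 𝒯, ∑ z ∈ T, (cellDiam T ^ 2)⁻¹ * ∫ x in cell T, (φ x - m z) ^ 2 := by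
        refine Finset.sum_le_sum fun T hT => ?_
        rw [← Finset.mul_sum]
        exact mul_le_mul_of_nonneg_left (hcell T hT) (by positivity)
    _ = ∑ z ∈ 𝒱, ∑ T ∈ 𝒯.filter (z ∈ ·),
          (cellDiam T ^ 2)⁻¹ * ∫ x in cell T, (φ x - m z) ^ 2 := Finset.sum_comm' hmem
    _ ≤ ∑ z ∈ 𝒱, C * ∑ T ∈ 𝒯.filter (z ∈ ·), ∫ x in cell T, ‖fderiv ℝ φ x‖ ^ 2 :=
        Finset.sum_le_sum hvz
    _ = C * ∑ T ∈ 𝒯, ∑ z ∈ T, ∫ x in cell T, ‖fderiv ℝ φ x‖ ^ 2 := by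
        rw [← Finset.mul_sum, Finset.sum_comm' hmem]
    _ = C * (d + 1) * ∑ T ∈ 𝒯, ∫ x in cell T, ‖fderiv ℝ φ x‖ ^ 2 := by
        rw [mul_assoc, Finset.mul_sum (a := ((d : ℝ) + 1))]
        congr 1
        refine Finset.sum_congr rfl fun T hT => ?_
        rw [Finset.sum_const, hM.card_eq T hT, nsmul_eq_mul]
        push_cast
        ring
    _ ≤ C * (d + 1) * ‖v.2‖ ^ 2 := by
        have hint : Integrable (fun x => ‖fderiv ℝ φ x‖ ^ 2) := by
          refine Continuous.integrable_of_hasCompactSupport (by fun_prop) ?_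
          exact (hφc.fderiv (𝕜 := ℝ)).norm.comp_left (g := fun t : ℝ => t ^ 2) (by norm_num)
        have h1 := hM.sum_setIntegral_cell_le (𝒮 := 𝒯) subset_rfl (μ := volume)
          Measure.AbsolutelyContinuous.rfl hint (Filter.Eventually.of_forall fun x => sq_nonneg _)
        have h2 : ∫ x in Ω, ‖fderiv ℝ φ x‖ ^ 2 = ∫ x, ‖fderiv ℝ φ x‖ ^ 2 :=
          setIntegral_eq_integral_of_forall_compl_eq_zero fun x hx => by
            rw [fderiv_of_notMem_tsupport ℝ (fun h => hx (hsupp h))]; simp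
        rw [← integral_norm_fderiv_sq hv2, h2]
        gcongr

/-! ### Friedrichs' inequality -/

/-- Friedrichs' inequality for test functions. -/
theorem exists_norm_sq_le_of_test (hd : 0 < d) {Ω : Set (E d)} (hΩ : Bornology.IsBounded Ω) :
    ∃ C : ℝ, 0 ≤ C ∧ ∀ v ∈ testPairs Ω, ‖v.1‖ ^ 2 ≤ C * ‖v.2‖ ^ 2 := by
  obtain ⟨R, hR, hsub⟩ := hΩ.subset_closedBall_lt 0 (0 : E d)
  -- With `Ω` inside the ball of radius `R`, the outer shell of the doubled ball fills at least half
  -- of it, and test functions vanish there.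
  set B := Metric.closedBall (0 : E d) (2 * R) with hBdef
  have hB : IsCompact B := isCompact_closedBall _ _
  have hBR : Metric.closedBall (0 : E d) R ⊆ B := Metric.closedBall_subset_closedBall (by linarith)
  have hvol : 2⁻¹ * volume.real B ≤ volume.real (B \ Metric.closedBall (0 : E d) R) := by
    rw [measureReal_sdiff hBR measurableSet_closedBall measure_closedBall_lt_top.ne, hBdef,
      volume_real_closedBall _ (by positivity), volume_real_closedBall _ hR.le, mul_pow]
    have h2 : (2 : ℝ) ≤ 2 ^ d := le_self_pow₀ (by norm_num) (by omega)
    have h3 : 0 ≤ R ^ d * volume.real (Metric.ball (0 : E d) 1) := by positivity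
    nlinarith
  refine ⟨4 * (2⁻¹ : ℝ)⁻¹ * (4 * R) ^ 2 * 2 ^ d, by positivity, fun v hv => ?_⟩
  obtain ⟨φ, hφs, -, hsupp, hv1, hv2⟩ := hv
  have hφ : ContDiff ℝ 1 φ := hφs.of_le (by exact_mod_cast le_top)
  have hφcont := hφ.continuous
  obtain ⟨y, hy, h⟩ := exists_integral_sq_sub_le hφ hB (convex_closedBall _ _) (R := 4 * R)
    (fun x hx y hy => by
      rw [mem_closedBall_zero_iff] at hx hy
      exact (norm_sub_le _ _).trans (by linarith))
    (measurableSet_closedBall.diff measurableSet_closedBall) Set.sdiff_subset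
    (by norm_num : (0 : ℝ) < 2⁻¹) (volume_real_closedBall_pos _ (by positivity)) hvol
  have hφy : φ y = 0 := image_eq_zero_of_notMem_tsupport fun h' => hy.2 (hsub (hsupp h'))
  have hgrad : ∫ x in B, ‖fderiv ℝ φ x‖ ^ 2 = ∫ x in Ω, ‖fderiv ℝ φ x‖ ^ 2 := by
    refine setIntegral_eq_of_subset_of_forall_sdiff_eq_zero hB.measurableSet (hsub.trans hBR)
      fun x hx => ?_
    rw [fderiv_of_notMem_tsupport ℝ (fun h => hx.2 (hsupp h))]; simp
  rw [hφy, hgrad, integral_norm_fderiv_sq hv2] at h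
  refine le_trans ?_ h
  rw [← integral_norm_sq]
  calc ∫ x in Ω, ‖v.1 x‖ ^ 2 = ∫ x in Ω, (φ x - 0) ^ 2 := by
        refine integral_congr_ae ?_
        filter_upwards [hv1] with x hx
        rw [hx, Real.norm_eq_abs, sq_abs, sub_zero]
    _ ≤ ∫ x in B, (φ x - 0) ^ 2 :=
        setIntegral_mono_set (Continuous.continuousOn (by fun_prop) |>.integrableOn_compact hB)
          (Filter.Eventually.of_forall fun x => sq_nonneg _)
          (Filter.Eventually.of_forall (hsub.trans hBR))

/-! ### Density of test functions -/

/-- The test pairs already form a subspace. Inequalities, which are closed but not linear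
conditions, then need checking on test functions only. -/
theorem mem_testPairs_of_mem_span {Ω : Set (E d)} {p : Pairs Ω}
    (hp : p ∈ Submodule.span ℝ (testPairs Ω)) : p ∈ testPairs Ω := by
  induction hp using Submodule.span_induction with
  | mem p hp => exact hp
  | zero =>
    refine ⟨0, contDiff_const, HasCompactSupport.zero, by simp [tsupport], Lp.coeFn_zero _ _ _, ?_⟩
    filter_upwards [Lp.coeFn_zero (E d) 2 (volume.restrict Ω)] with x hx
    have h1 : (0 : Pairs Ω).2 x = 0 := hx
    rw [h1]
    simp [gradient]
  | add p q _ _ hp hq =>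
    obtain ⟨φ, h1, h2, h3, h4, h5⟩ := hp
    obtain ⟨ψ, k1, k2, k3, k4, k5⟩ := hq
    refine ⟨φ + ψ, h1.add k1, h2.add k2, (tsupport_add φ ψ).trans (Set.union_subset h3 k3), ?_, ?_⟩
    · filter_upwards [h4, k4, Lp.coeFn_add p.1 q.1] with x a1 a2 a3
      have : (p + q).1 x = p.1 x + q.1 x := a3
      rw [this, a1, a2]; rfl
    · filter_upwards [h5, k5, Lp.coeFn_add p.2 q.2] with x a1 a2 a3
      have : (p + q).2 x = p.2 x + q.2 x := a3
      rw [this, a1, a2, gradient, gradient, gradient, fderiv_add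
        (h1.differentiable (by simp) x) (k1.differentiable (by simp) x), map_add]
  | smul c p _ hp =>
    obtain ⟨φ, h1, h2, h3, h4, h5⟩ := hp
    refine ⟨c • φ, h1.const_smul c, h2.smul_left (f := fun _ => c),
      (tsupport_smul_subset_right (fun _ => c) φ).trans h3, ?_, ?_⟩
    · filter_upwards [h4, Lp.coeFn_smul c p.1] with x a1 a3
      have : (c • p).1 x = c • p.1 x := a3
      rw [this, a1]; rfl
    · filter_upwards [h5, Lp.coeFn_smul c p.2] with x a1 a3
      have : (c • p).2 x = c • p.2 x := a3
      rw [this, a1, gradient, gradient, fderiv_const_smul (h1.differentiable (by simp) x), map_smul]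

theorem H10_subset_of_isClosed {Ω : Set (E d)} {S : Set (Pairs Ω)} (hS : IsClosed S)
    (h : testPairs Ω ⊆ S) {v : Pairs Ω} (hv : v ∈ H10 Ω) : v ∈ S := by
  have hv' : v ∈ closure (Submodule.span ℝ (testPairs Ω) : Set (Pairs Ω)) := hv
  exact closure_minimal (fun p hp => h (mem_testPairs_of_mem_span hp)) hS hv'

/-- Friedrichs' inequality. -/
theorem exists_norm_sq_le (hd : 0 < d) {Ω : Set (E d)} (hΩ : Bornology.IsBounded Ω) :
    ∃ C : ℝ, 0 ≤ C ∧ ∀ v ∈ H10 Ω, ‖v.1‖ ^ 2 ≤ C * ‖v.2‖ ^ 2 := by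
  obtain ⟨C, hC, h⟩ := exists_norm_sq_le_of_test hd hΩ
  have hcl : IsClosed {v : Pairs Ω | ‖v.1‖ ^ 2 ≤ C * ‖v.2‖ ^ 2} :=
    isClosed_le (by fun_prop) (by fun_prop)
  exact ⟨C, hC, fun v hv => H10_subset_of_isClosed hcl (fun p hp => h p hp) hv⟩

/-! ### The interpolation error in `L²(Ω)` and the fine functions -/

namespace IsRegularMesh

variable {Ω : Set (E d)} {𝒯 : Finset (Finset (E d))} (hM : IsRegularMesh Ω 𝒯)

include hM

theorem memLp_hat (hb : Bornology.IsBounded Ω) (z : E d) :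
    MemLp (hat 𝒯 z) 2 (volume.restrict Ω) := by
  have : IsFiniteMeasure (volume.restrict Ω) := ⟨by
    rw [Measure.restrict_apply_univ]; exact hb.measure_lt_top⟩
  refine MemLp.of_bound (hM.aestronglyMeasurable_hat z) 1 (Filter.Eventually.of_forall fun x => ?_)
  rw [Real.norm_of_nonneg (hM.hat_nonneg z x)]
  exact hM.hat_le_one z x

theorem inner_hat (hb : Bornology.IsBounded Ω) (z : E d) (u : Lp ℝ 2 (volume.restrict Ω)) :
    inner ℝ ((hM.memLp_hat hb z).toLp) u = ∫ x in Ω, u x * hat 𝒯 z x := by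
  rw [L2.inner_def]
  refine integral_congr_ae ?_
  filter_upwards [(hM.memLp_hat hb z).coeFn_toLp] with x hx
  rw [hx]
  simp

/-- The interpolation error `v - I_H v` as an element of `L²(Ω)`. -/
def errorLp (hb : Bornology.IsBounded Ω) (v : Pairs Ω) : Lp ℝ 2 (volume.restrict Ω) :=
  v.1 - ∑ z ∈ interiorVertices Ω 𝒯, clementValue Ω 𝒯 v z • (hM.memLp_hat hb z).toLp

theorem continuous_errorLp (hb : Bornology.IsBounded Ω) : Continuous (hM.errorLp hb) := by
  have hc : ∀ z, Continuous fun v : Pairs Ω => clementValue Ω 𝒯 v z := fun z => by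
    simp only [clementValue, ← hM.inner_hat hb]
    fun_prop
  unfold errorLp
  refine continuous_fst.sub (continuous_finsetSum _ fun z _ => ?_)
  exact (hc z).smul continuous_const

theorem coeFn_errorLp (hb : Bornology.IsBounded Ω) (v : Pairs Ω) :
    hM.errorLp hb v =ᵐ[volume.restrict Ω] fun x => v.1 x - clement Ω 𝒯 v x := by
  have h1 : ∀ᵐ x ∂(volume.restrict Ω), ∀ z ∈ interiorVertices Ω 𝒯,
      (clementValue Ω 𝒯 v z • (hM.memLp_hat hb z).toLp : Lp ℝ 2 (volume.restrict Ω)) x =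
        clementValue Ω 𝒯 v z * hat 𝒯 z x := by
    rw [Finset.eventually_all]
    intro z _
    filter_upwards [Lp.coeFn_smul (clementValue Ω 𝒯 v z) (hM.memLp_hat hb z).toLp,
      (hM.memLp_hat hb z).coeFn_toLp] with x a1 a2
    rw [a1, Pi.smul_apply, a2, smul_eq_mul]
  have h2 : ∀ s : Finset (E d), ∀ F : E d → Lp ℝ 2 (volume.restrict Ω),
      ∀ᵐ x ∂(volume.restrict Ω), (∑ z ∈ s, F z : Lp ℝ 2 (volume.restrict Ω)) x =
        ∑ z ∈ s, F z x := by
    classical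
    intro s F
    induction s using Finset.induction_on with
    | empty =>
      filter_upwards [Lp.coeFn_zero ℝ 2 (volume.restrict Ω)] with x hx
      simpa using hx
    | insert a s ha ih =>
      rw [Finset.sum_insert ha]
      filter_upwards [ih, Lp.coeFn_add (F a) (∑ z ∈ s, F z)] with x b1 b2
      rw [b2, Pi.add_apply, b1, Finset.sum_insert ha]
  filter_upwards [h1, h2 (interiorVertices Ω 𝒯) (fun z => clementValue Ω 𝒯 v z •
    (hM.memLp_hat hb z).toLp), Lp.coeFn_sub v.1 (∑ z ∈ interiorVertices Ω 𝒯,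
    clementValue Ω 𝒯 v z • (hM.memLp_hat hb z).toLp)] with x a1 a2 a3
  rw [errorLp, a3, Pi.sub_apply, a2, clement, Finset.sum_congr rfl a1]

omit hM in
theorem integral_cell_sq (u : Lp ℝ 2 (volume.restrict Ω)) (T : Finset (E d)) :
    ∫ x in cell T, u x ^ 2 ∂(volume.restrict Ω) =
      ‖LpToLpRestrictCLM (E d) ℝ ℝ (volume.restrict Ω) 2 (cell T) u‖ ^ 2 := by
  rw [← real_inner_self_eq_norm_sq, L2.inner_def]
  refine integral_congr_ae ?_
  filter_upwards [LpToLpRestrictCLM_coeFn ℝ (cell T) u] with x hx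
  rw [hx, real_inner_self_eq_norm_sq, Real.norm_eq_abs, sq_abs]

theorem clementError_eq (hb : Bornology.IsBounded Ω) (v : Pairs Ω) :
    clementError Ω 𝒯 v = ∑ T ∈ 𝒯, (cellDiam T ^ 2)⁻¹ *
      ∫ x in cell T, hM.errorLp hb v x ^ 2 ∂(volume.restrict Ω) := by
  refine Finset.sum_congr rfl fun T _ => ?_
  congr 1
  refine integral_congr_ae ?_
  filter_upwards [ae_restrict_of_ae (hM.coeFn_errorLp hb v)] with x hx
  rw [hx]

/-- Needed to pass from test functions to `H¹₀(Ω)`; for a fixed mesh no uniformity of the continuity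
is required. -/
theorem continuous_clementError (hb : Bornology.IsBounded Ω) :
    Continuous (clementError Ω 𝒯) := by
  have h : clementError Ω 𝒯 = fun v => ∑ T ∈ 𝒯, (cellDiam T ^ 2)⁻¹ *
      ‖LpToLpRestrictCLM (E d) ℝ ℝ (volume.restrict Ω) 2 (cell T) (hM.errorLp hb v)‖ ^ 2 := by
    funext v
    rw [hM.clementError_eq hb]
    exact Finset.sum_congr rfl fun T _ => by rw [integral_cell_sq]
  rw [h]
  refine continuous_finsetSum _ fun T _ => continuous_const.mul ?_
  exact (((LpToLpRestrictCLM (E d) ℝ ℝ (volume.restrict Ω) 2 (cell T)).continuous.comp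
    (hM.continuous_errorLp hb)).norm).pow 2

omit hM in
theorem integrable_sq (u : Lp ℝ 2 (volume.restrict Ω)) :
    Integrable (fun x => u x ^ 2) (volume.restrict Ω) :=
  (memLp_two_iff_integrable_sq (Lp.aestronglyMeasurable u)).1 (Lp.memLp u)

/-- The global interpolation error in `L²`. -/
theorem norm_errorLp_sq_le (hd : 0 < d) (hb : Bornology.IsBounded Ω) (v : Pairs Ω) :
    ‖hM.errorLp hb v‖ ^ 2 ≤ maxMeshSize 𝒯 ^ 2 * clementError Ω 𝒯 v := by
  have h1 : ‖hM.errorLp hb v‖ ^ 2 = ∫ x in Ω, hM.errorLp hb v x ^ 2 := by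
    rw [← integral_norm_sq]
    simp only [Real.norm_eq_abs, sq_abs]
  rw [h1, hM.setIntegral_eq_sum (integrable_sq _), hM.clementError_eq hb, Finset.mul_sum]
  refine Finset.sum_le_sum fun T hT => ?_
  rw [← mul_assoc]
  refine le_mul_of_one_le_left (integral_nonneg fun _ => sq_nonneg _) ?_
  have hD := (hM.nondeg hT).cellDiam_pos hd
  rw [← div_eq_mul_inv, one_le_div (by positivity)]
  exact pow_le_pow_left₀ hD.le (cellDiam_le_maxMeshSize hT) 2

/-- Evaluating `I_H v = 0` at an interior vertex isolates its coefficient, as hat functions are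
nodal. -/
theorem clementValue_eq_zero {Vh : Submodule ℝ (Pairs Ω)} {v : Pairs Ω} (hv : v ∈ Vf Ω 𝒯 Vh)
    {z : E d} (hz : z ∈ interiorVertices Ω 𝒯) : clementValue Ω 𝒯 v z = 0 := by
  classical
  have hz' := hz
  rw [interiorVertices, Finset.mem_filter, Finset.mem_biUnion] at hz'
  obtain ⟨⟨T, hT, hzT⟩, hzΩ⟩ := hz'
  have h := hv.2 z hzΩ
  rw [clement, Finset.sum_eq_single_of_mem z hz, hM.hat_self hT hzT, mul_one] at h
  · exact h
  · intro y _ hyz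
    rw [hM.hat_of_ne hT hzT hyz, mul_zero]

theorem inner_hat_eq_zero (hΩ : IsOpen Ω) (hb : Bornology.IsBounded Ω)
    {Vh : Submodule ℝ (Pairs Ω)} {v : Pairs Ω} (hv : v ∈ Vf Ω 𝒯 Vh) {z : E d}
    (hz : z ∈ interiorVertices Ω 𝒯) : inner ℝ ((hM.memLp_hat hb z).toLp) v.1 = (0 : ℝ) := by
  have h := hM.clementValue_eq_zero hv hz
  rw [clementValue, div_eq_zero_iff] at h
  rw [hM.inner_hat hb]
  exact h.resolve_right (hM.integral_hat_pos hΩ hb hz).ne'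

/-- A fine function is orthogonal in `L²` to all interpolants. -/
theorem inner_eq_inner_errorLp (hΩ : IsOpen Ω) (hb : Bornology.IsBounded Ω)
    {Vh : Submodule ℝ (Pairs Ω)} {v : Pairs Ω} (hv : v ∈ Vf Ω 𝒯 Vh) (u : Pairs Ω) :
    inner ℝ u.1 v.1 = inner ℝ (hM.errorLp hb u) v.1 := by
  rw [errorLp, inner_sub_left, sum_inner, Finset.sum_eq_zero, sub_zero]
  intro z hz
  rw [real_inner_smul_left, hM.inner_hat_eq_zero hΩ hb hv hz, mul_zero]

theorem errorLp_eq_self (hb : Bornology.IsBounded Ω) {Vh : Submodule ℝ (Pairs Ω)} {v : Pairs Ω}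
    (hv : v ∈ Vf Ω 𝒯 Vh) : hM.errorLp hb v = v.1 := by
  rw [errorLp, Finset.sum_eq_zero, sub_zero]
  intro z hz
  rw [hM.clementValue_eq_zero hv hz, zero_smul]

/-- A fine function is its own interpolation error, and up to a null set the mesh size is constant
on each cell. -/
theorem integral_meshSize_inv_eq (hb : Bornology.IsBounded Ω) {Vh : Submodule ℝ (Pairs Ω)}
    {v : Pairs Ω} (hv : v ∈ Vf Ω 𝒯 Vh) :
    ∫ x in Ω, ((meshSize 𝒯 x)⁻¹ * v.1 x) ^ 2 = clementError Ω 𝒯 v := by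
  have hint : ∀ T ∈ 𝒯, Integrable ((interior (cell T)).indicator
      fun x => (cellDiam T ^ 2)⁻¹ * v.1 x ^ 2) (volume.restrict Ω) := fun T _ =>
    ((integrable_sq v.1).const_mul _).indicator isOpen_interior.measurableSet
  have h1 : ∫ x in Ω, ((meshSize 𝒯 x)⁻¹ * v.1 x) ^ 2 = ∫ x in Ω, ∑ T ∈ 𝒯,
      (interior (cell T)).indicator (fun x => (cellDiam T ^ 2)⁻¹ * v.1 x ^ 2) x := by
    refine integral_congr_ae ?_
    filter_upwards [hM.ae_exists_mem_interior] with x hx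
    obtain ⟨T, hT, hxT⟩ := hx
    rw [hM.meshSize_eq hT hxT, Finset.sum_eq_single_of_mem T hT, Set.indicator_of_mem hxT, mul_pow,
      inv_pow]
    intro K hK hKT
    exact Set.indicator_of_notMem
      (fun hxK => Set.disjoint_left.1 (hM.disjoint_interior hK hT hKT) hxK hxT) _
  rw [h1, integral_finsetSum _ hint, hM.clementError_eq hb, hM.errorLp_eq_self hb hv]
  refine Finset.sum_congr rfl fun T _ => ?_
  rw [integral_indicator isOpen_interior.measurableSet, integral_const_mul,
    setIntegral_congr_set (interior_cell_ae_eq T Measure.absolutelyContinuous_restrict)]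

end IsRegularMesh

/-- The weighted Clément interpolation error in the mesh weighted norm is bounded by the gradient. -/
theorem exists_clementError_le (hd : 2 ≤ d) {Ω : Set (E d)} (hΩ : IsLipschitzDomain Ω)
    (γ : ℝ) : ∃ C : ℝ, 0 ≤ C ∧ ∀ 𝒯 : Finset (Finset (E d)), IsRegularMesh Ω 𝒯 →
      shapeRegularity 𝒯 ≤ γ → ∀ v ∈ H10 Ω, clementError Ω 𝒯 v ≤ C * ‖v.2‖ ^ 2 := by
  obtain ⟨C, hC, h⟩ := exists_clementError_le_of_test hd hΩ γ
  refine ⟨C, hC, fun 𝒯 hM hγ v hv => H10_subset_of_isClosed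
    (S := {v : Pairs Ω | clementError Ω 𝒯 v ≤ C * ‖v.2‖ ^ 2}) (isClosed_le
      (hM.continuous_clementError hΩ.isBounded) (by fun_prop)) (fun p hp => h 𝒯 hM hγ p hp) hv⟩

end TwoScale

end
-- The two-scale estimates
theorem theorem3p3 (d : ℕ) (hd : 2 ≤ d) (Ω : Set (E d)) (hΩ : IsLipschitzDomain Ω) (γ : ℝ) :
    ∃ C : ℝ, 0 < C ∧
      ∀ 𝒯 : Finset (Finset (E d)), IsRegularMesh Ω 𝒯 → shapeRegularity 𝒯 ≤ γ →
      ∀ (A : E d → Matrix (Fin d) (Fin d) ℝ) (α β : ℝ), IsCoefficient Ω A α β →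
      ∀ Vh : Submodule ℝ (Pairs Ω), VH Ω 𝒯 ≤ Vh → Vh ≤ H10 Ω →
      ∀ vc ∈ Vc Ω 𝒯 A Vh, ∀ vf ∈ Vf Ω 𝒯 Vh,
        inner ℝ vc.1 vf.1 ≤ C * (maxMeshSize 𝒯 ^ 2 * ‖vc.2‖ * ‖vf.2‖) ∧
        maxMeshSize 𝒯 ^ 2 * ‖vc.2‖ * ‖vf.2‖ ≤
          α⁻¹ * maxMeshSize 𝒯 ^ 2 * energyNorm Ω A vc * energyNorm Ω A vf ∧
        ‖vc.1‖ ^ 2 + (∫ x in Ω, ((meshSize 𝒯 x)⁻¹ * vf.1 x) ^ 2) ≤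
          C * (α⁻¹ * energyNorm Ω A (vc + vf) ^ 2) := by
  obtain ⟨C₁, hC₁, h₁⟩ := exists_clementError_le hd hΩ γ
  obtain ⟨C₂, hC₂, h₂⟩ := exists_norm_sq_le (by omega : 0 < d) hΩ.isBounded
  -- Both constants are only known to be non-negative; the `1` secures positivity.
  refine ⟨C₁ + C₂ + 1, by positivity, ?_⟩
  intro 𝒯 hM hγ A α β hA Vh hVH hVh vc hvc vf hvf
  have hb := hΩ.isBounded
  have hf10 : vf ∈ H10 Ω := hVh hvf.1
  have hc10 : vc ∈ H10 Ω := by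
    obtain ⟨v, hv, p, hp, rfl⟩ := hvc
    exact hVh (sub_mem (hVH hv) hp.1.1)
  have hα : 0 < α⁻¹ := inv_pos.2 hA.pos
  set H := maxMeshSize 𝒯 with hH
  refine ⟨?_, ?_, ?_⟩
  · have herr : ∀ v ∈ H10 Ω, ‖hM.errorLp hb v‖ ^ 2 ≤ C₁ * (H ^ 2 * ‖v.2‖ ^ 2) := fun v hv =>
      calc ‖hM.errorLp hb v‖ ^ 2 ≤ H ^ 2 * clementError Ω 𝒯 v :=
            hM.norm_errorLp_sq_le (by omega) hb v
        _ ≤ H ^ 2 * (C₁ * ‖v.2‖ ^ 2) := by gcongr; exact h₁ 𝒯 hM hγ v hv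
        _ = _ := by ring
    -- Replacing `v_c` by its interpolation error is what yields the second power of `H`.
    rw [hM.inner_eq_inner_errorLp hΩ.isOpen hb hvf vc]
    have hf := herr vf hf10
    rw [hM.errorLp_eq_self hb hvf] at hf
    have hprod : ‖hM.errorLp hb vc‖ * ‖vf.1‖ ≤ C₁ * (H ^ 2 * ‖vc.2‖ * ‖vf.2‖) := by
      refine (abs_le_of_sq_le_sq' ?_ (by positivity)).2
      calc (‖hM.errorLp hb vc‖ * ‖vf.1‖) ^ 2 = ‖hM.errorLp hb vc‖ ^ 2 * ‖vf.1‖ ^ 2 := by ring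
        _ ≤ (C₁ * (H ^ 2 * ‖vc.2‖ ^ 2)) * (C₁ * (H ^ 2 * ‖vf.2‖ ^ 2)) := by
            gcongr
            exact herr vc hc10
        _ = _ := by ring
    refine (real_inner_le_norm _ _).trans (hprod.trans ?_)
    gcongr
    linarith
  · calc H ^ 2 * ‖vc.2‖ * ‖vf.2‖ = H ^ 2 * (‖vc.2‖ * ‖vf.2‖) := by ring
      _ ≤ H ^ 2 * (α⁻¹ * (energyNorm Ω A vc * energyNorm Ω A vf)) := by
          exact mul_le_mul_of_nonneg_left (hA.norm_mul_norm_le vc vf) (sq_nonneg H)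
      _ = _ := by ring
  -- By `a`-orthogonality the energy of the sum splits, so `v_c` and `v_f` can be estimated
  -- separately.
  · rw [hM.integral_meshSize_inv_eq hb hvf,
      hA.energyNorm_add_sq (hA.energy_coarse_fine hvc hvf)]
    have hc := (h₂ vc hc10).trans (mul_le_mul_of_nonneg_left (hA.norm_sq_le vc) hC₂)
    have hf := (h₁ 𝒯 hM hγ vf hf10).trans (mul_le_mul_of_nonneg_left (hA.norm_sq_le vf) hC₁)
    have e1 : 0 ≤ α⁻¹ * energyNorm Ω A vc ^ 2 := by positivity
    have e2 : 0 ≤ α⁻¹ * energyNorm Ω A vf ^ 2 := by positivity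
    nlinarith [mul_nonneg hC₁ e1, mul_nonneg hC₂ e2]
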